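/- **Proposition (local determination of monodromy).** Let $(M,\omega)$ be a smooth 4-dimensional symplectic manifold with a Hamiltonian action of $\mathbb S^1=\mathbb R/2\pi\mathbb Z$ with momentum $J$ (generator $X_J$), free outside its fixed points; let $H$ be a smooth $\mathbb S^1$-invariant function with Hamiltonian vector field $X_H$, and $F=(H,J):M\to\mathbb R^2$, with compact and connected fibres. Let $\bar p$ be a (possibly degenerate) focus-focus point on a singly pinched torus, that is: $dF(\bar p)=0$, $\bar p$ is the only critical point of $F$ in a saturated neighbourhood of the fibre of $\bar v=F(\bar p)$, and $F^{-1}(\bar v)\setminus\{\bar p\}$ is homeomorphic to $\mathbb S^1\times(0,1)$. Let $U$ be an $\mathbb S^1$-invariant open neighbourhood of $\bar p$, $\Pi\subset U$, and let $\vartheta$ be a rotation 1-form on $U\setminus\Pi$, i.e. $U\setminus\Pi$ is open and $\mathbb S^1$-invariant and $\vartheta$ is a smooth closed 1-form on it with $\vartheta(X_J)=1$. Assume that $\vartheta$ is transversal to $F$: outside the fixed points of the action, $\Pi$ is a smooth 2-dimensional submanifold and $F|_\Pi$ has rank 1. Call $(B,D)$ an adapted pair if $B$ is an $\mathbb S^1$-invariant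 open neighbourhood of $\bar p$ and $D\subset\mathbb R^2$ is a contractible open neighbourhood of $\bar v$ such that, with $D^*=D\setminus\{\bar v\}$: $\bar p$ is the only critical point in $F^{-1}(D)$; $F^{-1}(D)\cap\partial B\to D$, $F^{-1}(D)\setminus B\to D$ and $F^{-1}(D^*)\cap\overline B\to D^*$ are, $\mathbb S^1$-equivariantly, isomorphic to the trivial bundles with fibres $\mathbb S^1\sqcup\mathbb S^1$, $\mathbb S^1\times[0,1]$ and $\mathbb S^1\times[0,1]$; $F^{-1}(D)\cap\overline B\subset U$; and $F^{-1}(D)\cap\partial B\cap\Pi=\emptyset$. Then: 1. Every neighbourhood of $\bar p$ contains the set $B$ of some adapted pair $(B,D)$. 2. Let $(B,D)$ be any adapted pair. For $v\in D^*$ such that $F^{-1}(v)\cap B\cap\Pi=\emptyset$, through each point of $F^{-1}(v)\cap B$ the part of the $X_H$-orbit inside $B$ is an orbit segment $\gamma^{\rm rel}_H$ over a bounded time interval with endpoints outside $B$, and $\Phi_{\rm rel}(v)=\int_{\gamma_H^{\rm rel}}\vartheta$ exists and does not depend on the choice of the segment in $F^{-1}(v)$. 3. Let moreover $\Gamma:\mathbb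 R/\mathbb Z\to D^*$ be a closed path with $\Gamma(s)\in F(\Pi\cap B)$ for only finitely many $s$. Then the torus bundle $F^{-1}(\Gamma)\to\Gamma$ has a well-defined monodromy number $k\in\mathbb Z$, and $$\operatorname{var}_\Gamma\Phi_{\rm rel}=-2\pi k .$$ Here $\operatorname{var}_\Gamma g=-\sum_j d_j$ for a function $g$ on the circle that is continuous except for finitely many jumps $d_j$ (right limit minus left limit). The monodromy number $k$ is defined by parallel transport of cycles along $\Gamma$: the cycle $c$ in the torus over $\Gamma(0)$ obtained by following an $X_H$-orbit until its first return to the $X_J$-orbit of its starting point, and then undoing the displacement $\Theta\in[0,2\pi)$ along $X_J$, is transported to the class $c+k\gamma_J$, where $\gamma_J$ is the class of an $X_J$-orbit. -/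

import Mathlib

open Set Filter Topology MeasureTheory
open scoped Manifold ContDiff

noncomputable section

/-- The model space of a four-dimensional manifold. -/
abbrev E4 : Type := EuclideanSpace ℝ (Fin 4)

section Forms

variable {M : Type*} [TopologicalSpace M] [ChartedSpace E4 M]

/-- The 1-form `θ` written in the chart at `x₀`. -/
def chartOneForm (θ : (p : M) → TangentSpace (𝓡 4) p →L[ℝ] ℝ) (x₀ : M) (y : E4) : E4 →L[ℝ] ℝ :=
  (θ ((extChartAt (𝓡 4) x₀).symm y)).comp
    (mfderiv 𝓘(ℝ, E4) (𝓡 4) (extChartAt (𝓡 4) x₀).symm y)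

/-- The value of the bilinear form `w`, written in the chart at `x₀`, on the constant
vectors `u`, `v`. -/
def chartTwoForm (w : (p : M) → TangentSpace (𝓡 4) p →L[ℝ] TangentSpace (𝓡 4) p →L[ℝ] ℝ)
    (x₀ : M) (u v : E4) (y : E4) : ℝ :=
  w ((extChartAt (𝓡 4) x₀).symm y)
    (mfderiv 𝓘(ℝ, E4) (𝓡 4) (extChartAt (𝓡 4) x₀).symm y u)
    (mfderiv 𝓘(ℝ, E4) (𝓡 4) (extChartAt (𝓡 4) x₀).symm y v)

/-- `w` is a symplectic form: a smooth, alternating, nondegenerate and closed 2-form. -/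
structure IsSymplecticForm
    (w : (p : M) → TangentSpace (𝓡 4) p →L[ℝ] TangentSpace (𝓡 4) p →L[ℝ] ℝ) : Prop where
  alternating : ∀ p u, w p u u = 0
  nondegenerate : ∀ p u, (∀ v, w p u v = 0) → u = 0
  smooth : ∀ x₀ u v, ContDiffOn ℝ ∞ (chartTwoForm w x₀ u v) (extChartAt (𝓡 4) x₀).target
  closed : ∀ x₀, ∀ y ∈ (extChartAt (𝓡 4) x₀).target, ∀ a b c : E4,
    fderiv ℝ (chartTwoForm w x₀ b c) y a + fderiv ℝ (chartTwoForm w x₀ c a) y b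
      + fderiv ℝ (chartTwoForm w x₀ a b) y c = 0

/-- `X` is the Hamiltonian vector field of `f`. -/
def IsHamiltonianField
    (w : (p : M) → TangentSpace (𝓡 4) p →L[ℝ] TangentSpace (𝓡 4) p →L[ℝ] ℝ)
    (f : M → ℝ) (X : (p : M) → TangentSpace (𝓡 4) p) : Prop :=
  ∀ p v, w p (X p) v = mfderiv (𝓡 4) 𝓘(ℝ, ℝ) f p v

end Forms

section System

variable {M : Type*} [TopologicalSpace M] [ChartedSpace E4 M] [MulAction Circle M]

/-- The circle action on `M` (of period `2π`, through `Circle.exp`) is a Hamiltonian action with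
momentum `J`: it is smooth and symplectic, and its generator is the Hamiltonian vector
field `XJ` of `J`. -/
structure IsHamiltonianCircleAction
    (w : (p : M) → TangentSpace (𝓡 4) p →L[ℝ] TangentSpace (𝓡 4) p →L[ℝ] ℝ)
    (J : M → ℝ) (XJ : (p : M) → TangentSpace (𝓡 4) p) : Prop where
  smooth : ContMDiff ((𝓡 1).prod (𝓡 4)) (𝓡 4) ∞ (fun q : Circle × M => q.1 • q.2)
  symplectic : ∀ (z : Circle) (p : M) (u v : TangentSpace (𝓡 4) p),
    w (z • p) (mfderiv (𝓡 4) (𝓡 4) (fun q : M => z • q) p u)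
      (mfderiv (𝓡 4) (𝓡 4) (fun q : M => z • q) p v) = w p u v
  momentum : IsHamiltonianField w J XJ
  generator : ∀ p : M, IsMIntegralCurve (I := 𝓡 4) (fun t : ℝ => Circle.exp t • p) XJ

/-- `p` is a regular point of `F`. -/
def IsRegularPt (F : M → ℝ × ℝ) (p : M) : Prop :=
  Function.Surjective (mfderiv (𝓡 4) 𝓘(ℝ, ℝ × ℝ) F p)

/-- `pbar` is a (possibly degenerate) focus-focus point on a singly pinched torus: a rank-zero
point of `F` which is the only critical point of `F` in a saturated neighbourhood of its fibre,
and whose removal from the fibre leaves an open cylinder. -/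
structure IsFocusFocus (F : M → ℝ × ℝ) (pbar : M) : Prop where
  rank_zero : mfderiv (𝓡 4) 𝓘(ℝ, ℝ × ℝ) F pbar = 0
  isolated : ∃ V ∈ 𝓝 (F pbar), ∀ p, F p ∈ V → p ≠ pbar → IsRegularPt F p
  pinched : Nonempty ({p : M // F p = F pbar ∧ p ≠ pbar} ≃ₜ Circle × Ioo (0 : ℝ) 1)

/-- `θ` is a rotation 1-form defined on the open invariant set `S`: a smooth closed 1-form
on `S` with `θ(XJ) = 1`. Values of `θ` outside `S` are irrelevant. -/
structure IsRotationForm (XJ : (p : M) → TangentSpace (𝓡 4) p)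
    (θ : (p : M) → TangentSpace (𝓡 4) p →L[ℝ] ℝ) (S : Set M) : Prop where
  isOpen : IsOpen S
  invariant : ∀ (z : Circle), ∀ p ∈ S, z • p ∈ S
  smooth : ∀ x₀, ContDiffOn ℝ ∞ (chartOneForm θ x₀)
    ((extChartAt (𝓡 4) x₀).target ∩ (extChartAt (𝓡 4) x₀).symm ⁻¹' S)
  closed : ∀ x₀, ∀ y ∈ (extChartAt (𝓡 4) x₀).target ∩ (extChartAt (𝓡 4) x₀).symm ⁻¹' S,
    ∀ u v : E4, fderiv ℝ (chartOneForm θ x₀) y u v = fderiv ℝ (chartOneForm θ x₀) y v u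
  rotation : ∀ p ∈ S, θ p (XJ p) = 1

/-- The polar set `P` is, away from the fixed points of the action, a smooth two-dimensional
submanifold (locally the zero set of a submersion `g` to the plane, with tangent
space `ker dg`), and the restriction of `F` to it has rank one there. -/
def IsTransversalPolarSet (F : M → ℝ × ℝ) (P : Set M) : Prop :=
  ∀ x ∈ P, (∃ z : Circle, z • x ≠ x) →
    ∃ (N : Set M) (g : M → ℝ × ℝ), IsOpen N ∧ x ∈ N ∧
      ContMDiffOn (𝓡 4) 𝓘(ℝ, ℝ × ℝ) ∞ g N ∧ (∀ y ∈ N, y ∈ P ↔ g y = 0) ∧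
      Function.Surjective (mfderiv (𝓡 4) 𝓘(ℝ, ℝ × ℝ) g x) ∧
      Module.finrank ℝ
        ((LinearMap.ker (mfderiv (𝓡 4) 𝓘(ℝ, ℝ × ℝ) g x).toLinearMap).map
          (mfderiv (𝓡 4) 𝓘(ℝ, ℝ × ℝ) F x).toLinearMap) = 1

/-- The part of `S` over `D` is, through `F` and compatibly with the circle action, isomorphic to
the trivial bundle over `D` with fibre `S¹ × Y`. -/
def IsTrivialOver (F : M → ℝ × ℝ) (S : Set M) (D : Set (ℝ × ℝ)) (Y : Type)
    [TopologicalSpace Y] : Prop :=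
  ∃ e : ↥(F ⁻¹' D ∩ S) ≃ₜ ↥D × (Circle × Y),
    (∀ x, ((e x).1 : ℝ × ℝ) = F x) ∧
    ∀ (z : Circle) (x x' : ↥(F ⁻¹' D ∩ S)), (x' : M) = z • (x : M) →
      (e x').2 = (z * (e x).2.1, (e x).2.2)

/-- `B` is an invariant open neighbourhood of `pbar` and `D` an open contractible neighbourhood
of its value, without other critical points over `D`, such that over `D` the boundary of `B` is
`D × (S¹ ⊔ S¹)` and the complement of `B` is `D × (S¹ × [0,1])`, and over `D` without the critical
value the closure of `B` is trivial with fibre `S¹ × [0,1]`. -/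
structure IsLocalPair (F : M → ℝ × ℝ) (pbar : M) (B : Set M) (D : Set (ℝ × ℝ)) : Prop where
  isOpen_ball : IsOpen B
  mem_ball : pbar ∈ B
  invariant : ∀ (z : Circle), ∀ p ∈ B, z • p ∈ B
  isOpen_disk : IsOpen D
  mem_disk : F pbar ∈ D
  contractible_disk : ContractibleSpace ↥D
  regular : ∀ p, F p ∈ D → p ≠ pbar → IsRegularPt F p
  boundary : IsTrivialOver F (frontier B) D Bool
  complement : IsTrivialOver F Bᶜ D unitInterval
  inside : IsTrivialOver F (closure B) (D \ {F pbar}) unitInterval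

/-- The pair `B`, `D` is adapted to a rotation form with polar set `P` in the domain `U`: over `D`
the closure of `B` lies in `U`, and the boundary of `B` contains no poles. -/
structure IsAdaptedPair (F : M → ℝ × ℝ) (pbar : M) (U P B : Set M) (D : Set (ℝ × ℝ)) : Prop
    extends IsLocalPair F pbar B D where
  closure_subset : F ⁻¹' D ∩ closure B ⊆ U
  no_boundary_poles : F ⁻¹' D ∩ frontier B ∩ P = ∅

/-- `γ`, restricted to `[a,b]`, is the part inside `B` of an orbit of `XH`. -/
def IsRelSegment (XH : (p : M) → TangentSpace (𝓡 4) p) (B : Set M)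
    (γ : ℝ → M) (a b : ℝ) : Prop :=
  IsMIntegralCurve (I := 𝓡 4) γ XH ∧ a < b ∧ (∀ t ∈ Ioo a b, γ t ∈ B) ∧ γ a ∉ B ∧ γ b ∉ B

open Classical in
/-- `Φ_rel(v)`: the integral of `θ` along the part inside `B` of an orbit of `XH` in the fibre
over `v` (any such orbit; zero if there is none). -/
def phiRel (F : M → ℝ × ℝ) (XH : (p : M) → TangentSpace (𝓡 4) p)
    (θ : (p : M) → TangentSpace (𝓡 4) p →L[ℝ] ℝ) (B : Set M) (v : ℝ × ℝ) : ℝ :=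
  if h : ∃ φ : ℝ, ∃ (γ : ℝ → M) (a b : ℝ), IsRelSegment XH B γ a b ∧ F (γ a) = v ∧
      φ = ∫ t in a..b, θ (γ t) (XH (γ t))
  then h.choose else 0

/-- `c` is the cycle generated by the second action: follow an orbit of `XH` until its first
return, at time `T`, to the circle orbit from which it started, and undo the rotation number `Θ`
along the circle action. (A loop of period one.) -/
def IsReturnCycle (XH : (p : M) → TangentSpace (𝓡 4) p) (c : ℝ → M) : Prop :=
  ∃ (γ : ℝ → M) (T Θ : ℝ), IsMIntegralCurve (I := 𝓡 4) γ XH ∧ 0 < T ∧ 0 ≤ Θ ∧ Θ < 2 * Real.pi ∧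
    γ T = Circle.exp Θ • γ 0 ∧ (∀ t ∈ Ioo 0 T, ∀ z : Circle, γ t ≠ z • γ 0) ∧
    ∀ t, c t = Circle.exp (-(Θ * t)) • γ (T * t)

/-- Parallel transport of cycles along `Γ`: there is a continuous family, over the parameters
`s ∈ [0,1]`, of loops (of period one) in the fibres over `Γ s`, from the loop `c₀` to the
loop `c₁`. -/
def TransportsTo (F : M → ℝ × ℝ) (Γ : ℝ → ℝ × ℝ) (c₀ c₁ : ℝ → M) : Prop :=
  ∃ C : ℝ × ℝ → M, ContinuousOn C (Icc 0 1 ×ˢ univ) ∧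
    (∀ s ∈ Icc (0 : ℝ) 1, ∀ t, C (s, t + 1) = C (s, t) ∧ F (C (s, t)) = Γ s) ∧
    (∀ t, C (0, t) = c₀ t) ∧ ∀ t, C (1, t) = c₁ t

/-- `k` is the monodromy number of the torus bundle over the closed path `Γ` (of period one).
With `γ_J` the class of the circle orbits and `c` the return cycle, `(γ_J, c)` is a basis of the
first homology of the torus over `Γ 0`; homology classes of a torus are the same as free homotopy
classes of loops, and `t ↦ exp (2πikt) • c t` is a loop in the class `c + k γ_J`. So the condition
says that monodromy sends `c` to `c + k γ_J`, while it fixes `γ_J`. -/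
def IsMonodromyNumber (F : M → ℝ × ℝ) (XH : (p : M) → TangentSpace (𝓡 4) p)
    (Γ : ℝ → ℝ × ℝ) (k : ℤ) : Prop :=
  ∃ c : ℝ → M, IsReturnCycle XH c ∧
    TransportsTo F Γ c (fun t => Circle.exp (2 * Real.pi * k * t) • c t)

end System

/-- The variation of a function on the circle, written as a function `g` of period one, is `v`:
`g` is continuous except for finitely many jumps (where its values do not matter), and `v` is
minus the sum of the jumps. -/
def HasVariation (g : ℝ → ℝ) (v : ℝ) : Prop :=
  ∃ (S : Finset ℝ) (l r : ℝ → ℝ), (S : Set ℝ) ⊆ Ico 0 1 ∧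
    (∀ s ∈ Ico (0 : ℝ) 1, s ∉ S → ContinuousAt g s) ∧
    (∀ s ∈ S, Tendsto g (𝓝[<] s) (𝓝 (l s)) ∧ Tendsto g (𝓝[>] s) (𝓝 (r s))) ∧
    v = -∑ s ∈ S, (r s - l s)

end

/-! Over `D \ {F pbar}` each fibre is a torus which the flow `φ` of `XH` crosses in two stages. From
a point `σ₁ v` of one boundary circle of `B` it crosses `B` in time `τB v` and reaches `ζB v • σ₂ v`
on the other circle; it then crosses the complement in time `τC v` and comes back to `ζC v • σ₁ v`
(`IsTransitSystem`). So the first return takes time `τB v + τC v`, and the rotation number is a real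
lift of `ζB v * ζC v`.

Monodromy is the degree of this holonomy. Let `Θ` be a continuous lift along `Γ`, with `Θ 1 = Θ 0 +
2πm`. Undoing the rotation by `Θ s` gives a continuous family of loops that carries the return cycle
`c` to `exp(-2πmt) • c t`, so `k = -m` is a monodromy number. It is the only one: the torus has a
circle coordinate which is constant along `c` and winds once along circle orbits, and its winding
number is preserved by transport (`monodromyNumber_eq`). The complement of `B` is a trivial bundle
over the whole contractible `D`, critical value included, so `ζC` lifts to a function on `D` and
contributes no winding. Hence `m` is the degree along `Γ` of `ζB`, which lives inside `B`.

The same degree governs `Φ_rel`. As the boundary of `B` has no poles and `D` is contractible, the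
closed form has primitives `G₁` along `σ₁` and `G₂` along the rotated section `exp u • σ₂`, and `G₂`
grows by `u` under rotation because `ϑ(X_J) = 1`. With `α` a lift of `ζB` along `Γ`, the function
`G₂ (Γ s, α s) - G₁ (Γ s)` is continuous and gains `2πm` in one turn. On intervals without polar
values the segments fill a strip on which `ϑ` has a primitive, so there `Φ_rel` differs from this
function by a constant (`IsTransitSystem.hasVariation_phiRel`). Since `Φ_rel ∘ Γ` is periodic, its
jumps must cancel the gain: minus their sum is `2πm = -2πk`.

The crossings rest on `IsCylinderBundle.not_isLocalExtr`: along the flow the transversal coordinate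
of a cylinder has no local extremum, since otherwise the orbit would meet one circle orbit twice in
a short time. So the coordinate is monotone and the flow goes from one boundary circle to the other;
transit times are continuous because crossing is an open condition.

For the existence of small pairs, the pinched fibre without `pbar` is one orbit of the joint action,
without returns: a returning orbit is compact, a cylinder is not. Thus the part outside a given
neighbourhood of `pbar` takes a bounded time. A tube of nearby orbit segments covering that time is
removed from `F ⁻¹' D`, for a small disk `D`; what remains is `B` (`IsTube.isLocalPair`).
Transversality prevents an arc of the orbit from lying in the polar set, so the ends of the tube can
be chosen free of poles. -/

set_option linter.unusedSectionVars false

/-! ### Hamiltonian vector fields in charts -/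

noncomputable section

section Charts

variable {M : Type*} [TopologicalSpace M] [ChartedSpace E4 M]

/-- The vector field `X` written in the chart at `x₀`. -/
def chartField (X : (p : M) → TangentSpace (𝓡 4) p) (x₀ : M) (y : E4) : E4 :=
  mfderiv (𝓡 4) 𝓘(ℝ, E4) (extChartAt (𝓡 4) x₀) ((extChartAt (𝓡 4) x₀).symm y)
    (X ((extChartAt (𝓡 4) x₀).symm y))

variable [IsManifold (𝓡 4) ∞ M]

instance isManifold_one_of_infty : IsManifold (𝓡 4) 1 M :=
  IsManifold.of_le (n := ∞) (by simp)

lemma mfderiv_chart_symm_comp {x₀ : M} {y : E4} (hy : y ∈ (extChartAt (𝓡 4) x₀).target)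
    (u : TangentSpace (𝓡 4) ((extChartAt (𝓡 4) x₀).symm y)) :
    mfderiv 𝓘(ℝ, E4) (𝓡 4) (extChartAt (𝓡 4) x₀).symm y
      (mfderiv (𝓡 4) 𝓘(ℝ, E4) (extChartAt (𝓡 4) x₀) ((extChartAt (𝓡 4) x₀).symm y) u) = u := by
  have := mfderivWithin_extChartAt_symm_comp_mfderiv_extChartAt (I := 𝓡 4) hy
  simp only [modelWithCornersSelf_coe, range_id, mfderivWithin_univ] at this
  exact DFunLike.congr_fun this u

lemma mfderiv_chart_comp_symm {x₀ : M} {y : E4} (hy : y ∈ (extChartAt (𝓡 4) x₀).target)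
    (u : E4) :
    mfderiv (𝓡 4) 𝓘(ℝ, E4) (extChartAt (𝓡 4) x₀) ((extChartAt (𝓡 4) x₀).symm y)
      (mfderiv 𝓘(ℝ, E4) (𝓡 4) (extChartAt (𝓡 4) x₀).symm y u) = u := by
  have := mfderiv_extChartAt_comp_mfderivWithin_extChartAt_symm (I := 𝓡 4) hy
  simp only [modelWithCornersSelf_coe, range_id, mfderivWithin_univ] at this
  exact DFunLike.congr_fun this u

lemma mfderiv_symm_chartField (X : (p : M) → TangentSpace (𝓡 4) p) {x₀ : M} {y : E4}
    (hy : y ∈ (extChartAt (𝓡 4) x₀).target) :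
    mfderiv 𝓘(ℝ, E4) (𝓡 4) (extChartAt (𝓡 4) x₀).symm y (chartField X x₀ y)
      = X ((extChartAt (𝓡 4) x₀).symm y) :=
  mfderiv_chart_symm_comp hy _

lemma isOpen_chart_target (x₀ : M) : IsOpen (extChartAt (𝓡 4) x₀).target :=
  isOpen_extChartAt_target x₀

lemma mdifferentiableAt_chart_symm {x₀ : M} {y : E4} (hy : y ∈ (extChartAt (𝓡 4) x₀).target) :
    MDifferentiableAt 𝓘(ℝ, E4) (𝓡 4) (extChartAt (𝓡 4) x₀).symm y :=
  (mdifferentiableOn_extChartAt_symm (I := 𝓡 4) y hy).mdifferentiableAt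
    ((isOpen_chart_target x₀).mem_nhds hy)

/-- The bilinear form `w` in the chart at `x₀`, as a bilinear map. -/
def chartBilin (w : (p : M) → TangentSpace (𝓡 4) p →L[ℝ] TangentSpace (𝓡 4) p →L[ℝ] ℝ)
    (x₀ : M) (y : E4) : E4 →L[ℝ] E4 →L[ℝ] ℝ :=
  ContinuousLinearMap.bilinearComp (E := E4) (F := E4) (w ((extChartAt (𝓡 4) x₀).symm y))
    (mfderiv 𝓘(ℝ, E4) (𝓡 4) (extChartAt (𝓡 4) x₀).symm y)
    (mfderiv 𝓘(ℝ, E4) (𝓡 4) (extChartAt (𝓡 4) x₀).symm y)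

lemma chartBilin_apply (w : (p : M) → TangentSpace (𝓡 4) p →L[ℝ] TangentSpace (𝓡 4) p →L[ℝ] ℝ)
    (x₀ : M) (y u v : E4) : chartBilin w x₀ y u v = chartTwoForm w x₀ u v y := rfl

variable {w : (p : M) → TangentSpace (𝓡 4) p →L[ℝ] TangentSpace (𝓡 4) p →L[ℝ] ℝ}

lemma contDiffOn_chartBilin (hw : IsSymplecticForm w) (x₀ : M) :
    ContDiffOn ℝ ∞ (chartBilin w x₀) (extChartAt (𝓡 4) x₀).target := by
  rw [contDiffOn_clm_apply]
  intro u
  rw [contDiffOn_clm_apply]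
  intro v
  exact hw.smooth x₀ u v

lemma chartBilin_injective (hw : IsSymplecticForm w) {x₀ : M} {y : E4}
    (hy : y ∈ (extChartAt (𝓡 4) x₀).target) : Function.Injective (chartBilin w x₀ y) := by
  rw [injective_iff_map_eq_zero]
  intro u hu
  have h1 : mfderiv 𝓘(ℝ, E4) (𝓡 4) (extChartAt (𝓡 4) x₀).symm y u = 0 := by
    apply hw.nondegenerate
    intro v
    have h : w ((extChartAt (𝓡 4) x₀).symm y)
        (mfderiv 𝓘(ℝ, E4) (𝓡 4) (extChartAt (𝓡 4) x₀).symm y u)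
        (mfderiv 𝓘(ℝ, E4) (𝓡 4) (extChartAt (𝓡 4) x₀).symm y
          (mfderiv (𝓡 4) 𝓘(ℝ, E4) (extChartAt (𝓡 4) x₀) ((extChartAt (𝓡 4) x₀).symm y) v)) = 0 :=
      DFunLike.congr_fun hu _
    rwa [mfderiv_chart_symm_comp hy] at h
  have h2 := mfderiv_chart_comp_symm hy u
  rw [h1, map_zero] at h2
  exact h2.symm

/-- In the chart the equation defining a Hamiltonian field is a linear system with smooth invertible
matrix. Solving it is how smoothness of the field, which is not assumed, is obtained. -/
lemma chartBilin_chartField {f : M → ℝ} (hf : ContMDiff (𝓡 4) 𝓘(ℝ, ℝ) ∞ f)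
    {X : (p : M) → TangentSpace (𝓡 4) p} (hX : IsHamiltonianField w f X) {x₀ : M} {y : E4}
    (hy : y ∈ (extChartAt (𝓡 4) x₀).target) :
    chartBilin w x₀ y (chartField X x₀ y) = fderiv ℝ (f ∘ (extChartAt (𝓡 4) x₀).symm) y := by
  ext v
  rw [chartBilin_apply, chartTwoForm, mfderiv_symm_chartField X hy, hX, ← mfderiv_eq_fderiv,
    mfderiv_comp y (hf.mdifferentiable (by simp) _) (mdifferentiableAt_chart_symm hy)]
  rfl

/-- A Hamiltonian vector field is smooth in every chart. -/
lemma contDiffOn_chartField (hw : IsSymplecticForm w) {f : M → ℝ}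
    (hf : ContMDiff (𝓡 4) 𝓘(ℝ, ℝ) ∞ f)
    {X : (p : M) → TangentSpace (𝓡 4) p} (hX : IsHamiltonianField w f X) (x₀ : M) :
    ContDiffOn ℝ ∞ (chartField X x₀) (extChartAt (𝓡 4) x₀).target := by
  have hfc : ContDiffOn ℝ ∞ (f ∘ (extChartAt (𝓡 4) x₀).symm) (extChartAt (𝓡 4) x₀).target := by
    rw [← contMDiffOn_iff_contDiffOn]
    exact hf.comp_contMDiffOn (contMDiffOn_extChartAt_symm x₀)
  have hd : ContDiffOn ℝ ∞ (fderiv ℝ (f ∘ (extChartAt (𝓡 4) x₀).symm))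
      (extChartAt (𝓡 4) x₀).target :=
    hfc.fderiv_of_isOpen (isOpen_chart_target x₀) (by simp)
  have he : ∀ y ∈ (extChartAt (𝓡 4) x₀).target, ∃ e : E4 ≃L[ℝ] (E4 →L[ℝ] ℝ),
      (e : E4 →L[ℝ] E4 →L[ℝ] ℝ) = chartBilin w x₀ y := fun y hy =>
    ⟨(LinearEquiv.ofInjectiveOfFinrankEq (chartBilin w x₀ y).toLinearMap
      (chartBilin_injective hw hy) (by
        rw [← (LinearMap.toContinuousLinearMap (E := E4) (F' := ℝ)).finrank_eq]
        exact (Subspace.dual_finrank_eq (K := ℝ) (V := E4)).symm)).toContinuousLinearEquiv,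
      by ext u v; rfl⟩
  have h0 : ∀ y ∈ (extChartAt (𝓡 4) x₀).target, chartField X x₀ y =
      (chartBilin w x₀ y).inverse (fderiv ℝ (f ∘ (extChartAt (𝓡 4) x₀).symm) y) := by
    intro y hy
    obtain ⟨e, he⟩ := he y hy
    rw [← chartBilin_chartField hf hX hy, ← he, ContinuousLinearMap.inverse_equiv]
    simp
  intro y hy
  obtain ⟨e, he⟩ := he y hy
  have h1 : ContDiffWithinAt ℝ ∞ (fun y => (chartBilin w x₀ y).inverse)
      (extChartAt (𝓡 4) x₀).target y := by
    have := contDiffAt_map_inverse (n := ∞) e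
    rw [he] at this
    exact this.comp_contDiffWithinAt y (contDiffOn_chartBilin hw x₀ y hy)
  exact (h1.clm_apply (hd y hy)).congr h0 (h0 y hy)

/-- A vector field which is smooth in charts is a smooth section of the tangent bundle. -/
lemma contMDiff_section_of_chartField {X : (p : M) → TangentSpace (𝓡 4) p}
    (hX : ∀ x₀ : M, ContDiffOn ℝ ∞ (chartField X x₀) (extChartAt (𝓡 4) x₀).target) :
    ContMDiff (𝓡 4) (𝓡 4).tangent 1 (fun p => (⟨p, X p⟩ : TangentBundle (𝓡 4) M)) := by
  intro x₀
  rw [Bundle.contMDiffAt_section]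
  have h1 : ContMDiffAt (𝓡 4) 𝓘(ℝ, E4) 1 (chartField X x₀ ∘ extChartAt (𝓡 4) x₀) x₀ := by
    have h2 : ContDiffAt ℝ 1 (chartField X x₀) (extChartAt (𝓡 4) x₀ x₀) :=
      ((hX x₀).contDiffAt ((isOpen_chart_target x₀).mem_nhds
        (mem_extChartAt_target x₀))).of_le (by simp)
    exact h2.contMDiffAt.comp x₀ contMDiffAt_extChartAt
  refine h1.congr_of_eventuallyEq ?_
  filter_upwards [extChartAt_source_mem_nhds (I := 𝓡 4) x₀] with p hp
  have hp' : p ∈ (chartAt E4 x₀).source := by rwa [extChartAt_source] at hp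
  have h3 := DFunLike.congr_fun
    (TangentBundle.continuousLinearMapAt_trivializationAt (I := 𝓡 4) hp') (X p)
  have h4 : (trivializationAt E4 (TangentSpace (𝓡 4)) x₀).continuousLinearMapAt ℝ p (X p)
      = (trivializationAt E4 (TangentSpace (𝓡 4)) x₀ ⟨p, X p⟩).2 := by
    rw [Bundle.Trivialization.continuousLinearMapAt_apply,
      Bundle.Trivialization.linearMapAt_apply, if_pos]
    rw [TangentBundle.trivializationAt_baseSet]; exact hp'
  have h5 : chartField X x₀ (extChartAt (𝓡 4) x₀ p)
      = mfderiv (𝓡 4) 𝓘(ℝ, E4) (extChartAt (𝓡 4) x₀) p (X p) := by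
    rw [chartField, (extChartAt (𝓡 4) x₀).left_inv hp]
  exact h4.symm.trans (h3.trans h5.symm)

/-- In a chart, an integral curve solves the corresponding differential equation. -/
lemma hasDerivAt_chart_comp {X : (p : M) → TangentSpace (𝓡 4) p} {γ : ℝ → M} {t : ℝ} {x₀ : M}
    (hγ : HasMFDerivAt 𝓘(ℝ, ℝ) (𝓡 4) γ t ((1 : ℝ →L[ℝ] ℝ).smulRight (X (γ t))))
    (hs : γ t ∈ (extChartAt (𝓡 4) x₀).source) :
    HasDerivAt (extChartAt (𝓡 4) x₀ ∘ γ) (chartField X x₀ (extChartAt (𝓡 4) x₀ (γ t))) t := by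
  have hs' : γ t ∈ (chartAt E4 x₀).source := by rwa [extChartAt_source] at hs
  have h1 := (mdifferentiableAt_extChartAt (I := 𝓡 4) hs').hasMFDerivAt.comp t hγ
  have h5 : chartField X x₀ (extChartAt (𝓡 4) x₀ (γ t))
      = mfderiv (𝓡 4) 𝓘(ℝ, E4) (extChartAt (𝓡 4) x₀) (γ t) (X (γ t)) := by
    rw [chartField, (extChartAt (𝓡 4) x₀).left_inv hs]
  have h2 : HasFDerivAt (extChartAt (𝓡 4) x₀ ∘ γ) _ t := hasMFDerivAt_iff_hasFDerivAt.1 h1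
  rw [hasDerivAt_iff_hasFDerivAt]
  refine h2.congr_fderiv (ContinuousLinearMap.ext fun r : ℝ => ?_)
  rw [h5]
  exact map_smul (mfderiv (𝓡 4) 𝓘(ℝ, E4) (extChartAt (𝓡 4) x₀) (γ t)) r (X (γ t))

/-- A solution of the differential equation in a chart gives an integral curve. -/
lemma hasMFDerivAt_symm_comp {X : (p : M) → TangentSpace (𝓡 4) p} {α : ℝ → E4} {t : ℝ} {x₀ : M}
    (hα : HasDerivAt α (chartField X x₀ (α t)) t)
    (hs : α t ∈ (extChartAt (𝓡 4) x₀).target) :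
    HasMFDerivAt 𝓘(ℝ, ℝ) (𝓡 4) ((extChartAt (𝓡 4) x₀).symm ∘ α) t
      ((1 : ℝ →L[ℝ] ℝ).smulRight (X (((extChartAt (𝓡 4) x₀).symm ∘ α) t))) := by
  have h1 := (mdifferentiableAt_chart_symm hs).hasMFDerivAt.comp t
    (hasDerivAt_iff_hasFDerivAt.1 hα).hasMFDerivAt
  refine h1.congr_mfderiv (ContinuousLinearMap.ext fun r : ℝ => ?_)
  exact (map_smul (mfderiv 𝓘(ℝ, E4) (𝓡 4) (extChartAt (𝓡 4) x₀).symm (α t)) r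
    (chartField X x₀ (α t))).trans (congrArg (fun u => r • u) (mfderiv_symm_chartField X hs))

end Charts

end

/-! ### Integral curves and global flows -/

noncomputable section

section GlobalFlow

variable {M : Type*} [TopologicalSpace M] [ChartedSpace E4 M] [IsManifold (𝓡 4) ∞ M]
  {X : (p : M) → TangentSpace (𝓡 4) p}

/-- A vector field which is smooth in charts has a continuous local flow. -/
lemma exists_local_flow
    (hX : ∀ x₀ : M, ContDiffOn ℝ ∞ (chartField X x₀) (extChartAt (𝓡 4) x₀).target) (x₀ : M) :
    ∃ ε > 0, ∃ N ∈ 𝓝 x₀, ∃ ψ : M × ℝ → M, ContinuousOn ψ (N ×ˢ Ioo (-ε) ε) ∧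
      ∀ x ∈ N, ψ (x, 0) = x ∧ IsMIntegralCurveOn (I := 𝓡 4) (fun t => ψ (x, t)) X (Ioo (-ε) ε) := by
  have h2 : ContDiffAt ℝ 1 (chartField X x₀) (extChartAt (𝓡 4) x₀ x₀) :=
    ((hX x₀).contDiffAt ((isOpen_chart_target x₀).mem_nhds
      (mem_extChartAt_target x₀))).of_le (by simp)
  obtain ⟨ε, hε, a, r, L, K, hr, hpl⟩ := IsPicardLindelof.of_contDiffAt_one h2
  obtain ⟨α, hα, hαc⟩ := (hpl 0).exists_forall_mem_closedBall_eq_hasDerivWithinAt_continuousOn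
  simp only [zero_sub, zero_add] at hα hαc
  set y₀ := extChartAt (𝓡 4) x₀ x₀ with hy₀
  have hc0 : ContinuousAt α (y₀, 0) := by
    refine hαc.continuousAt (prod_mem_nhds (Metric.closedBall_mem_nhds _ hr) (Icc_mem_nhds ?_ hε))
    linarith
  have hα0 : α (y₀, 0) = y₀ := (hα y₀ (Metric.mem_closedBall_self r.2)).1
  -- Start and time are restricted so that the solution in the chart stays in its target and can be
  -- carried back to `M`.
  have ht : ∀ᶠ z in 𝓝 (y₀, (0 : ℝ)), α z ∈ (extChartAt (𝓡 4) x₀).target := by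
    apply hc0.eventually_mem
    rw [hα0]
    exact (isOpen_chart_target x₀).mem_nhds (mem_extChartAt_target x₀)
  rw [nhds_prod_eq, eventually_prod_iff] at ht
  obtain ⟨pa, hpa, pb, hpb, hab⟩ := ht
  obtain ⟨δ, hδ, hδb⟩ := Metric.eventually_nhds_iff.1 hpb
  have hN : ∀ᶠ x in 𝓝 x₀, x ∈ (extChartAt (𝓡 4) x₀).source ∧
      extChartAt (𝓡 4) x₀ x ∈ Metric.closedBall y₀ r ∧ pa (extChartAt (𝓡 4) x₀ x) := by
    refine Filter.Eventually.and (Filter.eventually_mem_set.2 (extChartAt_source_mem_nhds (I := 𝓡 4) x₀))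
      (Filter.Eventually.and ?_ ?_)
    · exact (continuousAt_extChartAt x₀).eventually_mem (Metric.closedBall_mem_nhds _ hr)
    · exact (continuousAt_extChartAt x₀).eventually hpa
  refine ⟨min ε δ, lt_min hε hδ, _, hN,
    fun z => (extChartAt (𝓡 4) x₀).symm (α (extChartAt (𝓡 4) x₀ z.1, z.2)), ?_, ?_⟩
  · refine (continuousOn_extChartAt_symm x₀).comp (hαc.comp ?_ ?_) ?_
    · exact ContinuousOn.prodMk ((continuousOn_extChartAt x₀).comp continuousOn_fst
        (fun z hz => hz.1.1)) continuousOn_snd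
    · rintro ⟨x, t⟩ ⟨hx, ht⟩
      have := min_le_left ε δ
      exact ⟨hx.2.1, ⟨by linarith [ht.1], by linarith [ht.2]⟩⟩
    · rintro ⟨x, t⟩ ⟨hx, ht⟩
      refine hab hx.2.2 (hδb ?_)
      have := min_le_right ε δ
      rw [Real.dist_eq, sub_zero, abs_lt]
      exact ⟨by linarith [ht.1], by linarith [ht.2]⟩
  · rintro x ⟨hx1, hx2, hx3⟩
    refine ⟨?_, fun t ht => ?_⟩
    · simp only [(hα _ hx2).1]
      exact (extChartAt (𝓡 4) x₀).left_inv hx1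
    · have h1 := min_le_left ε δ
      have h2 := min_le_right ε δ
      have hd := ((hα _ hx2).2 t ⟨by linarith [ht.1], by linarith [ht.2]⟩).hasDerivAt
        (Icc_mem_nhds (by linarith [ht.1]) (by linarith [ht.2]))
      refine (hasMFDerivAt_symm_comp hd (hab hx3 (hδb ?_))).hasMFDerivWithinAt
      rw [Real.dist_eq, sub_zero, abs_lt]
      exact ⟨by linarith [ht.1], by linarith [ht.2]⟩

/-- A function with vanishing derivative along `X` is constant along integral curves of `X`. -/
lemma eq_of_mfderiv_eq_zero {f : M → ℝ} (hf : ContMDiff (𝓡 4) 𝓘(ℝ, ℝ) ∞ f)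
    (hX : ∀ p, mfderiv (𝓡 4) 𝓘(ℝ, ℝ) f p (X p) = 0) {γ : ℝ → M} {a b : ℝ}
    (hγ : IsMIntegralCurveOn (I := 𝓡 4) γ X (Ioo a b)) {s t : ℝ} (hs : s ∈ Ioo a b)
    (ht : t ∈ Ioo a b) : f (γ s) = f (γ t) := by
  have hd : ∀ u ∈ Ioo a b, HasDerivWithinAt (f ∘ γ) 0 (Ioo a b) u := by
    intro u hu
    have h1 := ((hf.mdifferentiable (by simp)) (γ u)).hasMFDerivAt.comp_hasMFDerivWithinAt u (hγ u hu)
    have h2 := hasMFDerivWithinAt_iff_hasFDerivWithinAt.1 h1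
    rw [hasDerivWithinAt_iff_hasFDerivWithinAt]
    refine h2.congr_fderiv (ContinuousLinearMap.ext fun r : ℝ => ?_)
    exact (map_smul (mfderiv (𝓡 4) 𝓘(ℝ, ℝ) f (γ u)) r (X (γ u))).trans
      (congrArg (fun x : ℝ => r • x) (hX (γ u)))
  have := (convex_Ioo a b).norm_image_sub_le_of_norm_hasDerivWithin_le (C := 0) hd
    (fun x _ => by simp) ht hs
  rw [zero_mul, norm_le_zero_iff, sub_eq_zero] at this
  exact this

variable [T2Space M]

/-- An integral curve which stays in a compact set extends to all times. -/
lemma exists_global_integralCurve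
    (hX : ∀ x₀ : M, ContDiffOn ℝ ∞ (chartField X x₀) (extChartAt (𝓡 4) x₀).target)
    {K : Set M} (hK : IsCompact K) {x : M} (hx : x ∈ K)
    (hinv : ∀ (γ : ℝ → M) (a : ℝ), γ 0 = x → IsMIntegralCurveOn (I := 𝓡 4) γ X (Ioo (-a) a) →
      ∀ t ∈ Ioo (-a) a, γ t ∈ K) :
    ∃ γ : ℝ → M, γ 0 = x ∧ IsMIntegralCurve (I := 𝓡 4) γ X := by
  have hv := contMDiff_section_of_chartField hX
  -- By compactness one existence time serves all of `K`.
  obtain ⟨ε, hε, hloc⟩ : ∃ ε > 0, ∀ y ∈ K, ∃ γ : ℝ → M, γ 0 = y ∧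
      IsMIntegralCurveOn (I := 𝓡 4) γ X (Ioo (-ε) ε) := by
    refine hK.induction_on (p := fun K => ∃ ε > 0, ∀ y ∈ K, ∃ γ : ℝ → M, γ 0 = y ∧
      IsMIntegralCurveOn (I := 𝓡 4) γ X (Ioo (-ε) ε)) ⟨1, one_pos, by simp⟩ ?_ ?_ ?_
    · rintro s t hst ⟨ε, hε, h⟩
      exact ⟨ε, hε, fun y hy => h y (hst hy)⟩
    · rintro s t ⟨ε, hε, h⟩ ⟨ε', hε', h'⟩
      refine ⟨min ε ε', lt_min hε hε', ?_⟩
      rintro y (hy | hy)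
      · obtain ⟨γ, h1, h2⟩ := h y hy
        exact ⟨γ, h1, h2.mono (Ioo_subset_Ioo (neg_le_neg (min_le_left _ _)) (min_le_left _ _))⟩
      · obtain ⟨γ, h1, h2⟩ := h' y hy
        exact ⟨γ, h1, h2.mono (Ioo_subset_Ioo (neg_le_neg (min_le_right _ _)) (min_le_right _ _))⟩
    · intro y _
      obtain ⟨ε, hε, N, hN, ψ, -, hψ⟩ := exists_local_flow hX y
      exact ⟨N, mem_nhdsWithin_of_mem_nhds hN, ε, hε, fun z hz => ⟨fun t => ψ (z, t), hψ z hz⟩⟩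
  -- Curves issued at the times `±(a - ε / 2)` live for a time `ε`, so gluing them prolongs the
  -- domain by `ε / 2` on each side.
  have hstep : ∀ n : ℕ, ∃ γ : ℝ → M, γ 0 = x ∧
      IsMIntegralCurveOn (I := 𝓡 4) γ X (Ioo (-(ε + n * (ε / 2))) (ε + n * (ε / 2))) := by
    intro n
    induction n with
    | zero => simpa using hloc x hx
    | succ n ih =>
      obtain ⟨γ, h0, hγ⟩ := ih
      set a := ε + n * (ε / 2) with ha
      have han : 0 ≤ n * (ε / 2) := by positivity
      have hm1 : a - ε / 2 ∈ Ioo (-a) a := ⟨by linarith, by linarith⟩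
      have hm2 : -(a - ε / 2) ∈ Ioo (-a) a := ⟨by linarith, by linarith⟩
      obtain ⟨γ₁, h10, hγ₁⟩ := hloc _ (hinv γ a h0 hγ _ hm1)
      obtain ⟨γ₂, h20, hγ₂⟩ := hloc _ (hinv γ a h0 hγ _ hm2)
      rw [← isMIntegralCurveOn_comp_add (dt := a - ε / 2)] at hγ₂
      rw [← isMIntegralCurveOn_comp_sub (dt := a - ε / 2)] at hγ₁
      replace hγ₁ := hγ₁.mono (s' := Ioo (a - ε / 2 - ε) (a - ε / 2 + ε)) (fun t ht => by
        constructor <;> linarith [ht.1, ht.2])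
      replace hγ₂ := hγ₂.mono (s' := Ioo (-(a - ε / 2) - ε) (-(a - ε / 2) + ε)) (fun t ht => by
        constructor <;> linarith [ht.1, ht.2])
      have hp1 := isMIntegralCurveOn_piecewise hv hγ hγ₁ (t₀ := a - ε / 2)
        ⟨hm1, by constructor <;> linarith⟩ (by simp [h10])
      replace hp1 := hp1.mono (s' := Ioo (-a) (a + ε / 2)) (fun t ht => by
        rcases lt_or_ge t a with h | h
        · exact Or.inl (mem_Ioo.2 ⟨ht.1, h⟩)
        · exact Or.inr (mem_Ioo.2 ⟨by linarith, by linarith [ht.2]⟩))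
      have hp2 := isMIntegralCurveOn_piecewise hv hp1 hγ₂ (t₀ := -(a - ε / 2))
        (mem_inter (mem_Ioo.2 (by constructor <;> linarith))
          (mem_Ioo.2 (by constructor <;> linarith))) (by
          rw [piecewise_eq_of_mem _ _ _ hm2]; simp [h20])
      refine ⟨_, ?_, hp2.mono ?_⟩
      · have h0m : (0 : ℝ) ∈ Ioo (-a) a := ⟨by linarith, by linarith⟩
        have h0m' : (0 : ℝ) ∈ Ioo (-a) (a + ε / 2) := ⟨h0m.1, by linarith [h0m.2]⟩
        rw [piecewise_eq_of_mem _ _ _ h0m', piecewise_eq_of_mem _ _ _ h0m,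
          h0]
      · intro t ht
        push_cast at ht
        rcases lt_or_ge (-a) t with h | h
        · exact Or.inl ⟨h, by linarith [ht.2]⟩
        · exact Or.inr ⟨by linarith [ht.1], by linarith⟩
  rw [exists_isMIntegralCurve_iff_exists_isMIntegralCurveOn_Ioo hv]
  intro a
  obtain ⟨n, hn⟩ := exists_nat_gt (a / (ε / 2))
  rw [div_lt_iff₀ (by positivity)] at hn
  obtain ⟨γ, h0, hγ⟩ := hstep n
  exact ⟨γ, h0, hγ.mono (Ioo_subset_Ioo (by linarith) (by linarith))⟩

/-- A smooth vector field all of whose integral curves are defined for all times has a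
continuous global flow. -/
lemma exists_flow
    (hX : ∀ x₀ : M, ContDiffOn ℝ ∞ (chartField X x₀) (extChartAt (𝓡 4) x₀).target)
    (hglob : ∀ x : M, ∃ γ : ℝ → M, γ 0 = x ∧ IsMIntegralCurve (I := 𝓡 4) γ X) :
    ∃ φ : Flow ℝ M, (∀ p, IsMIntegralCurve (I := 𝓡 4) (fun t => φ t p) X) ∧
      ∀ γ : ℝ → M, IsMIntegralCurve (I := 𝓡 4) γ X → ∀ t, γ t = φ t (γ 0) := by
  have hv := contMDiff_section_of_chartField hX
  choose Γ hΓ0 hΓ using hglob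
  have huniq : ∀ γ : ℝ → M, IsMIntegralCurve (I := 𝓡 4) γ X → ∀ t, γ t = Γ (γ 0) t := by
    intro γ hγ t
    exact congrFun (isMIntegralCurve_Ioo_eq_of_contMDiff_boundaryless (t₀ := 0) hv hγ (hΓ (γ 0))
      (hΓ0 _).symm) t
  have hadd : ∀ s t x, Γ x (s + t) = Γ (Γ x t) s := by
    intro s t x
    have := huniq (fun s => Γ x (s + t)) ((hΓ x).comp_add t) s
    simpa using this
  have hloc : ∀ x, ∃ ε > 0, ∃ N, IsOpen N ∧ x ∈ N ∧ ∀ y ∈ N, ∀ s ∈ Ioo (-ε) ε,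
      ContinuousAt (fun z : M × ℝ => Γ z.1 z.2) (y, s) := by
    intro x
    obtain ⟨ε, hε, N, hN, ψ, hψc, hψ⟩ := exists_local_flow hX x
    have heq : ∀ y ∈ N, ∀ s ∈ Ioo (-ε) ε, Γ y s = ψ (y, s) := by
      intro y hy s hs
      exact isMIntegralCurveOn_Ioo_eqOn_of_contMDiff_boundaryless (t₀ := 0) ⟨by linarith, hε⟩ hv
        ((hΓ y).isMIntegralCurveOn _) (hψ y hy).2 (by rw [hΓ0, (hψ y hy).1]) hs
    refine ⟨ε, hε, interior N, isOpen_interior, mem_interior_iff_mem_nhds.2 hN, ?_⟩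
    intro y hy s hs
    have hn : N ×ˢ Ioo (-ε) ε ∈ 𝓝 (y, s) :=
      prod_mem_nhds (mem_interior_iff_mem_nhds.1 hy) (Ioo_mem_nhds hs.1 hs.2)
    refine (hψc.continuousAt hn).congr ?_
    filter_upwards [hn] with z hz
    exact (heq z.1 hz.1 z.2 hz.2).symm
  have hcont : ∀ x t, ContinuousAt (fun y => Γ y t) x := by
    intro x
    let A : Set ℝ := {t | ContinuousAt (fun y => Γ y t) x}
    -- The times at which the time map is continuous at `x` form a clopen set: the flow is
    -- continuous for short times near `Γ x t`, and the group law transfers continuity from `s` to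
    -- any close `s'`.
    have key : ∀ t, ∃ δ > 0, ∀ s ∈ Metric.ball t δ, ∀ s' ∈ Metric.ball t δ, s ∈ A → s' ∈ A := by
      intro t
      obtain ⟨ε, hε, N, hNo, hxN, hN⟩ := hloc (Γ x t)
      have hc : ∀ᶠ s in 𝓝 t, Γ x s ∈ N :=
        (hΓ x).continuous.continuousAt.eventually_mem (hNo.mem_nhds hxN)
      obtain ⟨δ, hδ, hδN⟩ := Metric.eventually_nhds_iff_ball.1 hc
      refine ⟨min δ (ε / 2), lt_min hδ (by positivity), fun s hs s' hs' hA => ?_⟩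
      have h1 := hδN s (Metric.ball_subset_ball (min_le_left _ _) hs)
      have h2 : s' - s ∈ Ioo (-ε) ε := by
        have e1 := Metric.ball_subset_ball (min_le_right _ _) hs
        have e2 := Metric.ball_subset_ball (min_le_right _ _) hs'
        rw [Real.ball_eq_Ioo] at e1 e2
        constructor <;> linarith [e1.1, e1.2, e2.1, e2.2]
      have h3 := (hN _ h1 _ h2)
      have h4 : ContinuousAt (fun y => (Γ y s, s' - s)) x :=
        ContinuousAt.prodMk hA continuousAt_const
      have h5 : ContinuousAt (fun y => Γ (Γ y s) (s' - s)) x := ContinuousAt.comp (f := fun y => (Γ y s, s' - s)) h3 h4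
      change ContinuousAt (fun y => Γ y s') x
      refine h5.congr (Eventually.of_forall fun y => ?_)
      simp only
      rw [← hadd, sub_add_cancel]
    have hop : IsClopen A := by
      constructor
      · rw [← isOpen_compl_iff, Metric.isOpen_iff]
        intro t ht
        obtain ⟨δ, hδ, h⟩ := key t
        exact ⟨δ, hδ, fun s hs hsA => ht (h s hs t (Metric.mem_ball_self hδ) hsA)⟩
      · rw [Metric.isOpen_iff]
        intro t ht
        obtain ⟨δ, hδ, h⟩ := key t
        exact ⟨δ, hδ, fun s hs => h t (Metric.mem_ball_self hδ) s hs ht⟩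
    have h0 : (0 : ℝ) ∈ A := by
      change ContinuousAt (fun y => Γ y 0) x
      simp only [hΓ0]
      exact continuousAt_id
    have := hop.eq_univ ⟨0, h0⟩
    intro t
    change t ∈ A
    rw [this]; trivial
  refine ⟨⟨fun t x => Γ x t, ?_, fun s t x => hadd s t x, hΓ0⟩, hΓ, huniq⟩
  rw [continuous_iff_continuousAt]
  rintro ⟨t, x⟩
  obtain ⟨ε, hε, N, hNo, hxN, hN⟩ := hloc (Γ x t)
  have h1 : ContinuousAt (fun z : ℝ × M => (Γ z.2 t, z.1 - t)) (t, x) :=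
    ContinuousAt.prodMk (ContinuousAt.comp (f := Prod.snd) (g := fun y => Γ y t) (x := (t, x)) (hcont x t) continuousAt_snd)
      (by fun_prop)
  have h2 := hN _ hxN 0 ⟨by linarith, hε⟩
  have h3 : ContinuousAt (fun z : ℝ × M => Γ (Γ z.2 t) (z.1 - t)) (t, x) :=
    ContinuousAt.comp (g := fun z : M × ℝ => Γ z.1 z.2) (f := fun z : ℝ × M => (Γ z.2 t, z.1 - t))
      (by simpa using h2) h1
  refine h3.congr (Eventually.of_forall fun z => ?_)
  simp only [Function.uncurry]
  rw [← hadd, sub_add_cancel]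

end GlobalFlow

end

/-! ### Toral flows, linear algebra, and commutation of the two Hamiltonian fields -/

noncomputable section

/-- The flow `φ` commutes with a circle action, both preserve the map `F` and the set `R`, and on
`R` the circle action is free, the flow does not return to a circle orbit in short time, and
nearby points in a fibre of `F` differ by the flow for a short time and a rotation. -/
structure IsToralFlow {M : Type*} [TopologicalSpace M] [MulAction Circle M]
    (φ : Flow ℝ M) (F : M → ℝ × ℝ) (R : Set M) : Prop where
  map_smul : ∀ (t : ℝ) (z : Circle) (p : M), φ t (z • p) = z • φ t p
  continuous_map : Continuous F
  map_flow : ∀ t p, F (φ t p) = F p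
  map_action : ∀ (z : Circle) p, F (z • p) = F p
  flow_mem : ∀ t, ∀ p ∈ R, φ t p ∈ R
  smul_mem : ∀ (z : Circle), ∀ p ∈ R, z • p ∈ R
  free : ∀ p ∈ R, ∀ z : Circle, z • p = p → z = 1
  no_return : ∀ p ∈ R, ∃ ε > 0, ∀ᶠ q in 𝓝 p, ∀ t : ℝ, |t| ≤ ε → ∀ z : Circle, φ t q = z • q → t = 0
  transitive : ∀ p ∈ R, ∀ ε > 0, ∃ N ∈ 𝓝 p, ∀ q ∈ N, ∀ q' ∈ N, F q = F q' →
    ∃ (t : ℝ) (z : Circle), |t| < ε ∧ q = z • φ t q'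

section Linear

/-- Two independent vectors in the kernel of a surjection of a four-dimensional space to the plane
have dual coordinates complementing it. -/
lemma exists_complementary_coordinates {A : E4 →L[ℝ] ℝ × ℝ} (hA : Function.Surjective A)
    {u v : E4} (hu : A u = 0) (hv : A v = 0) (huv : ∀ a b : ℝ, a • u + b • v = 0 → a = 0 ∧ b = 0) :
    ∃ π : E4 →L[ℝ] ℝ × ℝ, π u = (1, 0) ∧ π v = (0, 1) ∧
      ∃ e : E4 ≃L[ℝ] (ℝ × ℝ) × (ℝ × ℝ), (e : E4 →L[ℝ] (ℝ × ℝ) × (ℝ × ℝ)) = A.prod π := by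
  let L : ℝ × ℝ →ₗ[ℝ] E4 := (LinearMap.toSpanSingleton ℝ E4 u).coprod (LinearMap.toSpanSingleton ℝ E4 v)
  have hL : ∀ a b, L (a, b) = a • u + b • v := fun a b => by simp [L]
  have hLi : LinearMap.ker L = ⊥ := by
    rw [LinearMap.ker_eq_bot']
    rintro ⟨a, b⟩ h
    rw [hL] at h
    obtain ⟨rfl, rfl⟩ := huv a b h
    rfl
  obtain ⟨π, hπ⟩ := LinearMap.exists_leftInverse_of_injective L hLi
  have hπ' : ∀ x, π (L x) = x := fun x => LinearMap.congr_fun hπ x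
  -- Both spaces have dimension two, the kernel because `A` is onto the plane.
  have hker : LinearMap.range L = LinearMap.ker A.toLinearMap := by
    apply Submodule.eq_of_le_of_finrank_eq
    · rintro _ ⟨⟨a, b⟩, rfl⟩
      rw [hL]
      simp [hu, hv]
    · rw [LinearMap.finrank_range_of_inj (LinearMap.ker_eq_bot.1 hLi)]
      have h1 := LinearMap.finrank_range_add_finrank_ker A.toLinearMap
      rw [LinearMap.range_eq_top.2 hA, finrank_top] at h1
      simp only [Module.finrank_prod, Module.finrank_self, finrank_euclideanSpace,
        Fintype.card_fin] at h1 ⊢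
      omega
  let π' : E4 →L[ℝ] ℝ × ℝ := LinearMap.toContinuousLinearMap π
  have hinj : Function.Injective (A.prod π').toLinearMap := by
    rw [← LinearMap.ker_eq_bot, LinearMap.ker_eq_bot']
    intro x hx
    have h1 : A x = 0 := congrArg Prod.fst hx
    have h2 : π x = 0 := congrArg Prod.snd hx
    have h3 : x ∈ LinearMap.range L := by rw [hker]; exact h1
    obtain ⟨y, rfl⟩ := h3
    rw [hπ'] at h2
    rw [h2, map_zero]
  refine ⟨π', ?_, ?_, (LinearEquiv.ofInjectiveOfFinrankEq (A.prod π').toLinearMap hinj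
    (by simp)).toContinuousLinearEquiv, by ext x <;> rfl⟩
  · have := hπ' (1, 0)
    rw [hL, one_smul, zero_smul, add_zero] at this
    exact this
  · have := hπ' (0, 1)
    rw [hL, one_smul, zero_smul, zero_add] at this
    exact this

/-- A map of the plane whose partial increments are close to those of the identity is close to the
identity. -/
lemma approximatesLinearOn_of_partial {h : ℝ × ℝ → ℝ × ℝ} {η : ℝ}
    {f₁ f₂ : ℝ → ℝ → ℝ × ℝ}
    (h1 : ∀ t y, |t| ≤ η → |y| ≤ η → HasDerivAt (fun s => h (s, y)) (f₁ t y) t)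
    (h2 : ∀ t y, |t| ≤ η → |y| ≤ η → HasDerivAt (fun s => h (t, s)) (f₂ t y) y)
    (b1 : ∀ t y, |t| ≤ η → |y| ≤ η → ‖f₁ t y - (1, 0)‖ ≤ 1 / 8)
    (b2 : ∀ t y, |t| ≤ η → |y| ≤ η → ‖f₂ t y - (0, 1)‖ ≤ 1 / 8) :
    ApproximatesLinearOn h (ContinuousLinearMap.id ℝ (ℝ × ℝ)) (Metric.closedBall 0 η) (1 / 4) := by
  have hmem : ∀ x : ℝ × ℝ, x ∈ Metric.closedBall (0 : ℝ × ℝ) η → |x.1| ≤ η ∧ |x.2| ≤ η := by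
    intro x hx
    rw [mem_closedBall_zero_iff, Prod.norm_def, max_le_iff] at hx
    exact hx
  have hI : ∀ x : ℝ, x ∈ Icc (-η) η ↔ |x| ≤ η := fun x => abs_le.symm
  rintro ⟨t, y⟩ hx ⟨t', y'⟩ hx'
  obtain ⟨ht, hy⟩ := hmem _ hx
  obtain ⟨ht', hy'⟩ := hmem _ hx'
  simp only at ht hy ht' hy'
  have e1 := (convex_Icc (-η) η).norm_image_sub_le_of_norm_hasDerivWithin_le
    (f := fun s => h (s, y) - (s, 0)) (f' := fun s => f₁ s y - (1, 0)) (C := 1 / 8)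
    (fun s hs => ((h1 s y ((hI s).1 hs) hy).sub
      ((hasDerivAt_id s).prodMk (hasDerivAt_const s (0 : ℝ)))).hasDerivWithinAt)
    (fun s hs => b1 s y ((hI s).1 hs) hy) ((hI _).2 ht') ((hI _).2 ht)
  have e2 := (convex_Icc (-η) η).norm_image_sub_le_of_norm_hasDerivWithin_le
    (f := fun s => h (t', s) - (0, s)) (f' := fun s => f₂ t' s - (0, 1)) (C := 1 / 8)
    (fun s hs => ((h2 t' s ht' ((hI s).1 hs)).sub
      ((hasDerivAt_const s (0 : ℝ)).prodMk (hasDerivAt_id s))).hasDerivWithinAt)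
    (fun s hs => b2 t' s ht' ((hI s).1 hs)) ((hI _).2 hy') ((hI _).2 hy)
  -- The increment is taken one coordinate at a time; the two errors of `1 / 8` add up to `1 / 4`.
  have e3 : h (t, y) - h (t', y') - ContinuousLinearMap.id ℝ (ℝ × ℝ) ((t, y) - (t', y')) =
      (h (t, y) - (t, 0) - (h (t', y) - (t', 0))) + (h (t', y) - (0, y) - (h (t', y') - (0, y'))) := by
    simp only [ContinuousLinearMap.id_apply]
    ext <;> simp <;> ring
  rw [e3]
  refine (norm_add_le _ _).trans ((add_le_add e1 e2).trans ?_)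
  have n1 : ‖t - t'‖ ≤ ‖(t, y) - (t', y')‖ := norm_fst_le ((t, y) - (t', y'))
  have n2 : ‖y - y'‖ ≤ ‖(t, y) - (t', y')‖ := norm_snd_le ((t, y) - (t', y'))
  have : ((1 / 4 : NNReal) : ℝ) = 1 / 4 := by simp
  rw [this]
  linarith

lemma ApproximatesLinearOn.injOn_of_id {h : ℝ × ℝ → ℝ × ℝ} {s : Set (ℝ × ℝ)}
    (hh : ApproximatesLinearOn h (ContinuousLinearMap.id ℝ (ℝ × ℝ)) s (1 / 4)) : InjOn h s := by
  intro x hx y hy hxy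
  have := hh x hx y hy
  rw [hxy, sub_self, zero_sub, norm_neg] at this
  simp only [ContinuousLinearMap.id_apply] at this
  have h4 : ((1 / 4 : NNReal) : ℝ) = 1 / 4 := by simp
  rw [h4] at this
  have h5 : ‖x - y‖ ≤ 0 := by linarith [norm_nonneg (x - y)]
  exact sub_eq_zero.1 (norm_le_zero_iff.1 h5)

/-- The quantitative inverse function theorem gives the radius `(1 - 1 / 4) * ε`; half of `ε` is
enough later. -/
lemma ApproximatesLinearOn.surjOn_of_id {h : ℝ × ℝ → ℝ × ℝ} {s : Set (ℝ × ℝ)}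
    (hh : ApproximatesLinearOn h (ContinuousLinearMap.id ℝ (ℝ × ℝ)) s (1 / 4)) {ε : ℝ}
    (hε : 0 ≤ ε) (hs : Metric.closedBall 0 ε ⊆ s) :
    SurjOn h (Metric.closedBall 0 ε) (Metric.closedBall (h 0) (1 / 2 * ε)) := by
  let r : (ContinuousLinearMap.id ℝ (ℝ × ℝ)).NonlinearRightInverse :=
    { toFun := id, nnnorm := 1, bound' := fun y => by simp, right_inv' := fun y => rfl }
  refine (hh.surjOn_closedBall_of_nonlinearRightInverse r hε hs).mono Subset.rfl ?_
  apply Metric.closedBall_subset_closedBall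
  have : (((r.nnnorm)⁻¹ : NNReal) : ℝ) = 1 := by simp [r]
  rw [← NNReal.coe_inv, this]
  norm_num
  nlinarith

end Linear

section Hamiltonian

variable {M : Type*} [TopologicalSpace M] [ChartedSpace E4 M]
  {w : (p : M) → TangentSpace (𝓡 4) p →L[ℝ] TangentSpace (𝓡 4) p →L[ℝ] ℝ}

lemma IsSymplecticForm.skew (hw : IsSymplecticForm w) (p : M) (u v : TangentSpace (𝓡 4) p) :
    w p u v = - w p v u := by
  have h1 := hw.alternating p (u + v)
  rw [map_add, map_add, add_apply, add_apply,
    hw.alternating, hw.alternating] at h1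
  linarith

lemma mfderiv_pair {H J : M → ℝ} (hH : ContMDiff (𝓡 4) 𝓘(ℝ, ℝ) ∞ H)
    (hJ : ContMDiff (𝓡 4) 𝓘(ℝ, ℝ) ∞ J) (p : M) (v : TangentSpace (𝓡 4) p) :
    mfderiv (𝓡 4) 𝓘(ℝ, ℝ × ℝ) (fun p => (H p, J p)) p v
      = (mfderiv (𝓡 4) 𝓘(ℝ, ℝ) H p v, mfderiv (𝓡 4) 𝓘(ℝ, ℝ) J p v) := by
  have hF : MDifferentiableAt (𝓡 4) 𝓘(ℝ, ℝ × ℝ) (fun p => (H p, J p)) p :=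
    (hH.mdifferentiable (by simp) p).prodMk_space (hJ.mdifferentiable (by simp) p)
  have h1 := HasMFDerivAt.comp (f := fun p => (H p, J p)) (g := Prod.fst) p
    (ContinuousLinearMap.fst ℝ ℝ ℝ).hasMFDerivAt hF.hasMFDerivAt
  have h2 := HasMFDerivAt.comp (f := fun p => (H p, J p)) (g := Prod.snd) p
    (ContinuousLinearMap.snd ℝ ℝ ℝ).hasMFDerivAt hF.hasMFDerivAt
  exact Prod.ext (DFunLike.congr_fun h1.mfderiv v).symm (DFunLike.congr_fun h2.mfderiv v).symm

lemma contMDiff_pair {H J : M → ℝ} (hH : ContMDiff (𝓡 4) 𝓘(ℝ, ℝ) ∞ H)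
    (hJ : ContMDiff (𝓡 4) 𝓘(ℝ, ℝ) ∞ J) :
    ContMDiff (𝓡 4) 𝓘(ℝ, ℝ × ℝ) ∞ (fun p => (H p, J p)) := hH.prodMk_space hJ

/-- At a regular point of `(H, J)` the Hamiltonian vector fields are independent. -/
lemma hamiltonian_fields_independent {H J : M → ℝ} (hH : ContMDiff (𝓡 4) 𝓘(ℝ, ℝ) ∞ H)
    (hJ : ContMDiff (𝓡 4) 𝓘(ℝ, ℝ) ∞ J) {XH XJ : (p : M) → TangentSpace (𝓡 4) p}
    (hXH : IsHamiltonianField w H XH) (hXJ : IsHamiltonianField w J XJ) {p : M}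
    (hp : IsRegularPt (fun p => (H p, J p)) p) {a b : ℝ} (hab : a • XH p + b • XJ p = 0) :
    a = 0 ∧ b = 0 := by
  have key : ∀ v (x y : ℝ), mfderiv (𝓡 4) 𝓘(ℝ, ℝ × ℝ) (fun p => (H p, J p)) p v = (x, y) →
      a * x + b * y = 0 := by
    intro v x y hxy
    rw [mfderiv_pair hH hJ] at hxy
    have e1 : w p (XH p) v = x := (hXH p v).trans (congrArg Prod.fst hxy)
    have e2 : w p (XJ p) v = y := (hXJ p v).trans (congrArg Prod.snd hxy)
    have h : w p (a • XH p + b • XJ p) v = 0 := by rw [hab, map_zero]; rfl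
    rw [map_add, map_smul, map_smul, add_apply, smul_apply, smul_apply, e1, e2] at h
    exact h
  constructor
  · obtain ⟨v, hv⟩ := hp (1, 0)
    simpa using key v 1 0 hv
  · obtain ⟨v, hv⟩ := hp (0, 1)
    simpa using key v 0 1 hv

variable [MulAction Circle M] {J : M → ℝ} {XJ : (p : M) → TangentSpace (𝓡 4) p}

/-- An invariant function is constant along the generator of a circle action. -/
lemma mfderiv_generator_eq_zero {f : M → ℝ} (hf : ContMDiff (𝓡 4) 𝓘(ℝ, ℝ) ∞ f)
    (hinv : ∀ (z : Circle) (p : M), f (z • p) = f p) (hXJ : IsHamiltonianCircleAction w J XJ)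
    (p : M) : mfderiv (𝓡 4) 𝓘(ℝ, ℝ) f p (XJ p) = 0 := by
  have h0 := hXJ.generator p 0
  have hp : Circle.exp 0 • p = p := by simp
  have h1 := HasMFDerivAt.comp (f := fun t : ℝ => Circle.exp t • p) (0 : ℝ)
    (hf.mdifferentiable (by simp) _).hasMFDerivAt h0
  have h2 : HasMFDerivAt 𝓘(ℝ, ℝ) 𝓘(ℝ, ℝ) (f ∘ fun t : ℝ => Circle.exp t • p) (0 : ℝ)
      (0 : ℝ →L[ℝ] ℝ) := by
    have : (f ∘ fun t : ℝ => Circle.exp t • p) = fun _ => f p := by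
      funext t; exact hinv _ _
    rw [this]
    exact hasMFDerivAt_const _ _
  have h3 := DFunLike.congr_fun (hasMFDerivAt_unique h1 h2) (1 : ℝ)
  have h4 : mfderiv (𝓡 4) 𝓘(ℝ, ℝ) f (Circle.exp 0 • p) ((1 : ℝ) • XJ (Circle.exp 0 • p)) = 0 := h3
  rw [one_smul, hp] at h4
  exact h4

variable [IsManifold (𝓡 4) ∞ M] [T2Space M]

/-- The circle action preserves the Hamiltonian vector field of an invariant function. -/
lemma mfderiv_smul_field (hw : IsSymplecticForm w) (hXJ : IsHamiltonianCircleAction w J XJ)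
    {f : M → ℝ} (hf : ContMDiff (𝓡 4) 𝓘(ℝ, ℝ) ∞ f)
    (hinv : ∀ (z : Circle) (p : M), f (z • p) = f p) {X : (p : M) → TangentSpace (𝓡 4) p}
    (hX : IsHamiltonianField w f X) (z : Circle) (p : M) :
    mfderiv (𝓡 4) (𝓡 4) (fun q : M => z • q) p (X p) = X (z • p) := by
  have hd : ∀ z : Circle, MDifferentiable (𝓡 4) (𝓡 4) (fun q : M => z • q) := by
    intro z
    have : ContMDiff (𝓡 4) (𝓡 4) ∞ (fun q : M => z • q) :=
      hXJ.smooth.comp (contMDiff_const.prodMk contMDiff_id)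
    exact this.mdifferentiable (by simp)
  -- The derivative of `z⁻¹` provides the preimage, but in the tangent space at `z⁻¹ • z • p`; `key`
  -- moves it to the one at `p`.
  have hsurj : ∀ u : TangentSpace (𝓡 4) (z • p), ∃ v : TangentSpace (𝓡 4) p,
      mfderiv (𝓡 4) (𝓡 4) (fun q : M => z • q) p v = u := by
    intro u
    have e1 := HasMFDerivAt.comp (f := fun q : M => z⁻¹ • q) (g := fun q : M => z • q) (z • p)
      (hd z _).hasMFDerivAt (hd z⁻¹ _).hasMFDerivAt
    have e2 : ((fun q : M => z • q) ∘ fun q : M => z⁻¹ • q) = id := by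
      funext q; simp
    rw [e2] at e1
    have e3 := DFunLike.congr_fun (hasMFDerivAt_unique e1 (hasMFDerivAt_id _)) u
    have e4 : z⁻¹ • z • p = p := by simp
    have key : ∀ q, q = p → ∀ v : TangentSpace (𝓡 4) q, ∃ v' : TangentSpace (𝓡 4) p,
        (mfderiv (𝓡 4) (𝓡 4) (fun q : M => z • q) p v' : E4)
          = mfderiv (𝓡 4) (𝓡 4) (fun q : M => z • q) q v := by
      rintro q rfl v
      exact ⟨v, rfl⟩
    obtain ⟨v', hv'⟩ := key _ e4 (mfderiv (𝓡 4) (𝓡 4) (fun q : M => z⁻¹ • q) (z • p) u)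
    exact ⟨v', hv'.trans e3⟩
  rw [← sub_eq_zero]
  apply hw.nondegenerate
  intro u
  obtain ⟨v, rfl⟩ := hsurj u
  have h1 := hXJ.symplectic z p (X p) v
  have h2 : mfderiv (𝓡 4) 𝓘(ℝ, ℝ) f p v = mfderiv (𝓡 4) 𝓘(ℝ, ℝ) f (z • p)
      (mfderiv (𝓡 4) (𝓡 4) (fun q : M => z • q) p v) := by
    have e1 := HasMFDerivAt.comp (f := fun q : M => z • q) (g := f) p
      (hf.mdifferentiable (by simp) _).hasMFDerivAt (hd z p).hasMFDerivAt
    have e2 : (f ∘ fun q : M => z • q) = f := by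
      funext q; exact hinv z q
    rw [e2] at e1
    rw [e1.mfderiv]
    rfl
  have h3 : w (z • p) (mfderiv (𝓡 4) (𝓡 4) (fun q : M => z • q) p (X p))
      (mfderiv (𝓡 4) (𝓡 4) (fun q : M => z • q) p v) = w (z • p) (X (z • p))
      (mfderiv (𝓡 4) (𝓡 4) (fun q : M => z • q) p v) :=
    h1.trans ((hX p v).trans (h2.trans (hX (z • p) _).symm))
  rw [map_sub, sub_apply, h3, sub_self]

/-- A rotation of an integral curve of an invariant Hamiltonian vector field is again an integral
curve. -/
lemma IsMIntegralCurve.circle_smul (hw : IsSymplecticForm w)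
    (hXJ : IsHamiltonianCircleAction w J XJ)
    {f : M → ℝ} (hf : ContMDiff (𝓡 4) 𝓘(ℝ, ℝ) ∞ f)
    (hinv : ∀ (z : Circle) (p : M), f (z • p) = f p) {X : (p : M) → TangentSpace (𝓡 4) p}
    (hX : IsHamiltonianField w f X) (z : Circle) {γ : ℝ → M}
    (hγ : IsMIntegralCurve (I := 𝓡 4) γ X) :
    IsMIntegralCurve (I := 𝓡 4) (fun t => z • γ t) X := by
  intro t
  have hd : ContMDiff (𝓡 4) (𝓡 4) ∞ (fun q : M => z • q) :=
    hXJ.smooth.comp (contMDiff_const.prodMk contMDiff_id)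
  have h1 := HasMFDerivAt.comp (f := γ) (g := fun q : M => z • q) t
    (hd.mdifferentiable (by simp) _).hasMFDerivAt (hγ t)
  refine h1.congr_mfderiv (ContinuousLinearMap.ext fun r : ℝ => ?_)
  exact (map_smul (mfderiv (𝓡 4) (𝓡 4) (fun q : M => z • q) (γ t)) r (X (γ t))).trans
      (congrArg (fun u => r • u) (mfderiv_smul_field hw hXJ hf hinv hX z (γ t)))

/-- Poisson commutation: `dJ(X) = w(XJ, X) = -w(X, XJ) = -df(XJ)`, which vanishes since `f` is
invariant. -/
lemma mfderiv_momentum_field (hw : IsSymplecticForm w) (hXJ : IsHamiltonianCircleAction w J XJ)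
    {f : M → ℝ} (hf : ContMDiff (𝓡 4) 𝓘(ℝ, ℝ) ∞ f)
    (hinv : ∀ (z : Circle) (p : M), f (z • p) = f p) {X : (p : M) → TangentSpace (𝓡 4) p}
    (hX : IsHamiltonianField w f X) (p : M) : mfderiv (𝓡 4) 𝓘(ℝ, ℝ) J p (X p) = 0 := by
  have h : w p (X p) (XJ p) = 0 := (hX p _).trans (mfderiv_generator_eq_zero hf hinv hXJ p)
  rw [← hXJ.momentum, hw.skew, h, neg_zero]
  rfl

lemma momentum_smul (hw : IsSymplecticForm w) (hJ : ContMDiff (𝓡 4) 𝓘(ℝ, ℝ) ∞ J)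
    (hXJ : IsHamiltonianCircleAction w J XJ) (z : Circle) (p : M) : J (z • p) = J p := by
  obtain ⟨t, rfl⟩ := Circle.exp_surjective z
  have h := eq_of_mfderiv_eq_zero hJ (X := XJ) (fun p => (hXJ.momentum p _).symm.trans (hw.alternating p _))
    ((hXJ.generator p).isMIntegralCurveOn (Ioo (-(|t| + 1)) (|t| + 1))) (s := t) (t := 0)
    (by rw [mem_Ioo, ← abs_lt]; linarith) (by constructor <;> linarith [abs_nonneg t])
  simpa using h

end Hamiltonian

end

/-! ### Flow boxes at regular points -/

noncomputable section

section RegularPoint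

variable {M : Type*} [TopologicalSpace M] [ChartedSpace E4 M] [IsManifold (𝓡 4) ∞ M]
  {w : (p : M) → TangentSpace (𝓡 4) p →L[ℝ] TangentSpace (𝓡 4) p →L[ℝ] ℝ}
  {H J : M → ℝ} {XH XJ : (p : M) → TangentSpace (𝓡 4) p}

/-- Near a regular point, `F = (H, J)` is completed to a chart by two functions which are linear in
a given chart and dual to the Hamiltonian vector fields at the point. -/
lemma exists_adapted_chart
    (hH : ContMDiff (𝓡 4) 𝓘(ℝ, ℝ) ∞ H) (hJ : ContMDiff (𝓡 4) 𝓘(ℝ, ℝ) ∞ J)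
    (hXH : IsHamiltonianField w H XH) (hXJ : IsHamiltonianField w J XJ)
    (hHH : ∀ p, mfderiv (𝓡 4) 𝓘(ℝ, ℝ) H p (XH p) = 0)
    (hHJ : ∀ p, mfderiv (𝓡 4) 𝓘(ℝ, ℝ) H p (XJ p) = 0)
    (hJH : ∀ p, mfderiv (𝓡 4) 𝓘(ℝ, ℝ) J p (XH p) = 0)
    (hJJ : ∀ p, mfderiv (𝓡 4) 𝓘(ℝ, ℝ) J p (XJ p) = 0)
    {p : M} (hp : IsRegularPt (fun p => (H p, J p)) p) :
    ∃ π : E4 →L[ℝ] ℝ × ℝ,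
      π (chartField XH p (extChartAt (𝓡 4) p p)) = (1, 0) ∧
      π (chartField XJ p (extChartAt (𝓡 4) p p)) = (0, 1) ∧
      (∃ O ∈ 𝓝 p, O ⊆ (extChartAt (𝓡 4) p).source ∧
        InjOn (fun q => ((H q, J q), π (extChartAt (𝓡 4) p q))) O) ∧
      ∃ σ : ℝ × ℝ → M, σ (H p, J p) = p ∧ ∃ V ∈ 𝓝 (H p, J p), ContinuousOn σ V ∧
        ∀ v ∈ V, (H (σ v), J (σ v)) = v := by
  set κ := extChartAt (𝓡 4) p with hκ
  set y₀ := κ p with hy₀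
  have hyt : y₀ ∈ κ.target := mem_extChartAt_target p
  have hsymm : κ.symm y₀ = p := extChartAt_to_inv p
  set F : M → ℝ × ℝ := fun p => (H p, J p) with hF
  have hFs : ContMDiff (𝓡 4) 𝓘(ℝ, ℝ × ℝ) ∞ F := contMDiff_pair hH hJ
  have hFc : ContDiffAt ℝ ∞ (F ∘ κ.symm) y₀ := by
    have : ContDiffOn ℝ ∞ (F ∘ κ.symm) κ.target := by
      rw [← contMDiffOn_iff_contDiffOn]
      exact hFs.comp_contMDiffOn (contMDiffOn_extChartAt_symm p)
    exact this.contDiffAt ((isOpen_chart_target p).mem_nhds hyt)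
  set A := fderiv ℝ (F ∘ κ.symm) y₀ with hA
  have hAv : ∀ u : E4, A u = mfderiv (𝓡 4) 𝓘(ℝ, ℝ × ℝ) F (κ.symm y₀)
      (mfderiv 𝓘(ℝ, E4) (𝓡 4) κ.symm y₀ u) := by
    intro u
    rw [hA, ← mfderiv_eq_fderiv,
      mfderiv_comp y₀ (hFs.mdifferentiable (by simp) _) (mdifferentiableAt_chart_symm hyt)]
    rfl
  have hp' : IsRegularPt F (κ.symm y₀) := by rw [hsymm]; exact hp
  have hAs : Function.Surjective A := by
    intro v
    obtain ⟨u, hu⟩ := hp' v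
    refine ⟨(mfderiv (𝓡 4) 𝓘(ℝ, E4) κ (κ.symm y₀) u : E4), ?_⟩
    refine (hAv _).trans ?_
    rw [mfderiv_chart_symm_comp hyt]
    exact hu
  have hAH : A (chartField XH p y₀) = 0 := by
    rw [hAv, mfderiv_symm_chartField XH hyt, mfderiv_pair hH hJ]
    exact Prod.ext (hHH _) (hJH _)
  have hAJ : A (chartField XJ p y₀) = 0 := by
    rw [hAv, mfderiv_symm_chartField XJ hyt, mfderiv_pair hH hJ]
    exact Prod.ext (hHJ _) (hJJ _)
  have hind : ∀ a b : ℝ, a • chartField XH p y₀ + b • chartField XJ p y₀ = 0 → a = 0 ∧ b = 0 := by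
    intro a b hab
    apply hamiltonian_fields_independent hH hJ hXH hXJ hp'
    rw [← mfderiv_symm_chartField XH hyt, ← mfderiv_symm_chartField XJ hyt]
    have := congrArg (mfderiv 𝓘(ℝ, E4) (𝓡 4) κ.symm y₀) hab
    refine Eq.trans ?_ (this.trans (map_zero (mfderiv 𝓘(ℝ, E4) (𝓡 4) κ.symm y₀)))
    refine Eq.symm ((map_add (mfderiv 𝓘(ℝ, E4) (𝓡 4) κ.symm y₀) _ _).trans ?_)
    exact congrArg₂ (· + ·) (map_smul (mfderiv 𝓘(ℝ, E4) (𝓡 4) κ.symm y₀) a _)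
      (map_smul (mfderiv 𝓘(ℝ, E4) (𝓡 4) κ.symm y₀) b _)
  obtain ⟨π, h1, h2, e, he⟩ := exists_complementary_coordinates hAs hAH hAJ hind
  refine ⟨π, h1, h2, ?_⟩
  -- `F` together with `π` has invertible derivative at `y₀`. The inverse function theorem gives the
  -- injectivity, and freezing the `π` coordinate in the inverse gives the local section.
  have hst : HasStrictFDerivAt (fun y => ((F ∘ κ.symm) y, π y)) (e : E4 →L[ℝ] _) y₀ := by
    rw [he]
    exact (hFc.hasStrictFDerivAt (by simp)).prodMk π.hasStrictFDerivAt
  set Ψ := hst.toOpenPartialHomeomorph with hΨ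
  have hΨv : ∀ y, Ψ y = ((F ∘ κ.symm) y, π y) := fun y => rfl
  have hΨs : y₀ ∈ Ψ.source := hst.mem_toOpenPartialHomeomorph_source
  constructor
  · refine ⟨κ.source ∩ κ ⁻¹' Ψ.source, ?_, inter_subset_left, ?_⟩
    · exact inter_mem (extChartAt_source_mem_nhds p)
        ((continuousAt_extChartAt p).preimage_mem_nhds (Ψ.open_source.mem_nhds hΨs))
    · rintro q ⟨hq, hq'⟩ r ⟨hr, hr'⟩ hqr
      apply κ.injOn hq hr
      apply Ψ.injOn hq' hr'
      rw [hΨv, hΨv, Function.comp_apply, Function.comp_apply, κ.left_inv hq, κ.left_inv hr]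
      exact hqr
  · have hΨ0 : Ψ y₀ = (F p, π y₀) := by rw [hΨv, Function.comp_apply, hsymm]
    have ht : (F p, π y₀) ∈ Ψ.target := by rw [← hΨ0]; exact Ψ.map_source hΨs
    have hi : Ψ.symm (F p, π y₀) = y₀ := by rw [← hΨ0]; exact Ψ.left_inv hΨs
    refine ⟨fun v => κ.symm (Ψ.symm (v, π y₀)), ?_,
      {v | (v, π y₀) ∈ Ψ.target ∩ Ψ.symm ⁻¹' κ.target}, ?_, ?_, ?_⟩
    · change κ.symm (Ψ.symm (F p, π y₀)) = p
      rw [hi, hsymm]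
    · have hc : ContinuousAt (fun v : ℝ × ℝ => (v, π y₀)) (F p) := by fun_prop
      apply hc.preimage_mem_nhds
      exact (Ψ.symm.isOpen_inter_preimage (isOpen_chart_target p)).mem_nhds
        ⟨ht, by rw [mem_preimage, hi]; exact hyt⟩
    · refine (continuousOn_extChartAt_symm p).comp
        (Ψ.continuousOn_symm.comp (by fun_prop) fun v hv => hv.1) fun v hv => hv.2
    · intro v hv
      have := Ψ.right_inv hv.1
      rw [hΨv] at this
      exact congrArg Prod.fst this

variable [MulAction Circle M] [ContinuousSMul Circle M] [T2Space M]

/-- Near a regular point, the joint motion along the flow and the circle action has coordinates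
uniformly close to the identity. -/
lemma exists_flow_box (hw : IsSymplecticForm w)
    (hH : ContMDiff (𝓡 4) 𝓘(ℝ, ℝ) ∞ H) (hJ : ContMDiff (𝓡 4) 𝓘(ℝ, ℝ) ∞ J)
    (hXH : IsHamiltonianField w H XH) (hXJ : IsHamiltonianCircleAction w J XJ)
    (hinv : ∀ (z : Circle) (p : M), H (z • p) = H p)
    {φ : Flow ℝ M} (hφ : ∀ p, IsMIntegralCurve (I := 𝓡 4) (fun t => φ t p) XH)
    {p : M} (hp : IsRegularPt (fun p => (H p, J p)) p) :
    ∃ (h : M → ℝ × ℝ) (O : Set M), ContinuousAt h p ∧ O ∈ 𝓝 p ∧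
      InjOn (fun q => ((H q, J q), h q)) O ∧
      ∀ η₁ > 0, ∃ η > 0, η ≤ η₁ ∧ ∀ᶠ q in 𝓝 p,
        (∀ t y, |t| ≤ η → |y| ≤ η → Circle.exp y • φ t q ∈ O) ∧
        ApproximatesLinearOn (fun x : ℝ × ℝ => h (Circle.exp x.2 • φ x.1 q))
          (ContinuousLinearMap.id ℝ (ℝ × ℝ)) (Metric.closedBall 0 η) (1 / 4) := by
  obtain ⟨π, hπH, hπJ, ⟨O, hO, hOs, hOi⟩, -⟩ := exists_adapted_chart hH hJ hXH hXJ.momentum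
    (fun p => (hXH p _).symm.trans (hw.alternating p _)) (mfderiv_generator_eq_zero hH hinv hXJ)
    (mfderiv_momentum_field hw hXJ hH hinv hXH)
    (fun p => (hXJ.momentum p _).symm.trans (hw.alternating p _)) hp
  set κ := extChartAt (𝓡 4) p with hκ
  have hκc : ContinuousAt κ p := continuousAt_extChartAt p
  have htar : κ.target ∈ 𝓝 (κ p) := (isOpen_chart_target p).mem_nhds (mem_extChartAt_target p)
  have hcH : ContinuousAt (fun q => π (chartField XH p (κ q))) p :=
    π.continuous.continuousAt.comp
      (((contDiffOn_chartField hw hH hXH p).continuousOn.continuousAt htar).comp hκc)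
  have hcJ : ContinuousAt (fun q => π (chartField XJ p (κ q))) p :=
    π.continuous.continuousAt.comp
      (((contDiffOn_chartField hw hJ hXJ.momentum p).continuousOn.continuousAt htar).comp hκc)
  -- At `p` the two fields have coordinates `(1, 0)` and `(0, 1)` under `π`; by continuity they stay
  -- within `1 / 8` of these nearby, which is the input of `approximatesLinearOn_of_partial`.
  have hev : ∀ᶠ r in 𝓝 p, r ∈ O ∧ ‖π (chartField XH p (κ r)) - (1, 0)‖ ≤ 1 / 8 ∧
      ‖π (chartField XJ p (κ r)) - (0, 1)‖ ≤ 1 / 8 := by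
    have e1 := Metric.tendsto_nhds.1 hcH.tendsto (1 / 8) (by norm_num)
    have e2 := Metric.tendsto_nhds.1 hcJ.tendsto (1 / 8) (by norm_num)
    filter_upwards [hO, e1, e2] with r h1 h2 h3
    rw [hπH, dist_eq_norm] at h2
    rw [hπJ, dist_eq_norm] at h3
    exact ⟨h1, h2.le, h3.le⟩
  refine ⟨fun q => π (κ q), O, π.continuous.continuousAt.comp hκc, hO, hOi, ?_⟩
  intro η₁ hη₁
  have hc : Continuous fun x : M × ℝ × ℝ => Circle.exp x.2.2 • φ x.2.1 x.1 := by fun_prop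
  have hev2 := hc.continuousAt.tendsto (x := (p, (0, 0)))
  simp only [Circle.exp_zero, one_smul, φ.map_zero_apply] at hev2
  have hev3 := hev2.eventually hev
  rw [nhds_prod_eq, eventually_prod_iff] at hev3
  obtain ⟨pa, hpa, pb, hpb, hab⟩ := hev3
  obtain ⟨δ, hδ, hδb⟩ := Metric.eventually_nhds_iff.1 hpb
  refine ⟨min η₁ (δ / 2), by positivity, min_le_left _ _, ?_⟩
  have hbox : ∀ t y : ℝ, |t| ≤ min η₁ (δ / 2) → |y| ≤ min η₁ (δ / 2) → pb (t, y) := by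
    intro t y ht hy
    apply hδb
    have := min_le_right η₁ (δ / 2)
    rw [Prod.dist_eq, Real.dist_eq, Real.dist_eq, sub_zero, sub_zero, max_lt_iff]
    constructor <;> linarith
  filter_upwards [hpa] with q hq
  refine ⟨fun t y ht hy => (hab hq (hbox t y ht hy)).1, ?_⟩
  apply approximatesLinearOn_of_partial
    (f₁ := fun t y => π (chartField XH p (κ (Circle.exp y • φ t q))))
    (f₂ := fun t y => π (chartField XJ p (κ (Circle.exp y • φ t q))))
  · intro t y ht hy
    exact π.hasFDerivAt.comp_hasDerivAt t (hasDerivAt_chart_comp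
      (((hφ q).circle_smul hw hXJ hH hinv hXH (Circle.exp y)) t) (hOs (hab hq (hbox t y ht hy)).1))
  · intro t y ht hy
    exact π.hasFDerivAt.comp_hasDerivAt y (hasDerivAt_chart_comp
      (hXJ.generator (φ t q) y) (hOs (hab hq (hbox t y ht hy)).1))
  · exact fun t y ht hy => (hab hq (hbox t y ht hy)).2.1
  · exact fun t y ht hy => (hab hq (hbox t y ht hy)).2.2

/-- The Hamiltonian flow of an invariant function and the circle action form a toral flow on a
saturated set of regular points. -/
theorem isToralFlow (hw : IsSymplecticForm w)
    (hH : ContMDiff (𝓡 4) 𝓘(ℝ, ℝ) ∞ H) (hJ : ContMDiff (𝓡 4) 𝓘(ℝ, ℝ) ∞ J)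
    (hXH : IsHamiltonianField w H XH) (hXJ : IsHamiltonianCircleAction w J XJ)
    (hfree : ∀ p : M, (∀ z : Circle, z • p = p) ∨ ∀ z : Circle, z • p = p → z = 1)
    (hinv : ∀ (z : Circle) (p : M), H (z • p) = H p)
    {φ : Flow ℝ M} (hφ : ∀ p, IsMIntegralCurve (I := 𝓡 4) (fun t => φ t p) XH)
    (huniq : ∀ γ : ℝ → M, IsMIntegralCurve (I := 𝓡 4) γ XH → ∀ t, γ t = φ t (γ 0))
    {V : Set (ℝ × ℝ)} {pbar : M}
    (hreg : ∀ p, (H p, J p) ∈ V → p ≠ pbar → IsRegularPt (fun p => (H p, J p)) p)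
    (hφbar : ∀ t, φ t pbar = pbar) (hzbar : ∀ z : Circle, z • pbar = pbar) :
    IsToralFlow φ (fun p => (H p, J p)) {p | (H p, J p) ∈ V ∧ p ≠ pbar} := by
  have hFφ : ∀ t p, (H (φ t p), J (φ t p)) = (H p, J p) := by
    intro t p
    have ht : t ∈ Ioo (-(|t| + 1)) (|t| + 1) := by rw [mem_Ioo, ← abs_lt]; linarith
    have h0 : (0 : ℝ) ∈ Ioo (-(|t| + 1)) (|t| + 1) := by constructor <;> linarith [abs_nonneg t]
    have e1 := eq_of_mfderiv_eq_zero hH (fun p => (hXH p _).symm.trans (hw.alternating p _))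
      ((hφ p).isMIntegralCurveOn _) ht h0
    have e2 := eq_of_mfderiv_eq_zero hJ (mfderiv_momentum_field hw hXJ hH hinv hXH)
      ((hφ p).isMIntegralCurveOn _) ht h0
    rw [φ.map_zero_apply] at e1 e2
    rw [e1, e2]
  have hFz : ∀ (z : Circle) p, (H (z • p), J (z • p)) = (H p, J p) := fun z p => by
    rw [hinv, momentum_smul hw hJ hXJ]
  have hsm : ∀ (t : ℝ) (z : Circle) (p : M), φ t (z • p) = z • φ t p := by
    intro t z p
    have := huniq _ ((hφ p).circle_smul hw hXJ hH hinv hXH z) t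
    simp only [φ.map_zero_apply] at this
    exact this.symm
  have hfr : ∀ p, IsRegularPt (fun p => (H p, J p)) p → ∀ z : Circle, z • p = p → z = 1 := by
    intro p hp
    -- At a fixed point the generator vanishes, against the independence of the fields at a regular
    -- point.
    rcases hfree p with h | h
    · exfalso
      have h0 := hXJ.generator p 0
      have e : (fun t : ℝ => Circle.exp t • p) = fun _ => p := by funext t; exact h _
      rw [e] at h0
      have e2 := DFunLike.congr_fun (hasMFDerivAt_unique h0 (hasMFDerivAt_const _ _)) (1 : ℝ)
      have e3 : (1 : ℝ) • XJ p = 0 := e2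
      rw [one_smul] at e3
      have := hamiltonian_fields_independent hH hJ hXH hXJ.momentum hp (a := 0) (b := 1)
        (by rw [zero_smul, one_smul, zero_add, e3])
      exact one_ne_zero this.2
    · exact h
  refine ⟨hsm, (contMDiff_pair hH hJ).continuous, hFφ, hFz, ?_, ?_, ?_, ?_, ?_⟩
  · rintro t p ⟨h1, h2⟩
    refine ⟨by rw [hFφ]; exact h1, fun h => h2 ?_⟩
    have := congrArg (φ (-t)) h
    rwa [← φ.map_add, neg_add_cancel, φ.map_zero_apply, hφbar] at this
  · rintro z p ⟨h1, h2⟩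
    refine ⟨by rw [hFz]; exact h1, fun h => h2 ?_⟩
    rw [← inv_smul_smul z p, h, hzbar]
  · rintro p ⟨h1, h2⟩
    exact hfr p (hreg p h1 h2)
  · rintro p ⟨h1, h2⟩
    obtain ⟨h, O, -, -, -, hbox⟩ := exists_flow_box hw hH hJ hXH hXJ hinv hφ (hreg p h1 h2)
    obtain ⟨η, hη, -, hev⟩ := hbox 1 one_pos
    -- Rotations by an angle below `η` are excluded by injectivity of the flow box. The others form
    -- a compact set, on which freeness at `p` persists for nearby points and short times.
    set V₁ : Set Circle := Circle.exp '' Metric.ball 0 η with hV₁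
    have hVo : IsOpen V₁ := isLocalHomeomorph_circleExp.isOpenMap _ Metric.isOpen_ball
    have hfar : ∀ᶠ x in 𝓝 (p, (0 : ℝ)), ∀ z ∈ V₁ᶜ, φ x.2 x.1 ≠ z • x.1 := by
      apply hVo.isClosed_compl.isCompact.eventually_forall_of_forall_eventually
      intro z hz
      have hc1 : Continuous fun x : (M × ℝ) × Circle => φ x.1.2 x.1.1 := by fun_prop
      have hc2 : Continuous fun x : (M × ℝ) × Circle => x.2 • x.1.1 := by fun_prop
      refine (isOpen_ne_fun hc1 hc2).mem_nhds ?_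
      simp only [mem_ofPred_eq, φ.map_zero_apply]
      intro h
      have := hfr p (hreg p h1 h2) z h.symm
      exact hz ⟨0, Metric.mem_ball_self hη, by simp [this]⟩
    rw [nhds_prod_eq, eventually_prod_iff] at hfar
    obtain ⟨pa, hpa, pb, hpb, hab⟩ := hfar
    obtain ⟨δ, hδ, hδb⟩ := Metric.eventually_nhds_iff.1 hpb
    refine ⟨min η (δ / 2), by positivity, ?_⟩
    filter_upwards [hev, hpa] with q hq hqa
    intro t ht z htz
    have ht1 := ht.trans (min_le_left _ _)
    have ht2 := ht.trans (min_le_right _ _)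
    by_cases hz : z ∈ V₁
    · obtain ⟨y, hy, rfl⟩ := hz
      rw [mem_ball_zero_iff] at hy
      have hinj := hq.2.injOn_of_id
      have e1 : (t, -y) ∈ Metric.closedBall (0 : ℝ × ℝ) η := by
        rw [mem_closedBall_zero_iff, Prod.norm_def, max_le_iff, norm_neg]
        exact ⟨ht1, hy.le⟩
      have e2 : (0, 0) ∈ Metric.closedBall (0 : ℝ × ℝ) η := Metric.mem_closedBall_self hη.le
      have e3 := hinj e1 e2 (by
        simp only [htz, Circle.exp_neg, inv_smul_smul, Circle.exp_zero, one_smul, φ.map_zero_apply])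
      exact congrArg Prod.fst e3
    · exact absurd htz (hab hqa (hδb (by rw [Real.dist_eq, sub_zero]; linarith)) z hz)
  · rintro p ⟨h1, h2⟩ ε hε
    obtain ⟨h, O, hc, hO, hOi, hbox⟩ := exists_flow_box hw hH hJ hXH hXJ hinv hφ (hreg p h1 h2)
    obtain ⟨η, hη, hηε, hev⟩ := hbox (ε / 2) (by positivity)
    have hnear := Metric.tendsto_nhds.1 hc.tendsto (1 / 4 * η) (by positivity)
    refine ⟨_, hev.and (hnear.and hO), ?_⟩
    rintro q ⟨hq1, hq2, hq3⟩ q' ⟨hq1', hq2', hq3'⟩ hF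
    have hs := hq1'.2.surjOn_of_id hη.le Subset.rfl
    -- `h q` and `h q'` are both within `η / 4` of `h p`, so `h q` is in the ball covered by the box
    -- at `q'`. The point reached there has the same `F` and the same `h` as `q`, hence is `q`.
    have hmem : h q ∈ Metric.closedBall
        ((fun x : ℝ × ℝ => h (Circle.exp x.2 • φ x.1 q')) 0) (1 / 2 * η) := by
      simp only [Prod.fst_zero, Prod.snd_zero, Circle.exp_zero, one_smul, φ.map_zero_apply,
        Metric.mem_closedBall]
      linarith [dist_triangle_right (h q) (h q') (h p)]
    obtain ⟨⟨t, y⟩, hty, heq⟩ := hs hmem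
    rw [mem_closedBall_zero_iff, Prod.norm_def, max_le_iff] at hty
    refine ⟨t, Circle.exp y, by have := hty.1; rw [Real.norm_eq_abs] at this; linarith, ?_⟩
    apply hOi hq3 (hq1'.1 t y hty.1 hty.2)
    simp only at heq ⊢
    rw [heq, hFz, hFφ, hF]

end RegularPoint

end

/-! ### Bundles of cylinders and the motion of the flow across them -/

noncomputable section

variable {M : Type*} [TopologicalSpace M] [MulAction Circle M]

/-- Coordinates of a trivial circle-equivariant bundle over `D` with fibre `Circle × Y`. -/
structure TrivialCoords (F : M → ℝ × ℝ) (S : Set M) (D : Set (ℝ × ℝ)) (Y : Type)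
    [TopologicalSpace Y] where
  /-- the circle coordinate -/
  c : M → Circle
  /-- the transversal coordinate -/
  y : M → Y
  /-- the sections where the circle coordinate is one -/
  s : ℝ × ℝ → Y → M
  cont_c : ContinuousOn c (F ⁻¹' D ∩ S)
  cont_y : ContinuousOn y (F ⁻¹' D ∩ S)
  cont_s : ContinuousOn (fun x : (ℝ × ℝ) × Y => s x.1 x.2) (D ×ˢ univ)
  s_mem : ∀ {v}, v ∈ D → ∀ r, s v r ∈ S
  F_s : ∀ {v}, v ∈ D → ∀ r, F (s v r) = v
  c_s : ∀ {v}, v ∈ D → ∀ r, c (s v r) = 1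
  y_s : ∀ {v}, v ∈ D → ∀ r, y (s v r) = r
  eq_smul : ∀ p ∈ S, F p ∈ D → p = c p • s (F p) (y p)
  c_smul : ∀ p ∈ S, F p ∈ D → ∀ z : Circle, c (z • p) = z * c p
  y_smul : ∀ p ∈ S, F p ∈ D → ∀ z : Circle, y (z • p) = y p

/-- The components of the homeomorphism are extended by arbitrary values outside the subtype, so
that coordinates and sections are functions on all of `M` and of the plane. -/
lemma IsTrivialOver.nonempty_coords {F : M → ℝ × ℝ} {S : Set M} {D : Set (ℝ × ℝ)} {Y : Type}
    [TopologicalSpace Y] [Nonempty M] [Nonempty Y] (h : IsTrivialOver F S D Y)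
    (hF : ∀ (z : Circle) p, F (z • p) = F p) (hS : ∀ (z : Circle), ∀ p ∈ S, z • p ∈ S) :
    Nonempty (TrivialCoords F S D Y) := by
  classical
  obtain ⟨e, he1, he2⟩ := h
  let q₀ : M := Classical.arbitrary M
  let y₀ : Y := Classical.arbitrary Y
  let c : M → Circle := fun p => if h : p ∈ F ⁻¹' D ∩ S then (e ⟨p, h⟩).2.1 else 1
  let y : M → Y := fun p => if h : p ∈ F ⁻¹' D ∩ S then (e ⟨p, h⟩).2.2 else y₀
  let s : ℝ × ℝ → Y → M := fun v r => if h : v ∈ D then (e.symm (⟨v, h⟩, (1, r)) : M) else q₀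
  have hs : ∀ {v} (h : v ∈ D) r, s v r = (e.symm (⟨v, h⟩, (1, r)) : M) := fun h r => dif_pos h
  have hc : ∀ {p} (h : p ∈ F ⁻¹' D ∩ S), c p = (e ⟨p, h⟩).2.1 := fun h => dif_pos h
  have hy : ∀ {p} (h : p ∈ F ⁻¹' D ∩ S), y p = (e ⟨p, h⟩).2.2 := fun h => dif_pos h
  have hFs : ∀ {v}, v ∈ D → ∀ r, F (s v r) = v := by
    intro v hv r
    rw [hs hv, ← he1, e.apply_symm_apply]
  have hsm : ∀ {v}, v ∈ D → ∀ r, s v r ∈ F ⁻¹' D ∩ S := by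
    intro v hv r
    rw [hs hv]
    exact (e.symm _).2
  have hes : ∀ {v} (hv : v ∈ D) r, e ⟨s v r, hsm hv r⟩ = (⟨v, hv⟩, (1, r)) := by
    intro v hv r
    have : (⟨s v r, hsm hv r⟩ : ↥(F ⁻¹' D ∩ S)) = e.symm (⟨v, hv⟩, (1, r)) := Subtype.ext (hs hv r)
    rw [this, e.apply_symm_apply]
  have hzm : ∀ p ∈ F ⁻¹' D ∩ S, ∀ z : Circle, z • p ∈ F ⁻¹' D ∩ S := fun p hp z =>
    ⟨by rw [mem_preimage, hF]; exact hp.1, hS z p hp.2⟩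
  refine ⟨⟨c, y, s, ?_, ?_, ?_, fun hv r => (hsm hv r).2, hFs, ?_, ?_, ?_, ?_, ?_⟩⟩
  · rw [continuousOn_iff_continuous_domRestrict]
    have : (F ⁻¹' D ∩ S).domRestrict c = fun p => (e p).2.1 := by
      funext p; exact hc p.2
    rw [this]; fun_prop
  · rw [continuousOn_iff_continuous_domRestrict]
    have : (F ⁻¹' D ∩ S).domRestrict y = fun p => (e p).2.2 := by
      funext p; exact hy p.2
    rw [this]; fun_prop
  · rw [continuousOn_iff_continuous_domRestrict]
    have : (D ×ˢ univ).domRestrict (fun x : (ℝ × ℝ) × Y => s x.1 x.2)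
        = fun x => (e.symm (⟨x.1.1, x.2.1⟩, (1, x.1.2)) : M) := by
      funext x; exact hs x.2.1 _
    rw [this]; fun_prop
  · intro v hv r
    rw [hc (hsm hv r), hes hv]
  · intro v hv r
    rw [hy (hsm hv r), hes hv]
  · intro p hp hpD
    have hp' : p ∈ F ⁻¹' D ∩ S := ⟨hpD, hp⟩
    have h1 := hsm hpD (y p)
    have h2 := he2 (c p) ⟨_, h1⟩ ⟨_, hzm _ h1 (c p)⟩ rfl
    rw [hes hpD] at h2
    have h3 : e ⟨_, hzm _ h1 (c p)⟩ = e ⟨p, hp'⟩ := by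
      refine Prod.ext (Subtype.ext ?_) (h2.trans ?_)
      · rw [he1, he1]
        change F (c p • s (F p) (y p)) = F p
        rw [hF, hFs hpD]
      · rw [mul_one, hc hp', hy hp']
    exact (congrArg Subtype.val (e.injective h3)).symm
  · intro p hp hpD z
    have hp' : p ∈ F ⁻¹' D ∩ S := ⟨hpD, hp⟩
    rw [hc hp', hc (hzm p hp' z), he2 z ⟨p, hp'⟩ ⟨_, hzm p hp' z⟩ rfl]
  · intro p hp hpD z
    have hp' : p ∈ F ⁻¹' D ∩ S := ⟨hpD, hp⟩
    rw [hy hp', hy (hzm p hp' z), he2 z ⟨p, hp'⟩ ⟨_, hzm p hp' z⟩ rfl]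

/-- This converts a coincidence of the coordinate `y` along the flow into a return to a circle
orbit. -/
lemma TrivialCoords.exists_smul {F : M → ℝ × ℝ} {S : Set M} {D : Set (ℝ × ℝ)} {Y : Type}
    [TopologicalSpace Y] (a : TrivialCoords F S D Y) {p q : M} (hp : p ∈ S) (hq : q ∈ S)
    (hF : F p = F q) (hpD : F p ∈ D) (hy : a.y p = a.y q) : ∃ z : Circle, q = z • p := by
  refine ⟨a.c q * (a.c p)⁻¹, ?_⟩
  have h1 := a.eq_smul p hp hpD
  have h2 := a.eq_smul q hq (hF ▸ hpD)
  rw [← hF, ← hy] at h2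
  have h3 : (a.c p)⁻¹ • p = a.s (F p) (a.y p) := by rw [inv_smul_eq_iff]; exact h1
  rw [mul_smul, h3]
  exact h2

/-- Restriction of trivial coordinates to a smaller base. -/
def TrivialCoords.restrict {F : M → ℝ × ℝ} {S : Set M} {D D' : Set (ℝ × ℝ)} {Y : Type}
    [TopologicalSpace Y] (a : TrivialCoords F S D Y) (h : D' ⊆ D) : TrivialCoords F S D' Y where
  c := a.c
  y := a.y
  s := a.s
  cont_c := a.cont_c.mono (inter_subset_inter_left _ (preimage_mono h))
  cont_y := a.cont_y.mono (inter_subset_inter_left _ (preimage_mono h))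
  cont_s := a.cont_s.mono (prod_mono_left h)
  s_mem hv := a.s_mem (h hv)
  F_s hv := a.F_s (h hv)
  c_s hv := a.c_s (h hv)
  y_s hv := a.y_s (h hv)
  eq_smul p hp hpD := a.eq_smul p hp (h hpD)
  c_smul p hp hpD := a.c_smul p hp (h hpD)
  y_smul p hp hpD := a.y_smul p hp (h hpD)

/-- The closed set `S` is over `D` a trivial bundle of cylinders with boundary `bd`, consisting of
points of `R`. -/
structure IsCylinderBundle (φ : Flow ℝ M) (F : M → ℝ × ℝ) (R bd S : Set M) (D : Set (ℝ × ℝ))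
    (a : TrivialCoords F S D unitInterval) (b : TrivialCoords F bd D Bool) : Prop where
  toral : IsToralFlow φ F R
  closed : IsClosed S
  bd_subset : bd ⊆ S
  isOpen_diff : IsOpen (S \ bd)
  smul_mem : ∀ (z : Circle), ∀ p ∈ S, z • p ∈ S
  smul_mem_bd : ∀ (z : Circle), ∀ p ∈ bd, z • p ∈ bd
  regular : ∀ p ∈ S, F p ∈ D → p ∈ R

namespace IsCylinderBundle

variable {φ : Flow ℝ M} {F : M → ℝ × ℝ} {R bd S : Set M} {D : Set (ℝ × ℝ)}
  {a : TrivialCoords F S D unitInterval} {b : TrivialCoords F bd D Bool}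

lemma continuousAt_coord (h : IsCylinderBundle φ F R bd S D a b) {p : M} (hD : F p ∈ D) {I : Set ℝ}
    (hI : ∀ t ∈ I, φ t p ∈ S) : ContinuousOn (fun t => (a.y (φ t p) : ℝ)) I := by
  refine continuous_subtype_val.comp_continuousOn (a.cont_y.comp
    (φ.continuous continuous_id continuous_const).continuousOn fun t ht => ⟨?_, hI t ht⟩)
  rw [mem_preimage, h.toral.map_flow]
  exact hD

/-- Along the flow, the transversal coordinate of a cylinder has no local extremum. -/
lemma not_isLocalExtr (h : IsCylinderBundle φ F R bd S D a b) {p : M} (hD : F p ∈ D)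
    (hS : ∀ᶠ t in 𝓝 (0 : ℝ), φ t p ∈ S) :
    ¬ IsLocalExtr (fun t => (a.y (φ t p) : ℝ)) 0 := by
  have hpS : p ∈ S := by simpa using hS.self_of_nhds
  obtain ⟨ε, hε, hN⟩ := h.toral.no_return p (h.regular p hpS hD)
  have hc : Continuous fun t => φ t p := φ.continuous continuous_id continuous_const
  have hN' : ∀ᶠ t in 𝓝 (0 : ℝ), ∀ s : ℝ, |s| ≤ ε → ∀ z : Circle, φ s (φ t p) = z • φ t p → s = 0 := by
    have := hc.continuousAt.tendsto (x := 0)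
    rw [φ.map_zero_apply] at this
    exact this.eventually hN
  -- two nearby times with the same value coincide
  have hsame : ∀ᶠ t in 𝓝 (0 : ℝ), ∀ s, φ s p ∈ S → |s - t| ≤ ε → φ t p ∈ S →
      (a.y (φ s p) : ℝ) = a.y (φ t p) → s = t := by
    filter_upwards [hN'] with t ht s hs hst htS heq
    obtain ⟨z, hz⟩ := a.exists_smul htS hs (by rw [h.toral.map_flow, h.toral.map_flow])
      (by rw [h.toral.map_flow]; exact hD) (Subtype.ext heq.symm)
    have := ht (s - t) hst z (by rw [← φ.map_add, sub_add_cancel, hz])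
    linarith
  -- Near a minimum, which is strict by `hsame`, the intermediate value theorem gives one value
  -- taken on both sides of `0`, at two distinct nearby times; that contradicts `hsame`. A general
  -- `f` allows maxima to be treated by a change of sign.
  have key : ∀ f : ℝ → ℝ, (∀ᶠ t in 𝓝 (0 : ℝ), ContinuousAt f t) →
      (∀ᶠ t in 𝓝 (0 : ℝ), ∀ s, φ s p ∈ S → |s - t| ≤ ε → φ t p ∈ S → f s = f t → s = t) →
      ¬ IsLocalMin f 0 := by
    intro f hfc hfs hmin
    obtain ⟨δ, hδ, hb⟩ := Metric.eventually_nhds_iff_ball.1 (hfc.and (hfs.and (hmin.and hS)))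
    set η := min (δ / 2) (ε / 2) with hη
    have hη0 : 0 < η := by positivity
    have hη1 : η ≤ δ / 2 := min_le_left _ _
    have hη2 : η ≤ ε / 2 := min_le_right _ _
    have hmem : ∀ t, |t| ≤ η → t ∈ Metric.ball (0 : ℝ) δ := by
      intro t ht
      rw [mem_ball_zero_iff, Real.norm_eq_abs]; linarith
    have hη' : |η| ≤ η := (abs_of_pos hη0).le
    have hηn : |-η| ≤ η := by rw [abs_neg]; exact hη'
    have hcont : ∀ x y, |x| ≤ η → |y| ≤ η → ContinuousOn f (uIcc x y) := by
      intro x y hx hy t ht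
      refine (hb t (hmem t ?_)).1.continuousWithinAt
      rw [abs_le] at hx hy ⊢
      rw [mem_uIcc] at ht
      rcases ht with ht | ht <;> constructor <;> linarith [ht.1, ht.2]
    have h0 : f 0 ≤ f η := (hb η (hmem η hη')).2.2.1
    have h0' : f 0 ≤ f (-η) := (hb (-η) (hmem _ hηn)).2.2.1
    have h00 : |(0 : ℝ)| ≤ η := by rw [abs_zero]; exact hη0.le
    have hlt : f 0 < f η := by
      refine lt_of_le_of_ne h0 fun he => ?_
      have := (hb 0 (hmem 0 h00)).2.1 η (hb η (hmem η hη')).2.2.2 (by rw [sub_zero]; linarith)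
        (hb 0 (hmem 0 h00)).2.2.2 he.symm
      linarith
    have hlt' : f 0 < f (-η) := by
      refine lt_of_le_of_ne h0' fun he => ?_
      have := (hb 0 (hmem 0 h00)).2.1 (-η) (hb (-η) (hmem _ hηn)).2.2.2
        (by rw [sub_zero]; linarith) (hb 0 (hmem 0 h00)).2.2.2 he.symm
      linarith
    have hfin : ∀ t₁ t₂, t₁ ≤ 0 → 0 ≤ t₂ → t₁ ≠ t₂ → |t₁| ≤ η → |t₂| ≤ η → f t₁ = f t₂ → False := by
      intro t₁ t₂ h1 h2 hne ha1 ha2 he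
      refine hne ((hb t₂ (hmem t₂ ha2)).2.1 t₁ (hb t₁ (hmem t₁ ha1)).2.2.2 ?_
        (hb t₂ (hmem t₂ ha2)).2.2.2 he)
      rw [abs_le] at ha1 ha2 ⊢
      constructor <;> linarith [ha1.1, ha1.2, ha2.1, ha2.2]
    rcases le_total (f η) (f (-η)) with hle | hle
    · obtain ⟨t, ht, hft⟩ := intermediate_value_uIcc (hcont 0 (-η) h00 hηn)
        (show f η ∈ uIcc (f 0) (f (-η)) by rw [mem_uIcc]; exact Or.inl ⟨h0, hle⟩)
      rw [uIcc_of_ge (by linarith)] at ht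
      exact hfin t η ht.2 hη0.le (by linarith [ht.2]) (by rw [abs_le]; constructor <;> linarith [ht.1, ht.2]) hη' hft
    · obtain ⟨t, ht, hft⟩ := intermediate_value_uIcc (hcont 0 η h00 hη')
        (show f (-η) ∈ uIcc (f 0) (f η) by rw [mem_uIcc]; exact Or.inl ⟨h0', hle⟩)
      rw [uIcc_of_le hη0.le] at ht
      exact hfin (-η) t (by linarith) ht.1 (by linarith [ht.1]) hηn (by rw [abs_le]; constructor <;> linarith [ht.1, ht.2]) hft.symm
  have hcy : ∀ᶠ t in 𝓝 (0 : ℝ), ContinuousAt (fun t => (a.y (φ t p) : ℝ)) t := by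
    filter_upwards [eventually_eventually_nhds.2 hS] with t ht
    exact (h.continuousAt_coord hD (I := {t | φ t p ∈ S}) (fun t ht => ht)).continuousAt ht
  rintro (hmin | hmax)
  · exact key _ hcy hsame hmin
  · refine key (fun t => - (a.y (φ t p) : ℝ)) (hcy.mono fun t ht => ht.neg) ?_ hmax.neg
    filter_upwards [hsame] with t ht s hs hst htS heq
    exact ht s hs hst htS (neg_injective heq)

/-- An orbit segment inside the cylinder meets every level of the transversal coordinate once. -/
lemma injOn_coord (h : IsCylinderBundle φ F R bd S D a b) {p : M} (hD : F p ∈ D) {I : Set ℝ}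
    (hI : I.OrdConnected) (hS : ∀ t ∈ I, φ t p ∈ S) : InjOn (fun t => (a.y (φ t p) : ℝ)) I := by
  have key : ∀ s ∈ I, ∀ t ∈ I, s < t → (a.y (φ s p) : ℝ) ≠ a.y (φ t p) := by
    intro s hs t ht hst he
    have hsub : Icc s t ⊆ I := hI.out hs ht
    obtain ⟨c, hc, hext⟩ := exists_isLocalExtr_Ioo hst
      ((h.continuousAt_coord hD hS).mono hsub) he
    have hDc : F (φ c p) ∈ D := by rw [h.toral.map_flow]; exact hD
    have htend : Tendsto (fun u : ℝ => u + c) (𝓝 0) (𝓝 c) := by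
      have : Continuous fun u : ℝ => u + c := by fun_prop
      simpa using this.tendsto 0
    refine h.not_isLocalExtr hDc ?_ ?_
    · filter_upwards [htend.eventually (Ioo_mem_nhds hc.1 hc.2)] with u hu
      rw [← φ.map_add]
      exact hS _ (hsub ⟨hu.1.le, hu.2.le⟩)
    · have e : (fun u => (a.y (φ u (φ c p)) : ℝ)) = (fun t => (a.y (φ t p) : ℝ)) ∘ fun u => u + c := by
        funext u
        rw [Function.comp_apply, φ.map_add]
      rw [e]
      have hext' : IsExtrFilter (fun t => (a.y (φ t p) : ℝ)) (𝓝 c) ((fun u : ℝ => u + c) 0) := by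
        rw [show (fun u : ℝ => u + c) 0 = c by simp]; exact hext
      exact IsExtrFilter.comp_tendsto (g := fun u : ℝ => u + c) hext' htend
  intro s hs t ht he
  by_contra hne
  rcases lt_or_gt_of_ne hne with hlt | hlt
  · exact key s hs t ht hlt he
  · exact key t ht s hs hlt he.symm

lemma sameOrbit (h : IsCylinderBundle φ F R bd S D a b) {p : M} {I : Set ℝ} (hD : F p ∈ D)
    (hI : I.OrdConnected) (hS : ∀ t ∈ I, φ t p ∈ S) {s t : ℝ} (hs : s ∈ I) (ht : t ∈ I) {z : Circle}
    (hz : φ t p = z • φ s p) : t = s := by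
  apply h.injOn_coord hD hI hS ht hs
  simp only [hz]
  rw [a.y_smul _ (hS s hs) (by rw [h.toral.map_flow]; exact hD)]

lemma isCompact_fibre (h : IsCylinderBundle φ F R bd S D a b) [ContinuousSMul Circle M] {v : ℝ × ℝ}
    (hv : v ∈ D) : IsCompact {p | p ∈ S ∧ F p = v} := by
  have hc : Continuous fun x : Circle × unitInterval => x.1 • a.s v x.2 := by
    have h1 : Continuous fun r : unitInterval => a.s v r := by
      have : ContinuousOn (fun r : unitInterval => a.s v r) univ :=
        a.cont_s.comp (f := fun r => (v, r)) (by fun_prop) fun r _ => ⟨hv, trivial⟩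
      rwa [← continuousOn_univ]
    fun_prop
  have := isCompact_range hc
  convert this
  ext p
  constructor
  · rintro ⟨hp, rfl⟩
    exact ⟨(a.c p, a.y p), (a.eq_smul p hp hv).symm⟩
  · rintro ⟨x, rfl⟩
    exact ⟨h.smul_mem _ _ (a.s_mem hv _), by simp only [h.toral.map_action, a.F_s hv]⟩

/-- The flow leaves the cylinder in forward time. -/
lemma exists_not_mem (h : IsCylinderBundle φ F R bd S D a b) [ContinuousSMul Circle M] {p : M}
    (hD : F p ∈ D) : ∃ t > 0, φ t p ∉ S := by
  by_contra! hcon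
  have hS : ∀ t ∈ Ioi (0 : ℝ), φ t p ∈ S := fun t ht => hcon t ht
  obtain ⟨q, hq, hcl⟩ := (h.isCompact_fibre hD).exists_mapClusterPt (f := atTop)
    (u := fun t : ℝ => φ t p) (by
      refine tendsto_principal.2 (?_ : ∀ᶠ t : ℝ in atTop, φ t p ∈ _)
      filter_upwards [eventually_gt_atTop 0] with t ht
      exact ⟨hS t ht, h.toral.map_flow t p⟩)
  -- An orbit trapped in the compact fibre accumulates at `q`. Two visits near `q` at times more
  -- than 1 apart differ by a rotation and a flow time below 1, so one circle orbit is met at two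
  -- different times. Taking `s ≥ 2` keeps `u + s` positive.
  obtain ⟨N, hN, htr⟩ := h.toral.transitive q (h.regular q hq.1 (hq.2 ▸ hD)) 1 one_pos
  have hfr := mapClusterPt_iff_frequently.1 hcl N hN
  obtain ⟨s, hs, hsN⟩ := (frequently_atTop.1 hfr) 2
  obtain ⟨t, ht, htN⟩ := (frequently_atTop.1 hfr) (s + 2)
  obtain ⟨u, z, hu, hz⟩ := htr _ htN _ hsN (by rw [h.toral.map_flow, h.toral.map_flow])
  rw [abs_lt] at hu
  rw [← φ.map_add] at hz
  have := h.sameOrbit hD ordConnected_Ioi hS (s := u + s) (t := t)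
    (by rw [mem_Ioi]; linarith) (by rw [mem_Ioi]; linarith) hz
  linarith

end IsCylinderBundle

lemma IsToralFlow.reverse {φ : Flow ℝ M} {F : M → ℝ × ℝ} {R : Set M} (h : IsToralFlow φ F R) :
    IsToralFlow φ.reverse F R where
  map_smul t := h.map_smul (-t)
  continuous_map := h.continuous_map
  map_flow t := h.map_flow (-t)
  map_action := h.map_action
  flow_mem t := h.flow_mem (-t)
  smul_mem := h.smul_mem
  free := h.free
  no_return p hp := by
    obtain ⟨ε, hε, hN⟩ := h.no_return p hp
    refine ⟨ε, hε, hN.mono fun q hq t ht z hz => ?_⟩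
    have := hq (-t) (by rwa [abs_neg]) z hz
    linarith
  transitive p hp ε hε := by
    obtain ⟨N, hN, ht⟩ := h.transitive p hp ε hε
    refine ⟨N, hN, fun q hq q' hq' hF => ?_⟩
    obtain ⟨t, z, h1, h2⟩ := ht q hq q' hq' hF
    refine ⟨-t, z, by rwa [abs_neg], ?_⟩
    rw [h2]
    change z • φ t q' = z • φ (- -t) q'
    rw [neg_neg]

namespace IsCylinderBundle

variable {φ : Flow ℝ M} {F : M → ℝ × ℝ} {R bd S : Set M} {D : Set (ℝ × ℝ)}
  {a : TrivialCoords F S D unitInterval} {b : TrivialCoords F bd D Bool}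

lemma reverse (h : IsCylinderBundle φ F R bd S D a b) :
    IsCylinderBundle φ.reverse F R bd S D a b :=
  { h with toral := h.toral.reverse }

/-- The first exit from the interior of the cylinder in forward time is through the boundary. -/
lemma exists_exit (h : IsCylinderBundle φ F R bd S D a b) [ContinuousSMul Circle M] {p : M}
    (hD : F p ∈ D) (hp : p ∈ S \ bd) :
    ∃ t > 0, (∀ s ∈ Ico 0 t, φ s p ∈ S \ bd) ∧ φ t p ∈ bd := by
  have hc : Continuous fun t => φ t p := φ.continuous continuous_id continuous_const
  set A : Set ℝ := {t | 0 ≤ t ∧ φ t p ∉ S \ bd} with hA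
  have hAc : IsClosed A :=
    isClosed_Ici.inter ((h.isOpen_diff.preimage hc).isClosed_compl)
  have hAn : A.Nonempty := by
    obtain ⟨t, ht, htS⟩ := h.exists_not_mem hD
    exact ⟨t, ht.le, fun h => htS h.1⟩
  have hAb : BddBelow A := ⟨0, fun t ht => ht.1⟩
  have hm := hAc.csInf_mem hAn hAb
  set t := sInf A with ht
  have hbef : ∀ s ∈ Ico 0 t, φ s p ∈ S \ bd := by
    intro s hs
    by_contra hcon
    exact absurd (csInf_le hAb (show s ∈ A from ⟨hs.1, hcon⟩)) (not_le.2 hs.2)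
  have h0 : 0 < t := by
    refine lt_of_le_of_ne hm.1 fun h0 => hm.2 ?_
    rw [← h0, φ.map_zero_apply]; exact hp
  refine ⟨t, h0, hbef, ?_⟩
  have hS : φ t p ∈ S := by
    refine h.closed.mem_of_tendsto (b := 𝓝[<] t) (hc.continuousWithinAt.tendsto) ?_
    filter_upwards [Ioo_mem_nhdsLT h0] with s hs
    exact (hbef s ⟨hs.1.le, hs.2⟩).1
  by_contra hb
  exact hm.2 ⟨hS, hb⟩

/-- Points with extremal transversal coordinate are on the boundary. -/
lemma mem_bd_of_extremal (h : IsCylinderBundle φ F R bd S D a b) {p : M} (hD : F p ∈ D)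
    (hp : p ∈ S) (he : (a.y p : ℝ) = 0 ∨ (a.y p : ℝ) = 1) : p ∈ bd := by
  by_contra hb
  have hc : Continuous fun t => φ t p := φ.continuous continuous_id continuous_const
  have hev : ∀ᶠ t in 𝓝 (0 : ℝ), φ t p ∈ S \ bd := by
    refine hc.continuousAt.eventually_mem (h.isOpen_diff.mem_nhds ?_)
    rw [φ.map_zero_apply]; exact ⟨hp, hb⟩
  -- Off the boundary the flow stays in `S` both ways for a short time, so the extreme values 0 and
  -- 1 would be local extrema.
  refine h.not_isLocalExtr hD (hev.mono fun t ht => ht.1) ?_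
  rcases he with he | he
  · left
    refine Eventually.of_forall fun t => ?_
    simp only [φ.map_zero_apply, he]
    exact (a.y (φ t p)).2.1
  · right
    refine Eventually.of_forall fun t => ?_
    simp only [φ.map_zero_apply, he]
    exact (a.y (φ t p)).2.2

lemma coord_eq_of_bd (h : IsCylinderBundle φ F R bd S D a b) {p q : M} (hD : F p ∈ D)
    (hF : F p = F q) (hp : p ∈ bd) (hq : q ∈ bd) (hy : b.y p = b.y q) : a.y p = a.y q := by
  obtain ⟨z, rfl⟩ := b.exists_smul hp hq hF hD hy
  rw [a.y_smul _ (h.bd_subset hp) hD]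

/-- Points on the boundary have extremal transversal coordinate. -/
lemma extremal_of_mem_bd (h : IsCylinderBundle φ F R bd S D a b) {p : M} (hD : F p ∈ D)
    (hp : p ∈ bd) : (a.y p : ℝ) = 0 ∨ (a.y p : ℝ) = 1 := by
  have hm : ∀ r : unitInterval, (r : ℝ) = 0 ∨ (r : ℝ) = 1 → a.s (F p) r ∈ bd := by
    intro r hr
    apply h.mem_bd_of_extremal (by rw [a.F_s hD]; exact hD) (a.s_mem hD _)
    rwa [a.y_s hD]
  have h0 := hm 0 (Or.inl rfl)
  have h1 := hm 1 (Or.inr rfl)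
  have hne : b.y (a.s (F p) 0) ≠ b.y (a.s (F p) 1) := by
    intro he
    have := h.coord_eq_of_bd (by rw [a.F_s hD]; exact hD) (by rw [a.F_s hD, a.F_s hD]) h0 h1 he
    rw [a.y_s hD, a.y_s hD] at this
    exact zero_ne_one this
  -- Over a point the boundary has only two circles, and the levels 0 and 1 already occupy one each.
  have : b.y p = b.y (a.s (F p) 0) ∨ b.y p = b.y (a.s (F p) 1) := by
    revert hne
    generalize b.y p = x; generalize b.y (a.s (F p) 0) = y; generalize b.y (a.s (F p) 1) = z
    revert x y z; decide
  rcases this with he | he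
  · left
    rw [h.coord_eq_of_bd hD (a.F_s hD _).symm hp h0 he, a.y_s hD]; rfl
  · right
    rw [h.coord_eq_of_bd hD (a.F_s hD _).symm hp h1 he, a.y_s hD]; rfl

/-- Every fibre of a cylinder bundle is swept by the flow from one boundary circle to the other. -/
lemma exists_transit (h : IsCylinderBundle φ F R bd S D a b) [ContinuousSMul Circle M] {v : ℝ × ℝ}
    (hv : v ∈ D) : ∃ (β : Bool) (τ : ℝ), 0 < τ ∧
      (∀ t ∈ Ioo 0 τ, φ t (b.s v β) ∈ S \ bd) ∧ φ τ (b.s v β) ∈ bd ∧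
      b.y (φ τ (b.s v β)) = !β ∧
      ∀ q ∈ S, F q = v → ∃ t ∈ Icc 0 τ, ∃ z : Circle, q = z • φ t (b.s v β) := by
  -- Start halfway across and run both ways to the boundary. The two ends have different
  -- coordinates, hence lie on different circles, and the intermediate value theorem makes the orbit
  -- meet every level between.
  set p₀ := a.s v ⟨1 / 2, by norm_num, by norm_num⟩ with hp₀
  have hFp : F p₀ = v := a.F_s hv _
  have hD : F p₀ ∈ D := hFp ▸ hv
  have hp : p₀ ∈ S \ bd := by
    refine ⟨a.s_mem hv _, fun hb => ?_⟩
    have := h.extremal_of_mem_bd hD hb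
    rw [a.y_s hv] at this
    norm_num at this
  obtain ⟨t₁, ht₁, hin₁, hbd₁⟩ := h.exists_exit hD hp
  obtain ⟨t₂, ht₂, hin₂, hbd₂⟩ := h.reverse.exists_exit hD hp
  change φ (-t₂) p₀ ∈ bd at hbd₂
  have hin : ∀ t ∈ Ioo (-t₂) t₁, φ t p₀ ∈ S \ bd := by
    intro t ht
    rcases le_total 0 t with h0 | h0
    · exact hin₁ t ⟨h0, ht.2⟩
    · have := hin₂ (-t) ⟨by linarith, by linarith [ht.1]⟩
      change φ (- -t) p₀ ∈ S \ bd at this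
      rwa [neg_neg] at this
  have hinS : ∀ t ∈ Icc (-t₂) t₁, φ t p₀ ∈ S := by
    intro t ht
    rcases eq_or_lt_of_le ht.1 with h1 | h1
    · rw [← h1]; exact h.bd_subset hbd₂
    rcases eq_or_lt_of_le ht.2 with h2 | h2
    · rw [h2]; exact h.bd_subset hbd₁
    exact (hin t ⟨h1, h2⟩).1
  have hl : -t₂ ∈ Icc (-t₂) t₁ := ⟨le_rfl, by linarith⟩
  have hr : t₁ ∈ Icc (-t₂) t₁ := ⟨by linarith, le_rfl⟩
  have hne : (a.y (φ (-t₂) p₀) : ℝ) ≠ a.y (φ t₁ p₀) := fun he => by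
    have := h.injOn_coord hD ordConnected_Icc hinS hl hr he
    linarith
  have hFt : ∀ t, F (φ t p₀) = v := fun t => by rw [h.toral.map_flow, hFp]
  have hbne : b.y (φ (-t₂) p₀) ≠ b.y (φ t₁ p₀) := fun he => hne (by
    rw [h.coord_eq_of_bd (by rw [hFt]; exact hv) (by rw [hFt, hFt]) hbd₂ hbd₁ he])
  set β := b.y (φ (-t₂) p₀) with hβ
  obtain ⟨z, hz⟩ := b.exists_smul hbd₂ (b.s_mem hv β) (by rw [hFt, b.F_s hv])
    (by rw [hFt]; exact hv) (by rw [b.y_s hv])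
  have hshift : ∀ t, φ t (b.s v β) = z • φ (t - t₂) p₀ := by
    intro t
    rw [hz, h.toral.map_smul, ← φ.map_add, sub_eq_add_neg]
  refine ⟨β, t₁ + t₂, by linarith, ?_, ?_, ?_, ?_⟩
  · intro t ht
    rw [hshift]
    have := hin (t - t₂) ⟨by linarith [ht.1], by linarith [ht.2]⟩
    refine ⟨h.smul_mem _ _ this.1, fun hb => this.2 ?_⟩
    have := h.smul_mem_bd z⁻¹ _ hb
    rwa [inv_smul_smul] at this
  · rw [hshift, add_sub_cancel_right]
    exact h.smul_mem_bd _ _ hbd₁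
  · rw [hshift, add_sub_cancel_right, b.y_smul _ hbd₁ (by rw [hFt]; exact hv)]
    revert hbne
    generalize b.y (φ t₁ p₀) = y
    generalize β = x
    revert x y; decide
  · intro q hq hFq
    have hc := h.continuousAt_coord hD hinS
    have hm : (a.y q : ℝ) ∈ uIcc (a.y (φ (-t₂) p₀) : ℝ) (a.y (φ t₁ p₀)) := by
      have e1 := h.extremal_of_mem_bd (by rw [hFt]; exact hv) hbd₂
      have e2 := h.extremal_of_mem_bd (by rw [hFt]; exact hv) hbd₁
      have := (a.y q).2
      rw [mem_uIcc]
      rcases e1 with e1 | e1 <;> rcases e2 with e2 | e2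
      · exact absurd (e1.trans e2.symm) hne
      · rw [e1, e2]; exact Or.inl this
      · rw [e1, e2]; exact Or.inr this
      · exact absurd (e1.trans e2.symm) hne
    obtain ⟨t, ht, hty⟩ := intermediate_value_uIcc
      (f := fun t => (a.y (φ t p₀) : ℝ)) (a := -t₂) (b := t₁)
      (by rwa [uIcc_of_le (by linarith)]) hm
    rw [uIcc_of_le (by linarith)] at ht
    obtain ⟨z', hz'⟩ := a.exists_smul (hinS t ht) hq (by rw [hFt, hFq]) (by rw [hFt]; exact hv)
      (Subtype.ext hty)
    refine ⟨t + t₂, ⟨by linarith [ht.1], by linarith [ht.2]⟩, z' * z⁻¹, ?_⟩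
    rw [hshift, add_sub_cancel_right, mul_smul, inv_smul_smul, hz']

end IsCylinderBundle

end

/-! ### Transit times and holonomies inside and outside the ball -/

noncomputable section

variable {M : Type*} [TopologicalSpace M] [MulAction Circle M]

/-- The flow sweeps the part of the cylinder `S` over `v` in time `τ`, starting from the
boundary circle `β`. -/
structure IsTransit (φ : Flow ℝ M) (F : M → ℝ × ℝ) (bd S : Set M) {D : Set (ℝ × ℝ)}
    (b : TrivialCoords F bd D Bool) (v : ℝ × ℝ) (β : Bool) (τ : ℝ) : Prop where
  pos : 0 < τ
  mem : ∀ t ∈ Ioo 0 τ, φ t (b.s v β) ∈ S \ bd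
  mem_bd : φ τ (b.s v β) ∈ bd
  exit : b.y (φ τ (b.s v β)) = !β
  cover : ∀ q ∈ S, F q = v → ∃ t ∈ Icc 0 τ, ∃ z : Circle, q = z • φ t (b.s v β)

namespace IsCylinderBundle

variable {φ : Flow ℝ M} {F : M → ℝ × ℝ} {R bd S : Set M} {D : Set (ℝ × ℝ)}
  {a : TrivialCoords F S D unitInterval} {b : TrivialCoords F bd D Bool}

/-- A boundary point reached from inside is left by the flow. -/
lemma exists_not_mem_of_bd (h : IsCylinderBundle φ F R bd S D a b) {p : M} (hD : F p ∈ D)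
    (hp : p ∈ bd) {δ : ℝ} (hδ : 0 < δ) (hback : ∀ t ∈ Ioo (-δ) 0, φ t p ∈ S) {ε : ℝ} (hε : 0 < ε) :
    ∃ t ∈ Ioo 0 ε, φ t p ∉ S := by
  by_contra! hcon
  refine h.not_isLocalExtr hD ?_ ?_
  · filter_upwards [Ioo_mem_nhds (neg_lt_zero.2 hδ) hε] with t ht
    rcases lt_trichotomy t 0 with h0 | rfl | h0
    · exact hback t ⟨ht.1, h0⟩
    · rw [φ.map_zero_apply]; exact h.bd_subset hp
    · exact hcon t ⟨h0, ht.2⟩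
  · rcases h.extremal_of_mem_bd hD hp with he | he
    · left
      refine Eventually.of_forall fun t => ?_
      simp only [φ.map_zero_apply, he]
      exact (a.y (φ t p)).2.1
    · right
      refine Eventually.of_forall fun t => ?_
      simp only [φ.map_zero_apply, he]
      exact (a.y (φ t p)).2.2

/-- A point of the exit circle is a rotation of the end of the transit, so its immediate past lies
in the cylinder. Were its immediate future there too, the coordinate would have a local extremum.
Only the entrance circle is left. -/
lemma entry_eq (h : IsCylinderBundle φ F R bd S D a b) {v : ℝ × ℝ} (hv : v ∈ D) {β : Bool} {τ : ℝ}
    (hT : IsTransit φ F bd S b v β τ) {p : M} (hp : p ∈ bd) (hF : F p = v) {δ : ℝ} (hδ : 0 < δ)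
    (hin : ∀ t ∈ Ioo 0 δ, φ t p ∈ S) : b.y p = β := by
  by_contra hne
  have hFe : ∀ t, F (φ t (b.s v β)) = v := fun t => by rw [h.toral.map_flow, b.F_s hv]
  have hy : b.y (φ τ (b.s v β)) = b.y p := by
    rw [hT.exit]
    exact Bool.eq_not_of_ne (Ne.symm hne) |> fun e => by rw [e, Bool.not_not]
  obtain ⟨z, rfl⟩ := b.exists_smul hT.mem_bd hp (by rw [hFe, hF]) (by rw [hFe]; exact hv) hy
  obtain ⟨t, ht, htS⟩ := h.exists_not_mem_of_bd (by rw [hFe]; exact hv) hT.mem_bd hT.pos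
    (fun t ht => by
      rw [← φ.map_add]
      exact (hT.mem _ ⟨by linarith [ht.1], by linarith [ht.2]⟩).1) hδ
  apply htS
  have := h.smul_mem z⁻¹ _ (hin t ht)
  rwa [h.toral.map_smul, inv_smul_smul] at this

lemma continuousWithinAt_section (b : TrivialCoords F bd D Bool) {v₀ : ℝ × ℝ} (hv₀ : v₀ ∈ D) (β : Bool) :
    ContinuousWithinAt (fun v => b.s v β) D v₀ :=
  (b.cont_s.comp (f := fun v => (v, β)) (by fun_prop) fun v hv => ⟨hv, trivial⟩) v₀ hv₀

/-- The entry circle is locally constant and the transit time is continuous. -/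
lemma eventually_transit (h : IsCylinderBundle φ F R bd S D a b) {v₀ : ℝ × ℝ} (hv₀ : v₀ ∈ D)
    {β : ℝ × ℝ → Bool} {τ : ℝ × ℝ → ℝ} (hT : ∀ v ∈ D, IsTransit φ F bd S b v (β v) (τ v))
    {ε : ℝ} (hε : 0 < ε) :
    ∀ᶠ v in 𝓝[D] v₀, β v = β v₀ ∧ |τ v - τ v₀| < ε := by
  have T₀ := hT v₀ hv₀
  set p₀ := b.s v₀ (β v₀) with hp₀
  have hp₀b : p₀ ∈ bd := b.s_mem hv₀ _
  have hFp₀ : F p₀ = v₀ := b.F_s hv₀ _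
  have hs : Tendsto (fun v => b.s v (β v₀)) (𝓝[D] v₀) (𝓝 p₀) := continuousWithinAt_section b hv₀ _
  obtain ⟨ε₀, hε₀, hN⟩ := h.toral.no_return p₀ (h.regular _ (h.bd_subset hp₀b) (hFp₀ ▸ hv₀))
  have hO : ∀ᶠ q in 𝓝 p₀, q ∈ bd → F q ∈ D → b.y q = β v₀ := by
    have h1 : ∀ᶠ q in 𝓝[F ⁻¹' D ∩ bd] p₀, b.y q ∈ ({b.y p₀} : Set Bool) :=
      (b.cont_y p₀ ⟨by rw [mem_preimage, hFp₀]; exact hv₀, hp₀b⟩).eventually_mem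
        (isOpen_discrete _ |>.mem_nhds rfl)
    rw [eventually_nhdsWithin_iff] at h1
    filter_upwards [h1] with q hq h2 h3
    rw [mem_singleton_iff.1 (hq ⟨h3, h2⟩), hp₀, b.y_s hv₀]
  -- short forward orbits stay where the boundary coordinate is constant
  have hφc : Continuous fun x : ℝ × M => φ x.1 x.2 := φ.continuous continuous_fst continuous_snd
  have hO' : ∀ᶠ x : ℝ × M in 𝓝 (0, p₀), φ x.1 x.2 ∈ bd → F (φ x.1 x.2) ∈ D → b.y (φ x.1 x.2) = β v₀ := by
    have := hφc.tendsto (0, p₀)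
    simp only [φ.map_zero_apply] at this
    exact this.eventually hO
  rw [nhds_prod_eq] at hO'
  obtain ⟨pa, hpa, pb, hpb, hab⟩ := eventually_prod_iff.1 hO'
  obtain ⟨δ₀, hδ₀, hball⟩ := Metric.eventually_nhds_iff_ball.1 hpa
  set δ := min (min (δ₀ / 2) ε₀) (min (ε / 2) (τ v₀ / 2)) with hδdef
  have hδ : 0 < δ := by have := T₀.pos; positivity
  have hδ1 : δ ≤ δ₀ / 2 := (min_le_left _ _).trans (min_le_left _ _)
  have hδ2 : δ ≤ ε₀ := (min_le_left _ _).trans (min_le_right _ _)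
  have hδ3 : δ ≤ ε / 2 := (min_le_right _ _).trans (min_le_left _ _)
  have hδ4 : δ ≤ τ v₀ / 2 := (min_le_right _ _).trans (min_le_right _ _)
  have hmid : ∀ᶠ q in 𝓝 p₀, ∀ t ∈ Icc δ (τ v₀ - δ), φ t q ∈ S \ bd := by
    refine isCompact_Icc.eventually_forall_of_forall_eventually fun t ht => ?_
    refine (hφc.comp continuous_swap).continuousAt.eventually_mem
      (x := (p₀, t)) (h.isOpen_diff.mem_nhds ?_)
    exact T₀.mem t ⟨by linarith [ht.1], by linarith [ht.2]⟩
  -- A moment soon after the exit at which the orbit is outside `S`; this is an open condition and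
  -- bounds nearby transit times from above.
  obtain ⟨t', ht', ht'S⟩ := h.exists_not_mem_of_bd (p := φ (τ v₀) p₀)
    (by rw [h.toral.map_flow, hFp₀]; exact hv₀) T₀.mem_bd T₀.pos (fun t ht => by
      rw [← φ.map_add]
      exact (T₀.mem _ ⟨by linarith [ht.1], by linarith [ht.2]⟩).1) hε
  rw [← φ.map_add] at ht'S
  have hout : ∀ᶠ q in 𝓝 p₀, φ (t' + τ v₀) q ∉ S :=
    (φ.continuous continuous_const continuous_id).continuousAt.eventually_mem
      (h.closed.isOpen_compl.mem_nhds ht'S)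
  filter_upwards [hs.eventually hN, hs.eventually hpb, hs.eventually hmid, hs.eventually hout,
    self_mem_nhdsWithin] with v h1 h2 h3 h4 hv
  have hFv : F (b.s v (β v₀)) = v := b.F_s hv _
  have hbv : b.s v (β v₀) ∈ bd := b.s_mem hv _
  -- A boundary point met so early is on the starting circle, as the label of the circle is locally
  -- constant; that is a return excluded by `no_return`.
  have hnb : ∀ t ∈ Ioc 0 δ, φ t (b.s v (β v₀)) ∉ bd := by
    intro t ht hb
    have hFt : F (φ t (b.s v (β v₀))) = v := by rw [h.toral.map_flow, hFv]
    have hy := hab (hball t (by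
      rw [mem_ball_zero_iff, Real.norm_eq_abs, abs_of_pos ht.1]; linarith [ht.2])) h2 hb
      (by rw [hFt]; exact hv)
    obtain ⟨z, hz⟩ := b.exists_smul hbv hb (by rw [hFt, hFv]) (by rw [hFv]; exact hv)
      (by rw [hy, b.y_s hv])
    have := h1 t (by rw [abs_of_pos ht.1]; linarith [ht.2]) z hz
    linarith [ht.1]
  have hc : Continuous fun t => φ t (b.s v (β v₀)) := φ.continuous continuous_id continuous_const
  -- This arc avoids the boundary, is connected, and at time `δ` is inside.
  have hin : ∀ t ∈ Ioc 0 δ, φ t (b.s v (β v₀)) ∈ S \ bd := by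
    have hpre : IsPreconnected ((fun t => φ t (b.s v (β v₀))) '' Ioc 0 δ) :=
      isPreconnected_Ioc.image _ hc.continuousOn
    have hcov : (fun t => φ t (b.s v (β v₀))) '' Ioc 0 δ ⊆ (S \ bd) ∪ Sᶜ := by
      rintro _ ⟨t, ht, rfl⟩
      by_cases hS : φ t (b.s v (β v₀)) ∈ S
      · exact Or.inl ⟨hS, hnb t ht⟩
      · exact Or.inr hS
    have hsub := hpre.subset_left_of_subset_union h.isOpen_diff h.closed.isOpen_compl
      (disjoint_left.2 fun x hx hx' => hx' hx.1) hcov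
      ⟨φ δ (b.s v (β v₀)), mem_image_of_mem (fun t => φ t (b.s v (β v₀))) (right_mem_Ioc.2 hδ),
        h3 δ ⟨le_rfl, by linarith⟩⟩
    exact fun t ht => hsub ⟨t, ht, rfl⟩
  have hβ : β v = β v₀ := by
    rw [← h.entry_eq hv (hT v hv) hbv hFv hδ fun t ht => (hin t ⟨ht.1, ht.2.le⟩).1, b.y_s hv]
  refine ⟨hβ, ?_⟩
  have T := hT v hv
  rw [hβ] at T
  have hlow : τ v₀ - δ < τ v := by
    by_contra! hle
    rcases le_or_gt (τ v) δ with h5 | h5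
    · exact (hin _ ⟨T.pos, h5⟩).2 T.mem_bd
    · exact (h3 _ ⟨h5.le, hle⟩).2 T.mem_bd
  have hup : τ v < t' + τ v₀ := by
    by_contra! hle
    rcases eq_or_lt_of_le hle with h5 | h5
    · rw [h5] at h4; exact h4 (h.bd_subset T.mem_bd)
    · exact h4 (T.mem _ ⟨by linarith [ht'.1, T₀.pos], h5⟩).1
  rw [abs_lt]
  constructor <;> linarith [ht'.2]

/-- Transit data of a bundle of cylinders. -/
theorem exists_transit_data (h : IsCylinderBundle φ F R bd S D a b) [ContinuousSMul Circle M] :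
    ∃ (β : ℝ × ℝ → Bool) (τ : ℝ × ℝ → ℝ), (∀ v ∈ D, IsTransit φ F bd S b v (β v) (τ v)) ∧
      ContinuousOn β D ∧ ContinuousOn τ D := by
  classical
  choose! β τ h1 h2 h3 h4 h5 using fun v (hv : v ∈ D) => h.exists_transit hv
  have hT : ∀ v ∈ D, IsTransit φ F bd S b v (β v) (τ v) := fun v hv =>
    ⟨h1 v hv, h2 v hv, h3 v hv, h4 v hv, h5 v hv⟩
  refine ⟨β, τ, hT, fun v hv => ?_, fun v hv => ?_⟩
  · refine tendsto_nhds_of_eventually_eq ?_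
    exact (h.eventually_transit hv hT one_pos).mono fun x hx => hx.1
  · rw [ContinuousWithinAt, Metric.tendsto_nhds]
    intro ε hε
    exact (h.eventually_transit hv hT hε).mono fun x hx => hx.2

end IsCylinderBundle

/-- Sections over the base of the two boundary circles of the ball, with the transit times and
holonomies of the flow inside the ball and outside it. -/
structure IsTransitSystem (φ : Flow ℝ M) (F : M → ℝ × ℝ) (vbar : ℝ × ℝ) (B : Set M)
    (D : Set (ℝ × ℝ)) (σ₁ σ₂ : ℝ × ℝ → M) (τB τC : ℝ × ℝ → ℝ) (ζB ζC : ℝ × ℝ → Circle) : Prop where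
  cont_sec₁ : ContinuousOn σ₁ D
  cont_sec₂ : ContinuousOn σ₂ D
  cont_τB : ContinuousOn τB (D \ {vbar})
  cont_τC : ContinuousOn τC D
  cont_ζB : ContinuousOn ζB (D \ {vbar})
  cont_ζC : ContinuousOn ζC D
  F_sec₁ : ∀ v ∈ D, F (σ₁ v) = v
  F_sec₂ : ∀ v ∈ D, F (σ₂ v) = v
  mem_sec₁ : ∀ v ∈ D, σ₁ v ∈ frontier B
  mem_sec₂ : ∀ v ∈ D, σ₂ v ∈ frontier B
  ne_sec : ∀ v ∈ D, ∀ z : Circle, σ₂ v ≠ z • σ₁ v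
  pos_τB : ∀ v ∈ D \ {vbar}, 0 < τB v
  pos_τC : ∀ v ∈ D, 0 < τC v
  inside : ∀ v ∈ D \ {vbar}, ∀ t ∈ Ioo 0 (τB v), φ t (σ₁ v) ∈ B
  outside : ∀ v ∈ D, ∀ t ∈ Ioo 0 (τC v), φ t (σ₂ v) ∉ closure B
  exit : ∀ v ∈ D \ {vbar}, φ (τB v) (σ₁ v) = ζB v • σ₂ v
  enter : ∀ v ∈ D, φ (τC v) (σ₂ v) = ζC v • σ₁ v
  cover_inside : ∀ v ∈ D \ {vbar}, ∀ q ∈ closure B, F q = v →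
    ∃ t ∈ Icc 0 (τB v), ∃ z : Circle, q = z • φ t (σ₁ v)
  cover_outside : ∀ v ∈ D, ∀ q ∉ B, F q = v →
    ∃ t ∈ Icc 0 (τC v), ∃ z : Circle, q = z • φ t (σ₂ v)

/-- The closure of `B` over the punctured disk and the complement of `B` over the whole disk are two
cylinder bundles with a common boundary. The holonomies are the circle coordinates of the exit
points. -/
theorem IsLocalPair.exists_transitSystem [ChartedSpace E4 M] [ContinuousSMul Circle M]
    {φ : Flow ℝ M} {F : M → ℝ × ℝ} {pbar : M} {B : Set M} {D V : Set (ℝ × ℝ)}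
    (hBD : IsLocalPair F pbar B D) (hDV : D ⊆ V) (ht : IsToralFlow φ F {p | F p ∈ V ∧ p ≠ pbar}) :
    ∃ σ₁ σ₂ τB τC ζB ζC, IsTransitSystem φ F (F pbar) B D σ₁ σ₂ τB τC ζB ζC := by
  have hBo := hBD.isOpen_ball
  have : Nonempty M := ⟨pbar⟩
  have hsc : ∀ z : Circle, Continuous fun p : M => z • p := fun z => continuous_const_smul z
  have hcl : ∀ (z : Circle), ∀ p ∈ closure B, z • p ∈ closure B := fun z p hp =>
    map_mem_closure (hsc z) hp fun q hq => hBD.invariant z q hq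
  have hco : ∀ (z : Circle), ∀ p ∈ Bᶜ, z • p ∈ Bᶜ := fun z p hp hz => hp (by
    have := hBD.invariant z⁻¹ _ hz
    rwa [inv_smul_smul] at this)
  have hfr : ∀ (z : Circle), ∀ p ∈ frontier B, z • p ∈ frontier B := fun z p hp => by
    rw [hBo.frontier_eq] at hp ⊢
    exact ⟨hcl z p hp.1, hco z p hp.2⟩
  obtain ⟨b⟩ := hBD.boundary.nonempty_coords ht.map_action hfr
  obtain ⟨aC⟩ := hBD.complement.nonempty_coords ht.map_action hco
  obtain ⟨aB⟩ := hBD.inside.nonempty_coords ht.map_action hcl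
  have hsub : D \ {F pbar} ⊆ D := sdiff_subset
  have e1 : closure B \ frontier B = B := by
    rw [closure_sdiff_frontier, hBo.interior_eq]
  have e2 : Bᶜ \ frontier B = (closure B)ᶜ := by
    rw [hBo.frontier_eq]
    ext p
    simp only [Set.mem_sdiff, mem_compl_iff]
    have := @subset_closure _ _ B p
    tauto
  have hB : IsCylinderBundle φ F {p | F p ∈ V ∧ p ≠ pbar} (frontier B) (closure B) (D \ {F pbar}) aB
      (b.restrict hsub) :=
    { toral := ht
      closed := isClosed_closure
      bd_subset := frontier_subset_closure
      isOpen_diff := by rw [e1]; exact hBo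
      smul_mem := hcl
      smul_mem_bd := hfr
      regular := fun p _ hp => ⟨hDV hp.1, fun he => hp.2 (by rw [he]; rfl)⟩ }
  have hC : IsCylinderBundle φ F {p | F p ∈ V ∧ p ≠ pbar} (frontier B) Bᶜ D aC b :=
    { toral := ht
      closed := hBo.isClosed_compl
      bd_subset := fun p hp => by rw [hBo.frontier_eq] at hp; exact hp.2
      isOpen_diff := by rw [e2]; exact isClosed_closure.isOpen_compl
      smul_mem := hco
      smul_mem_bd := hfr
      regular := fun p hp hD => ⟨hDV hD, fun he => hp (by rw [he]; exact hBD.mem_ball)⟩ }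
  obtain ⟨βB, τB, TB, -, cτB⟩ := hB.exists_transit_data
  obtain ⟨βC, τC, TC, cβC, cτC⟩ := hC.exists_transit_data
  have hDpre : IsPreconnected D := by
    have := hBD.contractible_disk
    exact (isConnected_iff_connectedSpace.2 inferInstance).isPreconnected
  obtain ⟨β, hβ⟩ : ∃ β, ∀ v ∈ D, βC v = β := ⟨βC (F pbar), fun v hv =>
    hDpre.constant cβC hv hBD.mem_disk⟩
  replace TC : ∀ v ∈ D, IsTransit φ F (frontier B) Bᶜ b v β (τC v) := fun v hv => hβ v hv ▸ TC v hv
  -- If both cylinders were entered through the same circle, an orbit would be inside and outside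
  -- `B` at once. So the entrance to the ball is constant because that of the complement is, and
  -- connectedness of the punctured disk is not needed.
  have hβB : ∀ v ∈ D \ {F pbar}, βB v = !β := by
    intro v hv
    by_contra hne
    have hb : βB v = β := by
      cases hx : βB v <;> cases β <;> simp_all
    have T1 := TB v hv
    have T2 := TC v hv.1
    rw [hb] at T1
    set t := min (τB v) (τC v) / 2
    have hm : 0 < min (τB v) (τC v) := lt_min T1.pos T2.pos
    have h1 := T1.mem t ⟨by positivity, by
      have := min_le_left (τB v) (τC v); simp only [t]; linarith⟩
    have h2 := T2.mem t ⟨by positivity, by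
      have := min_le_right (τB v) (τC v); simp only [t]; linarith⟩
    rw [e1] at h1
    exact h2.1 h1
  have TB' : ∀ v ∈ D \ {F pbar}, IsTransit φ F (frontier B) (closure B) (b.restrict hsub) v (!β) (τB v) :=
    fun v hv => hβB v hv ▸ TB v hv
  have hφc : Continuous fun x : ℝ × M => φ x.1 x.2 := φ.continuous continuous_fst continuous_snd
  have hsec : ∀ β, ContinuousOn (fun v => b.s v β) D := fun β v hv =>
    IsCylinderBundle.continuousWithinAt_section b hv β
  refine ⟨fun v => b.s v (!β), fun v => b.s v β, τB, τC, fun v => b.c (φ (τB v) (b.s v (!β))),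
    fun v => b.c (φ (τC v) (b.s v β)), ?_⟩
  exact
    { cont_sec₁ := hsec _
      cont_sec₂ := hsec _
      cont_τB := cτB
      cont_τC := cτC
      cont_ζB := b.cont_c.comp (hφc.comp_continuousOn (cτB.prodMk ((hsec _).mono hsub)))
        fun v hv => ⟨by
          rw [mem_preimage]; erw [ht.map_flow]; rw [b.F_s hv.1]; exact hv.1, (TB' v hv).mem_bd⟩
      cont_ζC := b.cont_c.comp (hφc.comp_continuousOn (cτC.prodMk (hsec _)))
        fun v hv => ⟨by
          rw [mem_preimage]; erw [ht.map_flow]; rw [b.F_s hv]; exact hv, (TC v hv).mem_bd⟩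
      F_sec₁ := fun v hv => b.F_s hv _
      F_sec₂ := fun v hv => b.F_s hv _
      mem_sec₁ := fun v hv => b.s_mem hv _
      mem_sec₂ := fun v hv => b.s_mem hv _
      ne_sec := fun v hv z he => by
        have := congrArg b.y he
        rw [b.y_smul _ (b.s_mem hv _) (by rw [b.F_s hv]; exact hv), b.y_s hv, b.y_s hv] at this
        cases β <;> simp at this
      pos_τB := fun v hv => (TB' v hv).pos
      pos_τC := fun v hv => (TC v hv).pos
      inside := fun v hv t h => by
        have := (TB' v hv).mem t h
        rw [e1] at this; exact this
      outside := fun v hv t h => by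
        have := (TC v hv).mem t h
        rw [e2] at this; exact this
      exit := fun v hv => by
        have hF : F (φ (τB v) (b.s v (!β))) = v := by rw [ht.map_flow, b.F_s hv.1]
        have := b.eq_smul _ (TB' v hv).mem_bd (by erw [hF]; exact hv.1)
        have hy : b.y (φ (τB v) (b.s v (!β))) = β := (TB' v hv).exit.trans (Bool.not_not β)
        refine this.trans ?_
        change _ • b.s (F (φ (τB v) (b.s v (!β)))) (b.y (φ (τB v) (b.s v (!β)))) = _
        rw [hF, hy]; rfl
      enter := fun v hv => by
        have hF : F (φ (τC v) (b.s v β)) = v := by rw [ht.map_flow, b.F_s hv]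
        have := b.eq_smul _ (TC v hv).mem_bd (by rw [hF]; exact hv)
        rw [hF, (TC v hv).exit] at this
        exact this
      cover_inside := fun v hv q hq hF => (TB' v hv).cover q hq hF
      cover_outside := fun v hv q hq hF => (TC v hv).cover q hq hF }

end

/-! ### Primitives of closed 1-forms along maps -/

noncomputable section

section Primitives

variable {M : Type*} [TopologicalSpace M] [ChartedSpace E4 M]

/-- `f` is a primitive of `θ` near `p`. -/
def IsLocalPrimitive (θ : (p : M) → TangentSpace (𝓡 4) p →L[ℝ] ℝ) (f : M → ℝ) (p : M) : Prop :=
  ∀ᶠ q in 𝓝 p, HasMFDerivAt (𝓡 4) 𝓘(ℝ, ℝ) f q (θ q)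

/-- `G` is, near `x`, the pullback along `q` of a primitive of `θ`. -/
def IsPrimitiveAlong {X : Type*} [TopologicalSpace X]
    (θ : (p : M) → TangentSpace (𝓡 4) p →L[ℝ] ℝ) (q : X → M) (G : X → ℝ) (x : X) : Prop :=
  ∃ f, IsLocalPrimitive θ f (q x) ∧ ∀ᶠ x' in 𝓝 x, G x' = f (q x')

variable {θ : (p : M) → TangentSpace (𝓡 4) p →L[ℝ] ℝ} {f g : M → ℝ} {p : M}

lemma IsLocalPrimitive.eventually (h : IsLocalPrimitive θ f p) :
    ∀ᶠ q in 𝓝 p, IsLocalPrimitive θ f q :=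
  eventually_eventually_nhds.2 h

lemma IsLocalPrimitive.hasMFDerivAt (h : IsLocalPrimitive θ f p) :
    HasMFDerivAt (𝓡 4) 𝓘(ℝ, ℝ) f p (θ p) :=
  h.self_of_nhds

lemma IsLocalPrimitive.add_const (h : IsLocalPrimitive θ f p) (c : ℝ) :
    IsLocalPrimitive θ (fun q => f q + c) p := by
  filter_upwards [h] with q hq
  have := hq.add (hasMFDerivAt_const c q)
  exact this.congr_mfderiv (add_zero (θ q))

lemma IsLocalPrimitive.hasDerivAt_comp {X : (p : M) → TangentSpace (𝓡 4) p} {γ : ℝ → M} {t : ℝ}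
    (h : IsLocalPrimitive θ f (γ t)) (hγ : IsMIntegralCurve (I := 𝓡 4) γ X) :
    HasDerivAt (fun s => f (γ s)) (θ (γ t) (X (γ t))) t := by
  have h1 := h.hasMFDerivAt.comp t (hγ t)
  have h2 : HasFDerivAt (𝕜 := ℝ) (fun s => f (γ s))
      ((1 : ℝ →L[ℝ] ℝ).smulRight (θ (γ t) (X (γ t)) : ℝ) : ℝ →L[ℝ] ℝ) t :=
    hasMFDerivAt_iff_hasFDerivAt.1 (h1.congr_mfderiv
      (ContinuousLinearMap.ext fun r : ℝ => map_smul (θ (γ t)) r (X (γ t))))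
  have h3 := HasFDerivAt.hasDerivAt (F := ℝ) h2
  have h4 : ((1 : ℝ →L[ℝ] ℝ).smulRight (θ (γ t) (X (γ t)) : ℝ)) (1 : ℝ) = θ (γ t) (X (γ t)) :=
    one_smul ℝ (θ (γ t) (X (γ t)) : ℝ)
  rwa [h4] at h3

section Manifold

variable [IsManifold (𝓡 4) ∞ M]

/-- On a ball in the chart the difference of the two primitives has zero derivative, hence is
constant. -/
lemma IsLocalPrimitive.eventually_sub_eq (hf : IsLocalPrimitive θ f p)
    (hg : IsLocalPrimitive θ g p) : ∀ᶠ q in 𝓝 p, g q = f q + (g p - f p) := by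
  set e := extChartAt (𝓡 4) p
  have hy : e p ∈ e.target := mem_extChartAt_target p
  have hc : ContinuousAt e.symm (e p) := continuousAt_extChartAt_symm p
  have hev : ∀ᶠ y in 𝓝 (e p), y ∈ e.target ∧
      HasMFDerivAt (𝓡 4) 𝓘(ℝ, ℝ) f (e.symm y) (θ (e.symm y)) ∧
      HasMFDerivAt (𝓡 4) 𝓘(ℝ, ℝ) g (e.symm y) (θ (e.symm y)) := by
    have hm : ∀ᶠ y in 𝓝 (e p), y ∈ e.target := (isOpen_chart_target p).mem_nhds hy
    refine hm.and ?_
    have ht : Tendsto e.symm (𝓝 (e p)) (𝓝 p) := by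
      have := hc.tendsto
      rwa [extChartAt_to_inv] at this
    exact (ht.eventually hf).and (ht.eventually hg)
  obtain ⟨r, hr, hb⟩ := Metric.eventually_nhds_iff_ball.1 hev
  have hder : ∀ y ∈ Metric.ball (e p) r,
      HasFDerivAt (fun y => g (e.symm y) - f (e.symm y)) (0 : E4 →L[ℝ] ℝ) y := by
    intro y hy
    obtain ⟨h1, h2, h3⟩ := hb y hy
    have hs := (mdifferentiableAt_chart_symm h1).hasMFDerivAt
    have h4 := (h3.comp y hs).sub (h2.comp y hs)
    have h5 := hasMFDerivAt_iff_hasFDerivAt.1 h4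
    exact h5.congr_fderiv (ContinuousLinearMap.ext fun u : E4 => sub_self _)
  have hconst : ∀ y ∈ Metric.ball (e p) r,
      g (e.symm y) - f (e.symm y) = g (e.symm (e p)) - f (e.symm (e p)) := by
    intro y hy
    refine (convex_ball (e p) r).is_const_of_fderivWithin_eq_zero (𝕜 := ℝ)
      (f := fun y => g (e.symm y) - f (e.symm y))
      (fun z hz => (hder z hz).differentiableAt.differentiableWithinAt) (fun z hz => ?_) hy
      (Metric.mem_ball_self hr)
    rw [fderivWithin_of_isOpen Metric.isOpen_ball hz, (hder z hz).fderiv]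
  have hce : Tendsto e (𝓝 p) (𝓝 (e p)) := continuousAt_extChartAt p
  filter_upwards [hce.eventually (Metric.ball_mem_nhds _ hr), extChartAt_source_mem_nhds (I := 𝓡 4) p]
    with q hq hqs
  have h1 := hconst _ hq
  rw [e.left_inv hqs, extChartAt_to_inv] at h1
  linarith

variable [MulAction Circle M] {XJ : (p : M) → TangentSpace (𝓡 4) p} {S : Set M}

/-- The Poincaré lemma on a ball in the chart, pulled back to `M`. -/
lemma IsRotationForm.exists_primitive (hθ : IsRotationForm XJ θ S) {p : M} (hp : p ∈ S) :
    ∃ f, IsLocalPrimitive θ f p := by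
  set e := extChartAt (𝓡 4) p
  have hT : IsOpen (e.target ∩ e.symm ⁻¹' S) :=
    (continuousOn_extChartAt_symm p).isOpen_inter_preimage (isOpen_chart_target p) hθ.isOpen
  have hmem : e p ∈ e.target ∩ e.symm ⁻¹' S :=
    ⟨mem_extChartAt_target p, by rw [mem_preimage, extChartAt_to_inv]; exact hp⟩
  obtain ⟨r, hr, hb⟩ := Metric.isOpen_iff.1 hT _ hmem
  obtain ⟨g, hg⟩ := Convex.exists_forall_hasFDerivAt_of_fderiv_symmetric
    (convex_ball (e p) r) Metric.isOpen_ball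
    (((hθ.smooth p).differentiableOn (by simp)).mono hb) fun a ha x y => hθ.closed p a (hb ha) x y
  refine ⟨g ∘ e, ?_⟩
  have hce : Tendsto e (𝓝 p) (𝓝 (e p)) := continuousAt_extChartAt p
  filter_upwards [hce.eventually (Metric.ball_mem_nhds _ hr), extChartAt_source_mem_nhds (I := 𝓡 4) p]
    with q hq hqs
  have hqs' : q ∈ (chartAt E4 p).source := by rwa [extChartAt_source] at hqs
  have h1 := (hasMFDerivAt_iff_hasFDerivAt.2 (hg _ hq)).comp q
    (mdifferentiableAt_extChartAt (I := 𝓡 4) hqs').hasMFDerivAt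
  refine h1.congr_mfderiv (ContinuousLinearMap.ext fun u => ?_)
  have h2 := mfderiv_chart_symm_comp (x₀ := p) (e.map_source hqs)
  have h3 : ∀ q', q' = q → ∀ u : E4, θ q' (mfderiv 𝓘(ℝ, E4) (𝓡 4) e.symm (e q)
      (mfderiv (𝓡 4) 𝓘(ℝ, E4) e q' u)) = θ q' u → θ q' (mfderiv 𝓘(ℝ, E4) (𝓡 4) e.symm (e q)
      (mfderiv (𝓡 4) 𝓘(ℝ, E4) e q u)) = θ q u := by
    rintro q' rfl u h
    exact h
  exact h3 _ (e.left_inv hqs) u (congrArg (θ (e.symm (e q))) (h2 u))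

/-- The pairing of `θ` with a Hamiltonian field is continuous. -/
lemma IsRotationForm.continuousOn_pairing
    {w : (p : M) → TangentSpace (𝓡 4) p →L[ℝ] TangentSpace (𝓡 4) p →L[ℝ] ℝ}
    (hθ : IsRotationForm XJ θ S) (hw : IsSymplecticForm w) {H : M → ℝ}
    (hH : ContMDiff (𝓡 4) 𝓘(ℝ, ℝ) ∞ H) {XH : (p : M) → TangentSpace (𝓡 4) p}
    (hXH : IsHamiltonianField w H XH) : ContinuousOn (fun p => (θ p (XH p) : ℝ)) S := by
  intro p hp
  set e := extChartAt (𝓡 4) p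
  have hT : IsOpen (e.target ∩ e.symm ⁻¹' S) :=
    (continuousOn_extChartAt_symm p).isOpen_inter_preimage (isOpen_chart_target p) hθ.isOpen
  have hmem : e p ∈ e.target ∩ e.symm ⁻¹' S :=
    ⟨mem_extChartAt_target p, by rw [mem_preimage, extChartAt_to_inv]; exact hp⟩
  have h1 : ContinuousAt (chartOneForm θ p) (e p) :=
    (hθ.smooth p).continuousOn.continuousAt (hT.mem_nhds hmem)
  have h2 : ContinuousAt (chartField XH p) (e p) :=
    (contDiffOn_chartField hw hH hXH p).continuousOn.continuousAt
      ((isOpen_chart_target p).mem_nhds hmem.1)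
  have h3 : ContinuousAt (fun q => chartOneForm θ p (e q) (chartField XH p (e q))) p :=
    (h1.clm_apply h2).comp (f := e) (continuousAt_extChartAt p)
  refine (h3.congr ?_).continuousWithinAt
  filter_upwards [extChartAt_source_mem_nhds (I := 𝓡 4) p] with q hqs
  have h4 := mfderiv_symm_chartField XH (x₀ := p) (e.map_source hqs)
  have h5 : ∀ q', q' = q → θ q' (mfderiv 𝓘(ℝ, E4) (𝓡 4) e.symm (e q)
      (chartField XH p (e q))) = θ q' (XH q') → θ q' (mfderiv 𝓘(ℝ, E4) (𝓡 4) e.symm (e q)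
      (chartField XH p (e q))) = θ q (XH q) := by
    rintro q' rfl h
    exact h
  exact h5 _ (e.left_inv hqs) (congrArg (θ (e.symm (e q))) h4)

section Along

variable {X Y : Type*} [TopologicalSpace X] [TopologicalSpace Y] {q : X → M} {G G' : X → ℝ} {x : X}

lemma IsLocalPrimitive.along (q : X → M) (h : IsLocalPrimitive θ f (q x)) :
    IsPrimitiveAlong θ q (fun x => f (q x)) x :=
  ⟨f, h, Eventually.of_forall fun _ => rfl⟩

lemma IsPrimitiveAlong.add_const (h : IsPrimitiveAlong θ q G x) (c : ℝ) :
    IsPrimitiveAlong θ q (fun x => G x + c) x := by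
  obtain ⟨f, hf, he⟩ := h
  exact ⟨_, hf.add_const c, he.mono fun x' h => congrArg (· + c) h⟩

lemma IsPrimitiveAlong.congr (h : IsPrimitiveAlong θ q G x) (he : G' =ᶠ[𝓝 x] G) :
    IsPrimitiveAlong θ q G' x := by
  obtain ⟨f, hf, hG⟩ := h
  exact ⟨f, hf, by filter_upwards [he, hG] with x' h1 h2 using h1.trans h2⟩

lemma IsPrimitiveAlong.comp {g : Y → X} {y : Y} (h : IsPrimitiveAlong θ q G (g y))
    (hg : ContinuousAt g y) : IsPrimitiveAlong θ (fun y => q (g y)) (fun y => G (g y)) y := by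
  obtain ⟨f, hf, he⟩ := h
  exact ⟨f, hf, hg.eventually he⟩

lemma IsPrimitiveAlong.eventually_eq (h : IsPrimitiveAlong θ q G x) (h' : IsPrimitiveAlong θ q G' x)
    (hq : ContinuousAt q x) : ∀ᶠ x' in 𝓝 x, G' x' = G x' + (G' x - G x) := by
  obtain ⟨f, hf, he⟩ := h
  obtain ⟨f', hf', he'⟩ := h'
  rw [he.self_of_nhds, he'.self_of_nhds]
  filter_upwards [he, he', hq.eventually (hf.eventually_sub_eq hf')] with x' h1 h2 h3
  rw [h1, h2, h3]

lemma IsPrimitiveAlong.sub_eq_sub [PreconnectedSpace X] (h : ∀ x, IsPrimitiveAlong θ q G x)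
    (h' : ∀ x, IsPrimitiveAlong θ q G' x) (hq : Continuous q) (x y : X) :
    G' x - G x = G' y - G y := by
  have : IsLocallyConstant fun x => G' x - G x := by
    rw [IsLocallyConstant.iff_eventually_eq]
    intro x
    filter_upwards [(h x).eventually_eq (h' x) hq.continuousAt] with x' hx'
    rw [hx']; ring
  exact this.apply_eq_of_preconnectedSpace x y

/-- Primitives along a family of paths parametrised near `y₀`. -/
lemma IsRotationForm.exists_primitive_strip (hθ : IsRotationForm XJ θ S) {Q : Y × ℝ → M}
    (hQ : Continuous Q) (y₀ : Y) (hS : ∀ t, Q (y₀, t) ∈ S) :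
    ∃ G : Y × ℝ → ℝ, ∀ t ∈ Icc (0 : ℝ) 1, IsPrimitiveAlong θ Q G (y₀, t) := by
  have hc : Continuous fun t => Q (y₀, t) := by fun_prop
  -- Continuation in `t` by steps of `δ / 2`, with `δ` a Lebesgue number: on each step a single
  -- local primitive is available along the path over `y₀`.
  obtain ⟨δ, hδ, hL⟩ := lebesgue_number_lemma_of_metric (isCompact_Icc (a := (0 : ℝ)) (b := 1))
    (c := fun f : M → ℝ => {t | IsLocalPrimitive θ f (Q (y₀, t))})
    (fun f => isOpen_iff_mem_nhds.2 fun t ht => hc.continuousAt.eventually ht.eventually)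
    (fun t _ => by
      obtain ⟨f, hf⟩ := hθ.exists_primitive (hS t)
      exact mem_iUnion.2 ⟨f, hf⟩)
  have key : ∀ n : ℕ, ∃ G : Y × ℝ → ℝ, ∀ t ∈ Icc (0 : ℝ) 1, t ≤ n * (δ / 2) →
      IsPrimitiveAlong θ Q G (y₀, t) := by
    intro n
    induction n with
    | zero =>
      obtain ⟨f, hf⟩ := hθ.exists_primitive (hS 0)
      refine ⟨fun x => f (Q x), fun t ht h => ?_⟩
      have : t = 0 := le_antisymm (by simpa using h) ht.1
      rw [this]
      exact hf.along Q
    | succ n ih =>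
      obtain ⟨G, hG⟩ := ih
      set s : ℝ := n * (δ / 2) with hs
      have hs0 : 0 ≤ s := by positivity
      rcases le_or_gt 1 s with h1 | h1
      · exact ⟨G, fun t ht _ => hG t ht (ht.2.trans h1)⟩
      obtain ⟨f, hf⟩ := hL s ⟨hs0, h1.le⟩
      have hGs := hG s ⟨hs0, h1.le⟩ le_rfl
      have hfs : IsPrimitiveAlong θ Q (fun x => f (Q x)) (y₀, s) :=
        IsLocalPrimitive.along Q (hf (Metric.mem_ball_self hδ))
      have hev := hfs.eventually_eq hGs hQ.continuousAt
      set c := G (y₀, s) - f (Q (y₀, s)) with hcdef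
      have hevy : ∀ᶠ y in 𝓝 y₀, G (y, s) = f (Q (y, s)) + c := by
        have hcy : Continuous fun y : Y => (y, s) := by fun_prop
        exact (hcy.tendsto y₀).eventually hev
      classical
      -- After time `s` the new primitive is shifted, separately for each `y`, to agree with the old
      -- one at time `s`. For `y` near `y₀` the shift is the constant `c`, so `G'` is again locally
      -- a pulled-back primitive.
      set G' : Y × ℝ → ℝ := fun x =>
        if x.2 ≤ s then G x else f (Q x) + (G (x.1, s) - f (Q (x.1, s))) with hG'
      have hevy' : ∀ t, ∀ᶠ x : Y × ℝ in 𝓝 (y₀, t), G (x.1, s) = f (Q (x.1, s)) + c :=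
        fun t => (continuous_fst.tendsto (y₀, t)).eventually hevy
      refine ⟨G', fun t ht hts => ?_⟩
      have hball : s ≤ t → t ∈ Metric.ball s δ := fun h => by
        rw [Metric.mem_ball, Real.dist_eq, abs_of_nonneg (by linarith)]
        push_cast at hts
        nlinarith
      rcases lt_trichotomy t s with h | h | h
      · refine (hG t ht h.le).congr ?_
        filter_upwards [(continuous_snd.tendsto (y₀, t)).eventually (Iio_mem_nhds h)] with x hx
        exact if_pos (le_of_lt hx)
      · rw [h]
        refine (hfs.add_const c).congr ?_
        filter_upwards [hev, hevy' s] with x h2 h3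
        simp only [hG']
        split_ifs
        · exact h2
        · rw [h3]; ring
      · refine ((IsLocalPrimitive.along Q (hf (hball h.le))).add_const c).congr ?_
        filter_upwards [(continuous_snd.tendsto (y₀, t)).eventually (Ioi_mem_nhds h), hevy' t]
          with x h2 h3
        simp only [hG']
        rw [if_neg (not_le.2 h2), h3]; ring
  obtain ⟨n, hn⟩ := exists_nat_gt (1 / (δ / 2))
  obtain ⟨G, hG⟩ := key n
  refine ⟨G, fun t ht => hG t ht (ht.2.trans ?_)⟩
  rw [div_lt_iff₀ (by positivity)] at hn
  exact hn.le

/-- A closed form has a primitive along a map from a contractible space. -/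
theorem IsRotationForm.exists_primitive_along [ContractibleSpace X] (hθ : IsRotationForm XJ θ S)
    (hq : Continuous q) (hS : ∀ x, q x ∈ S) : ∃ G : X → ℝ, ∀ x, IsPrimitiveAlong θ q G x := by
  obtain ⟨x₀, ⟨h⟩⟩ := id_nullhomotopic X
  -- The contraction is run backwards, from the common point `q x₀` at time 0 to `q x` at time 1;
  -- continuation along these paths defines the primitive.
  set Q : X × ℝ → M := fun x => q (h.symm (projIcc 0 1 zero_le_one x.2, x.1)) with hQ
  have hQc : Continuous Q := by
    have : Continuous fun x : X × ℝ => (projIcc (0 : ℝ) 1 zero_le_one x.2, x.1) := by fun_prop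
    exact hq.comp (h.symm.continuous.comp this)
  have hQ0 : ∀ x, Q (x, 0) = q x₀ := fun x => by
    simp only [hQ, projIcc_left]
    exact congrArg q (h.symm.apply_zero x)
  have hQ1 : ∀ x, Q (x, 1) = q x := fun x => by
    simp only [hQ, projIcc_right]
    exact congrArg q (h.symm.apply_one x)
  choose G hG using fun x : X => hθ.exists_primitive_strip hQc x fun t => hS _
  refine ⟨fun x => G x (x, 1) - G x (x, 0), fun x => ?_⟩
  -- near `x`, all the primitives used agree up to the initial value
  have hev : ∀ᶠ x' in 𝓝 x, ∀ t ∈ Icc (0 : ℝ) 1, IsPrimitiveAlong θ Q (G x) (x', t) := by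
    refine isCompact_Icc.eventually_forall_of_forall_eventually fun t ht => ?_
    obtain ⟨f, hf, he⟩ := hG x t ht
    filter_upwards [hQc.continuousAt.eventually hf.eventually, eventually_eventually_nhds.2 he]
      with y h1 h2
    exact ⟨f, h1, h2⟩
  have hconst : ∀ᶠ x' in 𝓝 x, G x (x', 0) = G x (x, 0) := by
    obtain ⟨f, hf, he⟩ := hG x 0 ⟨le_rfl, zero_le_one⟩
    have hcy : Continuous fun y : X => (y, (0 : ℝ)) := by fun_prop
    filter_upwards [(hcy.tendsto x).eventually he] with x' h'
    rw [h', he.self_of_nhds, hQ0, hQ0]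
  obtain ⟨f, hf, he⟩ := hG x 1 ⟨zero_le_one, le_rfl⟩
  rw [hQ1] at hf
  refine ⟨_, hf.add_const (- G x (x, 0)), ?_⟩
  have hcy : Continuous fun y : X => (y, (1 : ℝ)) := by fun_prop
  filter_upwards [hev, hconst, (hcy.tendsto x).eventually he] with x' h1 h2 h3
  rw [hQ1] at h3
  have hpath : Continuous fun t : Icc (0 : ℝ) 1 => (x', (t : ℝ)) := by fun_prop
  have h4 := IsPrimitiveAlong.sub_eq_sub (θ := θ) (q := fun t : Icc (0 : ℝ) 1 => Q (x', t))
    (fun t => (h1 t t.2).comp (g := fun t : Icc (0 : ℝ) 1 => (x', (t : ℝ))) hpath.continuousAt) (fun t => (hG x' t t.2).comp (g := fun t : Icc (0 : ℝ) 1 => (x', (t : ℝ))) hpath.continuousAt)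
    (hQc.comp hpath) ⟨1, zero_le_one, le_rfl⟩ ⟨0, le_rfl, zero_le_one⟩
  simp only at h4
  rw [h3, h2] at h4
  linarith

end Along

end Manifold

end Primitives

end

/-! ### Relative orbit segments and the integral `Φ_rel` -/

noncomputable section

section RelativeSegments

variable {M : Type*} [TopologicalSpace M] [ChartedSpace E4 M]
  {θ : (p : M) → TangentSpace (𝓡 4) p →L[ℝ] ℝ} {S : Set M}

lemma IsPrimitiveAlong.continuousAt {X : Type*} [TopologicalSpace X] {q : X → M} {G : X → ℝ} {x : X}
    (h : IsPrimitiveAlong θ q G x) (hq : ContinuousAt q x) : ContinuousAt G x := by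
  obtain ⟨f, hf, he⟩ := h
  exact (hf.hasMFDerivAt.continuousAt.comp hq).congr (he.mono fun x' h => h.symm)

/-- The integral of a closed form along an integral curve is the increment of a primitive. -/
lemma integral_pairing_eq {X : (p : M) → TangentSpace (𝓡 4) p}
    (hcont : ContinuousOn (fun p => (θ p (X p) : ℝ)) S) {γ : ℝ → M}
    (hγ : IsMIntegralCurve (I := 𝓡 4) γ X) {a b : ℝ} (hab : a ≤ b) (hS : ∀ t ∈ Icc a b, γ t ∈ S)
    {G : Icc a b → ℝ} (hG : ∀ t, IsPrimitiveAlong θ (fun t : Icc a b => γ t) G t) :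
    IntervalIntegrable (fun t => (θ (γ t) (X (γ t)) : ℝ)) volume a b ∧
      ∫ t in a..b, (θ (γ t) (X (γ t)) : ℝ) = G ⟨b, hab, le_rfl⟩ - G ⟨a, le_rfl, hab⟩ := by
  have hc := hγ.continuous
  have hint : IntervalIntegrable (fun t => (θ (γ t) (X (γ t)) : ℝ)) volume a b := by
    apply ContinuousOn.intervalIntegrable
    rw [uIcc_of_le hab]
    exact hcont.comp hc.continuousOn hS
  refine ⟨hint, ?_⟩
  have hGc : Continuous G := continuous_iff_continuousAt.2 fun t =>
    (hG t).continuousAt (hc.comp continuous_subtype_val).continuousAt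
  have hp : Continuous (projIcc a b hab) := continuous_projIcc
  have := intervalIntegral.integral_eq_sub_of_hasDerivAt_of_le hab
    (f := fun t => G (projIcc a b hab t)) (hGc.comp hp).continuousOn (fun t ht => ?_) hint
  · rw [this, projIcc_right, projIcc_left]
  · have hpt : projIcc a b hab t = ⟨t, ht.1.le, ht.2.le⟩ := projIcc_of_mem hab ⟨ht.1.le, ht.2.le⟩
    obtain ⟨f, hf, he⟩ := hG ⟨t, ht.1.le, ht.2.le⟩
    refine (hf.hasDerivAt_comp hγ).congr_of_eventuallyEq ?_
    have htend := hp.tendsto t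
    rw [hpt] at htend
    filter_upwards [htend.eventually he, Ioo_mem_nhds ht.1 ht.2] with s hs hs'
    rw [hs, projIcc_of_mem hab ⟨hs'.1.le, hs'.2.le⟩]

variable [IsManifold (𝓡 4) ∞ M] [MulAction Circle M] {XJ XH : (p : M) → TangentSpace (𝓡 4) p}

/-- A primitive of a rotation form grows linearly along circle orbits. -/
lemma IsRotationForm.primitive_circle (hθ : IsRotationForm XJ θ S) {p : M} (hp : p ∈ S)
    (hXJ : IsMIntegralCurve (I := 𝓡 4) (fun t : ℝ => Circle.exp t • p) XJ) {G : ℝ → ℝ}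
    (hG : ∀ u, IsPrimitiveAlong θ (fun u => Circle.exp u • p) G u) (u : ℝ) : G u = G 0 + u := by
  have hd : ∀ u, HasDerivAt G 1 u := by
    intro u
    obtain ⟨f, hf, he⟩ := hG u
    have h1 := hf.hasDerivAt_comp (γ := fun u => Circle.exp u • p) hXJ
    have h2 : θ (Circle.exp u • p) (XJ (Circle.exp u • p)) = 1 :=
      hθ.rotation _ (hθ.invariant _ _ hp)
    rw [h2] at h1
    exact h1.congr_of_eventuallyEq he
  have := is_const_of_deriv_eq_zero (f := fun u => G u - u)
    (fun u => ((hd u).sub (hasDerivAt_id u)).differentiableAt)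
    (fun u => by
      have := ((hd u).sub (hasDerivAt_id u)).deriv
      rw [sub_self] at this
      exact this) u 0
  simp only [sub_zero] at this
  linarith

variable [ContinuousSMul Circle M] {φ : Flow ℝ M} {F : M → ℝ × ℝ} {R : Set M}

/-- The integral of a rotation form is the same on all the translates of an orbit segment. -/
lemma IsRotationForm.exists_integral (hθ : IsRotationForm XJ θ S)
    (hXJ : ∀ p : M, IsMIntegralCurve (I := 𝓡 4) (fun t : ℝ => Circle.exp t • p) XJ)
    (hcont : ContinuousOn (fun p => (θ p (XH p) : ℝ)) S) {p : M} {τ : ℝ} (hτ : 0 ≤ τ)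
    (hS : ∀ t ∈ Icc 0 τ, φ t p ∈ S) :
    ∃ c : ℝ, ∀ (γ : ℝ → M) (a : ℝ) (z : Circle), IsMIntegralCurve (I := 𝓡 4) γ XH →
      (∀ t, γ t = z • φ (t - a) p) →
      IntervalIntegrable (fun t => (θ (γ t) (XH (γ t)) : ℝ)) volume a (a + τ) ∧
        ∫ t in a..(a + τ), (θ (γ t) (XH (γ t)) : ℝ) = c := by
  have : ContractibleSpace (Icc 0 τ) := (convex_Icc 0 τ).contractibleSpace ⟨0, le_rfl, hτ⟩
  have hφ : Continuous fun t => φ t p := φ.continuous continuous_id continuous_const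
  have hq : Continuous fun x : ℝ × Icc 0 τ => Circle.exp x.1 • φ (x.2 : ℝ) p :=
    (Circle.exp.continuous.comp continuous_fst).smul (hφ.comp (continuous_subtype_val.comp continuous_snd))
  obtain ⟨G, hG⟩ := hθ.exists_primitive_along hq fun x => hθ.invariant _ _ (hS _ x.2.2)
  -- A rotation by `u` adds the same `u` at both ends of the segment, so the increment in `t` does
  -- not depend on it.
  have hlin : ∀ u (t : Icc 0 τ), G (u, t) = G (0, t) + u := fun u t =>
    hθ.primitive_circle (hS _ t.2) (hXJ _) (G := fun u => G (u, t))
      (fun u => (hG (u, t)).comp (g := fun u : ℝ => (u, t)) (by fun_prop)) u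
  refine ⟨G (0, ⟨τ, hτ, le_rfl⟩) - G (0, ⟨0, le_rfl, hτ⟩), fun γ a z hγ hγz => ?_⟩
  obtain ⟨u, rfl⟩ := Circle.exp_surjective z
  have hm : ∀ t : Icc a (a + τ), (t : ℝ) - a ∈ Icc 0 τ := fun t =>
    ⟨by linarith [t.2.1], by linarith [t.2.2]⟩
  have hgc : Continuous fun t : Icc a (a + τ) => (u, (⟨(t : ℝ) - a, hm t⟩ : Icc 0 τ)) := by fun_prop
  have hprim : ∀ t : Icc a (a + τ), IsPrimitiveAlong θ (fun t : Icc a (a + τ) => γ t)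
      (fun t => G (u, ⟨(t : ℝ) - a, hm t⟩)) t := fun t => by
    have := (hG (u, ⟨(t : ℝ) - a, hm t⟩)).comp
      (g := fun t : Icc a (a + τ) => (u, (⟨(t : ℝ) - a, hm t⟩ : Icc 0 τ))) hgc.continuousAt
    simpa only [← hγz] using this
  obtain ⟨h1, h2⟩ := integral_pairing_eq hcont hγ (by linarith)
    (fun t ht => by rw [hγz]; exact hθ.invariant _ _ (hS _ (hm ⟨t, ht⟩))) hprim
  refine ⟨h1, h2.trans ?_⟩
  rw [hlin, hlin u]
  have e1 : (⟨a + τ - a, hm ⟨a + τ, by linarith, le_rfl⟩⟩ : Icc 0 τ) = ⟨τ, hτ, le_rfl⟩ :=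
    Subtype.ext (add_sub_cancel_left a τ)
  have e2 : (⟨a - a, hm ⟨a, le_rfl, by linarith⟩⟩ : Icc 0 τ) = ⟨0, le_rfl, hτ⟩ :=
    Subtype.ext (sub_self a)
  rw [e1, e2]; ring

variable {vbar : ℝ × ℝ} {B : Set M} {D : Set (ℝ × ℝ)} {σ₁ σ₂ : ℝ × ℝ → M} {τB τC : ℝ × ℝ → ℝ}
  {ζB ζC : ℝ × ℝ → Circle}

namespace IsTransitSystem

lemma not_mem_ball (hB : IsOpen B) {p : M} (hp : p ∈ frontier B) : p ∉ B := by
  rw [hB.frontier_eq] at hp; exact hp.2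

/-- Through each point of the ball there is a relative segment. -/
lemma exists_relSegment (hT : IsTransitSystem φ F vbar B D σ₁ σ₂ τB τC ζB ζC)
    (ht : IsToralFlow φ F R) (hB : IsOpen B) (hinv : ∀ (z : Circle), ∀ p ∈ B, z • p ∈ B)
    (hφ : ∀ p, IsMIntegralCurve (I := 𝓡 4) (fun t => φ t p) XH) {v : ℝ × ℝ} (hv : v ∈ D \ {vbar})
    {p : M} (hp : p ∈ B) (hF : F p = v) :
    ∃ (γ : ℝ → M) (a b : ℝ), IsRelSegment XH B γ a b ∧ a < 0 ∧ 0 < b ∧ γ 0 = p := by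
  have hinv' : ∀ (z : Circle) q, z • q ∈ B → q ∈ B := fun z q hq => by
    have := hinv z⁻¹ _ hq
    rwa [inv_smul_smul] at this
  have h1 : σ₁ v ∉ B := not_mem_ball hB (hT.mem_sec₁ v hv.1)
  have h2 : σ₂ v ∉ B := not_mem_ball hB (hT.mem_sec₂ v hv.1)
  have h3 : φ (τB v) (σ₁ v) ∉ B := fun h => by
    rw [hT.exit v hv] at h; exact h2 (hinv' _ _ h)
  obtain ⟨t, ht', z, rfl⟩ := hT.cover_inside v hv p (subset_closure hp) hF
  have ht0 : 0 < t := lt_of_le_of_ne ht'.1 fun h => by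
    subst h
    rw [φ.map_zero_apply] at hp
    exact h1 (hinv' _ _ hp)
  have ht1 : t < τB v := lt_of_le_of_ne ht'.2 fun h => by
    subst h
    exact h3 (hinv' _ _ hp)
  have hsh : ∀ s, φ s (z • φ t (σ₁ v)) = z • φ (s + t) (σ₁ v) := fun s => by
    rw [ht.map_smul, φ.map_add]
  refine ⟨fun s => φ s (z • φ t (σ₁ v)), -t, τB v - t, ⟨hφ _, by linarith, fun s hs => ?_, ?_, ?_⟩,
    by linarith, by linarith, φ.map_zero_apply _⟩
  · simp only [hsh]
    exact hinv _ _ (hT.inside v hv _ ⟨by linarith [hs.1], by linarith [hs.2]⟩)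
  · simp only [hsh, neg_add_cancel, φ.map_zero_apply]
    exact fun h => h1 (hinv' _ _ h)
  · simp only [hsh, sub_add_cancel]
    exact fun h => h3 (hinv' _ _ h)

/-- All the relative segments over `v` are translates of the one starting from the section. -/
lemma relSegment_eq (hT : IsTransitSystem φ F vbar B D σ₁ σ₂ τB τC ζB ζC)
    (ht : IsToralFlow φ F R) (hB : IsOpen B) (hinv : ∀ (z : Circle), ∀ p ∈ B, z • p ∈ B)
    (huniq : ∀ γ : ℝ → M, IsMIntegralCurve (I := 𝓡 4) γ XH → ∀ t, γ t = φ t (γ 0))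
    {v : ℝ × ℝ} (hv : v ∈ D \ {vbar}) {γ : ℝ → M} {a b : ℝ} (hγ : IsRelSegment XH B γ a b)
    (hF : F (γ a) = v) : b = a + τB v ∧ ∃ z : Circle, ∀ t, γ t = z • φ (t - a) (σ₁ v) := by
  obtain ⟨hc, hab, hin, ha, hb⟩ := hγ
  have hinv' : ∀ (z : Circle) q, z • q ∈ B → q ∈ B := fun z q hq => by
    have := hinv z⁻¹ _ hq
    rwa [inv_smul_smul] at this
  have h2 : σ₂ v ∉ B := not_mem_ball hB (hT.mem_sec₂ v hv.1)
  have hsh : ∀ t, γ t = φ (t - a) (γ a) := fun t => by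
    rw [huniq γ hc t, huniq γ hc a, ← φ.map_add, sub_add_cancel]
  have hcl : γ a ∈ closure B := by
    refine mem_closure_of_tendsto (b := 𝓝[>] a)
      (hc.continuous.continuousWithinAt.tendsto) ?_
    filter_upwards [Ioo_mem_nhdsGT hab] with t ht using hin t ht
  obtain ⟨t, ht', z, hz⟩ := hT.cover_inside v hv _ hcl hF
  have ht0 : t = 0 := by
    by_contra h0
    have hpos : 0 < t := lt_of_le_of_ne ht'.1 (Ne.symm h0)
    -- Starting at the exit point, the curve would next be outside the closure of `B`; starting
    -- strictly between entrance and exit, it would begin inside `B`. Both are excluded.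
    rcases eq_or_lt_of_le ht'.2 with h | h
    · rw [h, hT.exit v hv] at hz
      have hτC := hT.pos_τC v hv.1
      set s := min (b - a) (τC v) / 2 with hs
      have hm : 0 < min (b - a) (τC v) := lt_min (by linarith) hτC
      have hs0 : 0 < s := by positivity
      have hs1 : s < b - a := by have := min_le_left (b - a) (τC v); linarith
      have hs2 : s < τC v := by have := min_le_right (b - a) (τC v); linarith
      have h5 := hin (a + s) ⟨by linarith, by linarith⟩
      rw [hsh, hz, add_sub_cancel_left, ht.map_smul, ht.map_smul] at h5
      exact hT.outside v hv.1 s ⟨hs0, hs2⟩ (subset_closure (hinv' _ _ (hinv' _ _ h5)))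
    · refine ha ?_
      rw [hz]
      exact hinv _ _ (hT.inside v hv t ⟨hpos, h⟩)
  rw [ht0, φ.map_zero_apply] at hz
  have hγz : ∀ t, γ t = z • φ (t - a) (σ₁ v) := fun t => by rw [hsh, hz, ht.map_smul]
  refine ⟨?_, z, hγz⟩
  rcases lt_trichotomy (b - a) (τB v) with h | h | h
  · refine absurd ?_ hb
    rw [hγz]
    exact hinv _ _ (hT.inside v hv _ ⟨by linarith, h⟩)
  · linarith
  · have h5 := hin (a + τB v) ⟨by linarith [hT.pos_τB v hv], by linarith⟩
    rw [hγz, add_sub_cancel_left, hT.exit v hv] at h5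
    exact absurd (hinv' _ _ (hinv' _ _ h5)) h2

/-- The closed segment must lie in the domain of the form: its interior has no poles by the choice
of `v`, and its ends have none because they are on the boundary of `B`. -/
lemma segment_mem (hT : IsTransitSystem φ F vbar B D σ₁ σ₂ τB τC ζB ζC) (hB : IsOpen B)
    (hinv : ∀ (z : Circle), ∀ p ∈ B, z • p ∈ B) (ht : IsToralFlow φ F R) {U P : Set M}
    (hU : F ⁻¹' D ∩ closure B ⊆ U) (hP : F ⁻¹' D ∩ frontier B ∩ P = ∅)
    {v : ℝ × ℝ} (hv : v ∈ D \ {vbar}) (hvP : ∀ p ∈ B, F p = v → p ∉ P) {t : ℝ}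
    (h : t ∈ Icc 0 (τB v)) : φ t (σ₁ v) ∈ U \ P := by
  have hF : F (φ t (σ₁ v)) = v := by rw [ht.map_flow, hT.F_sec₁ v hv.1]
  have hFD : φ t (σ₁ v) ∈ F ⁻¹' D := by rw [mem_preimage, hF]; exact hv.1
  have hfrU : φ t (σ₁ v) ∈ frontier B → φ t (σ₁ v) ∈ U \ P := fun h =>
    ⟨hU ⟨hFD, frontier_subset_closure h⟩, fun hp => by
      have : φ t (σ₁ v) ∈ F ⁻¹' D ∩ frontier B ∩ P := ⟨⟨hFD, h⟩, hp⟩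
      rw [hP] at this; exact this⟩
  have hfz : ∀ z : Circle, z • σ₂ v ∈ frontier B := fun z => by
    have h2 := hT.mem_sec₂ v hv.1
    rw [hB.frontier_eq] at h2 ⊢
    refine ⟨map_mem_closure (continuous_const_smul z) h2.1 fun q hq => hinv z q hq, fun h => h2.2 ?_⟩
    have := hinv z⁻¹ _ h
    rwa [inv_smul_smul] at this
  rcases eq_or_lt_of_le h.1 with h0 | h0
  · refine hfrU ?_
    rw [← h0, φ.map_zero_apply]; exact hT.mem_sec₁ v hv.1
  rcases eq_or_lt_of_le h.2 with h1 | h1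
  · refine hfrU ?_
    rw [h1, hT.exit v hv]
    exact hfz _
  · have := hT.inside v hv t ⟨h0, h1⟩
    exact ⟨hU ⟨hFD, subset_closure this⟩, hvP _ this hF⟩

/-- `phiRel` is the integral over any relative segment. -/
theorem integral_eq_phiRel (hT : IsTransitSystem φ F vbar B D σ₁ σ₂ τB τC ζB ζC)
    (ht : IsToralFlow φ F R) (hB : IsOpen B) (hinv : ∀ (z : Circle), ∀ p ∈ B, z • p ∈ B)
    (huniq : ∀ γ : ℝ → M, IsMIntegralCurve (I := 𝓡 4) γ XH → ∀ t, γ t = φ t (γ 0))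
    (hXJ : ∀ p : M, IsMIntegralCurve (I := 𝓡 4) (fun t : ℝ => Circle.exp t • p) XJ)
    {U P : Set M} (hθ : IsRotationForm XJ θ (U \ P))
    (hcont : ContinuousOn (fun p => (θ p (XH p) : ℝ)) (U \ P))
    (hU : F ⁻¹' D ∩ closure B ⊆ U) (hP : F ⁻¹' D ∩ frontier B ∩ P = ∅)
    {v : ℝ × ℝ} (hv : v ∈ D \ {vbar}) (hvP : ∀ p ∈ B, F p = v → p ∉ P)
    {γ : ℝ → M} {a b : ℝ} (hγ : IsRelSegment XH B γ a b) (hF : F (γ a) = v) :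
    IntervalIntegrable (fun t => (θ (γ t) (XH (γ t)) : ℝ)) volume a b ∧
      ∫ t in a..b, (θ (γ t) (XH (γ t)) : ℝ) = phiRel F XH θ B v := by
  obtain ⟨c, hc⟩ := hθ.exists_integral hXJ hcont (hT.pos_τB v hv).le
    fun t h => hT.segment_mem hB hinv ht hU hP hv hvP h
  have key : ∀ (γ : ℝ → M) (a b : ℝ), IsRelSegment XH B γ a b → F (γ a) = v →
      IntervalIntegrable (fun t => (θ (γ t) (XH (γ t)) : ℝ)) volume a b ∧
      ∫ t in a..b, (θ (γ t) (XH (γ t)) : ℝ) = c := by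
    intro γ a b hγ hF
    obtain ⟨rfl, z, hz⟩ := hT.relSegment_eq ht hB hinv huniq hv hγ hF
    exact hc γ a z hγ.1 hz
  refine ⟨(key γ a b hγ hF).1, (key γ a b hγ hF).2.trans ?_⟩
  have hex : ∃ φ : ℝ, ∃ (γ : ℝ → M) (a b : ℝ), IsRelSegment XH B γ a b ∧ F (γ a) = v ∧
      φ = ∫ t in a..b, (θ (γ t) (XH (γ t)) : ℝ) := ⟨_, γ, a, b, hγ, hF, rfl⟩
  have hdef : phiRel F XH θ B v = hex.choose := dif_pos hex
  obtain ⟨γ', a', b', h1, h2, h3⟩ := hex.choose_spec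
  rw [hdef, h3, (key γ' a' b' h1 h2).2]

/-- `phiRel` is the increment of a primitive along the segment starting from the section. -/
theorem phiRel_eq_sub (hT : IsTransitSystem φ F vbar B D σ₁ σ₂ τB τC ζB ζC)
    (ht : IsToralFlow φ F R) (hB : IsOpen B) (hinv : ∀ (z : Circle), ∀ p ∈ B, z • p ∈ B)
    (hφ : ∀ p, IsMIntegralCurve (I := 𝓡 4) (fun t => φ t p) XH)
    (huniq : ∀ γ : ℝ → M, IsMIntegralCurve (I := 𝓡 4) γ XH → ∀ t, γ t = φ t (γ 0))
    (hXJ : ∀ p : M, IsMIntegralCurve (I := 𝓡 4) (fun t : ℝ => Circle.exp t • p) XJ)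
    {U P : Set M} (hθ : IsRotationForm XJ θ (U \ P))
    (hcont : ContinuousOn (fun p => (θ p (XH p) : ℝ)) (U \ P))
    (hU : F ⁻¹' D ∩ closure B ⊆ U) (hP : F ⁻¹' D ∩ frontier B ∩ P = ∅)
    {v : ℝ × ℝ} (hv : v ∈ D \ {vbar}) (hvP : ∀ p ∈ B, F p = v → p ∉ P)
    {G : Icc (0 : ℝ) 1 → ℝ}
    (hG : ∀ t, IsPrimitiveAlong θ (fun t : Icc (0 : ℝ) 1 => φ (τB v * t) (σ₁ v)) G t) :
    phiRel F XH θ B v = G 1 - G 0 := by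
  have hτ := hT.pos_τB v hv
  -- Time is rescaled to `[0, 1]` so that the segments over varying `v`, whose lengths differ, can
  -- form one strip.
  have hm : ∀ t : Icc 0 (τB v), (t : ℝ) / τB v ∈ Icc (0 : ℝ) 1 := fun t =>
    ⟨div_nonneg t.2.1 hτ.le, div_le_one_of_le₀ t.2.2 hτ.le⟩
  have hgc : Continuous fun t : Icc 0 (τB v) => (⟨(t : ℝ) / τB v, hm t⟩ : Icc (0 : ℝ) 1) := by
    fun_prop
  have hprim : ∀ t : Icc 0 (τB v), IsPrimitiveAlong θ (fun t : Icc 0 (τB v) => φ t (σ₁ v))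
      (fun t => G ⟨(t : ℝ) / τB v, hm t⟩) t := fun t => by
    have := (hG ⟨(t : ℝ) / τB v, hm t⟩).comp
      (g := fun t : Icc 0 (τB v) => (⟨(t : ℝ) / τB v, hm t⟩ : Icc (0 : ℝ) 1)) hgc.continuousAt
    simpa only [mul_div_cancel₀ _ hτ.ne'] using this
  have h1 := (integral_pairing_eq hcont (hφ (σ₁ v)) hτ.le
    (fun t h => hT.segment_mem hB hinv ht hU hP hv hvP h) hprim).2
  have hseg : IsRelSegment XH B (fun t => φ t (σ₁ v)) 0 (τB v) := by
    refine ⟨hφ _, hτ, hT.inside v hv, ?_, ?_⟩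
    · simp only [φ.map_zero_apply]
      exact not_mem_ball hB (hT.mem_sec₁ v hv.1)
    · intro h
      simp only [hT.exit v hv] at h
      have := hinv (ζB v)⁻¹ _ h
      rw [inv_smul_smul] at this
      exact not_mem_ball hB (hT.mem_sec₂ v hv.1) this
  have h2 := (hT.integral_eq_phiRel ht hB hinv huniq hXJ hθ hcont hU hP hv hvP hseg
    (by simp only [φ.map_zero_apply]; exact hT.F_sec₁ v hv.1)).2
  rw [← h2, h1]
  have e1 : (⟨τB v / τB v, hm ⟨τB v, hτ.le, le_rfl⟩⟩ : Icc (0 : ℝ) 1) = 1 :=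
    Subtype.ext (div_self hτ.ne')
  have e2 : (⟨0 / τB v, hm ⟨0, le_rfl, hτ.le⟩⟩ : Icc (0 : ℝ) 1) = 0 :=
    Subtype.ext (zero_div _)
  rw [e1, e2]

end IsTransitSystem

end RelativeSegments

end

/-! ### Jumps, variation, and degrees of circle-valued functions -/

noncomputable section

section Jumps

/-- A piecewise constant function changes over `[0,1]` by the sum of its jumps. -/
lemma sum_jumps {Ψ l r : ℝ → ℝ} (hl : ∀ s, ∀ᶠ s' in 𝓝[<] s, Ψ s' = l s)
    (hr : ∀ s, ∀ᶠ s' in 𝓝[>] s, Ψ s' = r s) {A : Finset ℝ} (hA : (A : Set ℝ) ⊆ Ico 0 1)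
    (hreg : ∀ s ∈ Ico (0 : ℝ) 1, s ∉ A → l s = r s) :
    ∑ s ∈ A, (r s - l s) = l 1 - l 0 := by
  classical
  have hll : ∀ s, ∀ᶠ t in 𝓝[<] s, l t = l s := by
    intro s
    obtain ⟨a, ha, hlt⟩ := (mem_nhdsLT_iff_exists_Ioo_subset).1 (hl s)
    filter_upwards [Ioo_mem_nhdsLT ha] with t ht
    obtain ⟨u, hu, hu'⟩ := ((hl t).and (Ioo_mem_nhdsLT ht.1)).exists
    rw [← hu]
    exact hlt ⟨hu'.1, hu'.2.trans ht.2⟩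
  have hlr : ∀ s, ∀ᶠ t in 𝓝[>] s, l t = r s := by
    intro s
    obtain ⟨b, hb, hlt⟩ := (mem_nhdsGT_iff_exists_Ioo_subset).1 (hr s)
    filter_upwards [Ioo_mem_nhdsGT hb] with t ht
    obtain ⟨u, hu, hu'⟩ := ((hl t).and (Ioo_mem_nhdsLT ht.1)).exists
    rw [← hu]
    exact hlt ⟨hu'.1, hu'.2.trans ht.2⟩
  -- Subtracting the jumps already passed from the left limit leaves a function that is locally
  -- constant from both sides, so it is continuous with zero right derivative.
  set E : ℝ → ℝ := fun t => l t - ∑ s ∈ A with s < t, (r s - l s) with hE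
  have hAfin : ∀ s : ℝ, ∀ᶠ t in 𝓝 s, ∀ a ∈ A, a ≠ s → (a < t ↔ a < s) := by
    intro s
    rw [Filter.eventually_all_finset]
    intro a _
    rcases lt_trichotomy a s with h | h | h
    · filter_upwards [lt_mem_nhds h] with t ht _
      exact ⟨fun _ => h, fun _ => ht⟩
    · exact Eventually.of_forall fun t h' => absurd h h'
    · filter_upwards [gt_mem_nhds h] with t ht _
      exact ⟨fun h' => absurd h' (not_lt.2 ht.le), fun h' => absurd h' (not_lt.2 h.le)⟩
  have hEl : ∀ s, ∀ᶠ t in 𝓝[<] s, E t = E s := by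
    intro s
    filter_upwards [hll s, nhdsWithin_le_nhds (hAfin s), self_mem_nhdsWithin] with t h1 h2 h3
    have : A.filter (· < t) = A.filter (· < s) := by
      refine Finset.filter_congr fun a ha => ?_
      rcases eq_or_ne a s with rfl | hne
      · exact ⟨fun h => absurd (h.trans h3) (lt_irrefl _), fun h => absurd h (lt_irrefl _)⟩
      · exact h2 a ha hne
    simp only [hE, h1, this]
  have hEr : ∀ s ∈ Ico (0 : ℝ) 1, ∀ᶠ t in 𝓝[>] s, E t = E s := by
    intro s hs
    filter_upwards [hlr s, nhdsWithin_le_nhds (hAfin s), self_mem_nhdsWithin] with t h1 h2 h3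
    have h3' : s < t := h3
    by_cases hsA : s ∈ A
    · have : A.filter (· < t) = insert s (A.filter (· < s)) := by
        ext a
        simp only [Finset.mem_filter, Finset.mem_insert]
        rcases eq_or_ne a s with rfl | hne
        · simp [hsA, h3']
        · simp only [hne, false_or]
          exact and_congr_right fun ha => h2 a ha hne
      simp only [hE, h1, this]
      rw [Finset.sum_insert (by simp)]
      ring
    · have : A.filter (· < t) = A.filter (· < s) := by
        refine Finset.filter_congr fun a ha => h2 a ha ?_
        rintro rfl; exact hsA ha
      simp only [hE, h1, this, hreg s hs hsA]
  have hder : ∀ s ∈ Ico (0 : ℝ) 1, HasDerivWithinAt E 0 (Ici s) s := by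
    intro s hs
    rw [← hasDerivWithinAt_Ioi_iff_Ici]
    exact (hasDerivWithinAt_const s _ (E s)).congr_of_eventuallyEq (hEr s hs) rfl
  have hcont : ContinuousOn E (Icc 0 1) := by
    intro s hs
    have h1 : ContinuousWithinAt E (Iio s) s := tendsto_nhds_of_eventually_eq (hEl s)
    rcases eq_or_lt_of_le hs.2 with h | h
    · refine ContinuousWithinAt.mono (t := insert s (Iio s)) h1.insert ?_
      rw [Iio_insert, h]
      exact fun x hx => hx.2
    · have h2 := (hder s ⟨hs.1, h⟩).continuousWithinAt
      have := h1.union h2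
      rw [Iio_union_Ici] at this
      exact this.mono (subset_univ _)
  have h := constant_of_has_deriv_right_zero hcont hder 1 ⟨zero_le_one, le_rfl⟩
  have e1 : A.filter (· < (1 : ℝ)) = A := Finset.filter_true_of_mem fun a ha => (hA ha).2
  have e0 : A.filter (· < (0 : ℝ)) = ∅ := Finset.filter_false_of_mem fun a ha => not_lt.2 (hA ha).1
  simp only [hE, e1, e0, Finset.sum_empty] at h
  linarith

/-- Periodicity spreads finiteness from one period to every bounded interval, which excludes
accumulation points. -/
lemma eventually_not_mem_of_periodic {N : Set ℝ} (hN : ∀ s, s + 1 ∈ N ↔ s ∈ N)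
    (hfin : (N ∩ Ico 0 1).Finite) (s : ℝ) : ∀ᶠ t in 𝓝[≠] s, t ∉ N := by
  have hint : ∀ (n : ℤ) (s : ℝ), s + n ∈ N ↔ s ∈ N := by
    intro n
    induction n using Int.induction_on with
    | zero => simp
    | succ n ih => intro s; have := (hN _).trans (ih s); push_cast at this ⊢; rwa [← add_assoc]
    | pred n ih => intro s; rw [← ih s, ← hN (s + _)]; push_cast; ring_nf
  have hN' : (N ∩ Icc (s - 1) (s + 1)).Finite := by
    have hb : ((fun x : ℝ × ℤ => x.1 + x.2) '' ((N ∩ Ico 0 1) ×ˢ Icc ⌊s - 1⌋ ⌊s + 1⌋)).Finite :=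
      (hfin.prod (finite_Icc _ _)).image _
    refine hb.subset ?_
    rintro t ⟨ht, ht1, ht2⟩
    refine ⟨(Int.fract t, ⌊t⌋), ⟨⟨?_, Int.fract_nonneg t, Int.fract_lt_one t⟩,
      Int.floor_le_floor ht1, Int.floor_le_floor ht2⟩, Int.fract_add_floor t⟩
    rw [← hint ⌊t⌋, Int.fract_add_floor]; exact ht
  have hc : IsClosed ((N ∩ Icc (s - 1) (s + 1)) \ {s}) := (hN'.subset sdiff_subset).isClosed
  have h1 : ∀ᶠ t in 𝓝 s, t ∉ (N ∩ Icc (s - 1) (s + 1)) \ {s} :=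
    hc.isOpen_compl.mem_nhds fun h => h.2 rfl
  rw [eventually_nhdsWithin_iff]
  filter_upwards [h1, Icc_mem_nhds (show s - 1 < s by linarith) (show s < s + 1 by linarith)]
    with t h2 h3 h4 h5
  exact h2 ⟨⟨h5, h3⟩, h4⟩

/-- The variation of a periodic function which, up to a continuous function of increment `x`, is
constant on the intervals free of exceptional points. -/
theorem hasVariation_of_locally_const {g c : ℝ → ℝ} (hg : ∀ s, g (s + 1) = g s) (hc : Continuous c)
    {x : ℝ} (hcx : ∀ s, c (s + 1) = c s + x) {N : Set ℝ} (hN : ∀ s, s + 1 ∈ N ↔ s ∈ N)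
    (hfin : (N ∩ Ico 0 1).Finite)
    (hconst : ∀ a b, (∀ s ∈ Ioo a b, s ∉ N) → ∀ s ∈ Ioo a b, ∀ s' ∈ Ioo a b,
      g s - c s = g s' - c s') : HasVariation g x := by
  classical
  set Ψ : ℝ → ℝ := fun s => g s - c s with hΨ
  have hball : ∀ s, ∃ ε > 0, ∀ t, t ≠ s → t ∈ Ioo (s - ε) (s + ε) → t ∉ N := by
    intro s
    have := eventually_not_mem_of_periodic hN hfin s
    rw [eventually_nhdsWithin_iff, Metric.eventually_nhds_iff_ball] at this
    obtain ⟨ε, hε, h⟩ := this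
    exact ⟨ε, hε, fun t h1 h2 => h t (by rwa [Real.ball_eq_Ioo]) h1⟩
  choose ε hε hgood using hball
  set l : ℝ → ℝ := fun s => Ψ (s - ε s / 2) with hldef
  set r : ℝ → ℝ := fun s => Ψ (s + ε s / 2) with hrdef
  have hl : ∀ s, ∀ᶠ s' in 𝓝[<] s, Ψ s' = l s := by
    intro s
    have h0 := hε s
    filter_upwards [Ioo_mem_nhdsLT (show s - ε s < s by linarith)] with t ht
    exact hconst (s - ε s) s (fun u hu => hgood s u hu.2.ne ⟨hu.1, by linarith [hu.2]⟩) t ht _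
      ⟨by linarith, by linarith⟩
  have hr : ∀ s, ∀ᶠ s' in 𝓝[>] s, Ψ s' = r s := by
    intro s
    have h0 := hε s
    filter_upwards [Ioo_mem_nhdsGT (show s < s + ε s by linarith)] with t ht
    exact hconst s (s + ε s) (fun u hu => hgood s u hu.1.ne' ⟨by linarith [hu.1], hu.2⟩) t ht _
      ⟨by linarith, by linarith⟩
  have hfull : ∀ s, s ∉ N → ∀ t ∈ Ioo (s - ε s) (s + ε s), Ψ t = Ψ s := by
    intro s hs t ht
    have h0 := hε s
    refine hconst (s - ε s) (s + ε s) (fun u hu => ?_) t ht s ⟨by linarith, by linarith⟩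
    rcases eq_or_ne u s with rfl | hne
    · exact hs
    · exact hgood s u hne hu
  have hmem : ∀ s, s ∈ hfin.toFinset ↔ s ∈ N ∧ s ∈ Ico (0 : ℝ) 1 := fun s => by
    rw [Set.Finite.mem_toFinset]; rfl
  refine ⟨hfin.toFinset, fun s => l s + c s, fun s => r s + c s, ?_, ?_, ?_, ?_⟩
  · intro s hs
    exact ((hmem s).1 hs).2
  · intro s hs hsA
    have hsN : s ∉ N := fun h => hsA ((hmem s).2 ⟨h, hs⟩)
    have h1 : ContinuousAt Ψ s := by
      refine (continuousAt_const (y := Ψ s)).congr ?_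
      have h0 := hε s
      filter_upwards [Ioo_mem_nhds (show s - ε s < s by linarith) (show s < s + ε s by linarith)]
        with t ht
      exact (hfull s hsN t ht).symm
    have h2 : g = fun s => Ψ s + c s := by funext s; simp [hΨ]
    rw [h2]
    exact h1.add hc.continuousAt
  · intro s _
    have h2 : g = fun s => Ψ s + c s := by funext s; simp [hΨ]
    rw [h2]
    exact ⟨(tendsto_nhds_of_eventually_eq (hl s)).add hc.continuousWithinAt.tendsto,
      (tendsto_nhds_of_eventually_eq (hr s)).add hc.continuousWithinAt.tendsto⟩
  · have h := sum_jumps hl hr (A := hfin.toFinset) (fun s hs => ((hmem s).1 hs).2) fun s hs hsA => by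
      have hsN : s ∉ N := fun h => hsA ((hmem s).2 ⟨h, hs⟩)
      have h0 := hε s
      exact (hfull s hsN _ ⟨by linarith, by linarith⟩).trans
        (hfull s hsN _ ⟨by linarith, by linarith⟩).symm
    -- `Ψ` drops by `x` over a period; this is read off at a point just below 0 and its translate
    -- just below 1. The jumps therefore sum to `-x`.
    have hl1 : l 1 = l 0 - x := by
      have h1 : ∀ᶠ s in 𝓝[<] (0 : ℝ), Ψ (s + 1) = l 1 := by
        have : Tendsto (fun s : ℝ => s + 1) (𝓝[<] 0) (𝓝[<] 1) := by
          refine tendsto_nhdsWithin_iff.2 ⟨?_, ?_⟩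
          · have : Continuous fun s : ℝ => s + 1 := by fun_prop
            have := this.tendsto 0
            rw [zero_add] at this
            exact this.mono_left nhdsWithin_le_nhds
          · filter_upwards [self_mem_nhdsWithin] with s hs
            have : s < 0 := hs
            rw [mem_Iio]; linarith
        exact this.eventually (hl 1)
      obtain ⟨s, h2, h3⟩ := (h1.and (hl 0)).exists
      rw [← h2, ← h3, hΨ]
      simp only [hg, hcx]; ring
    have e : ∑ s ∈ hfin.toFinset, (r s + c s - (l s + c s)) = ∑ s ∈ hfin.toFinset, (r s - l s) :=
      Finset.sum_congr rfl fun s _ => by ring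
    rw [e, h, hl1]; ring

/-- Lifting of circle-valued functions on the line. -/
lemma exists_circle_lift {X : Type*} [TopologicalSpace X] [SimplyConnectedSpace X]
    [LocallyPathConnectedSpace X] {ζ : X → Circle} (hζ : Continuous ζ) (x₀ : X) (y₀ : ℝ)
    (h₀ : Circle.exp y₀ = ζ x₀) :
    ∃ α : X → ℝ, Continuous α ∧ α x₀ = y₀ ∧ ∀ x, Circle.exp (α x) = ζ x := by
  obtain ⟨α, ⟨h1, h2⟩, -⟩ := Circle.isCoveringMap_exp.existsUnique_continuousMap_lifts
    (⟨ζ, hζ⟩ : C(X, Circle)) x₀ y₀ h₀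
  exact ⟨α, α.continuous, h1, fun x => congrFun h2 x⟩

lemma circle_exp_eq_one_iff {x : ℝ} : Circle.exp x = 1 ↔ ∃ m : ℤ, x = m * (2 * Real.pi) :=
  Circle.exp_eq_one

/-- A lift of a periodic circle-valued function has a degree. -/
lemma exists_degree {α : ℝ → ℝ} (hα : Continuous α)
    (hper : ∀ s, Circle.exp (α (s + 1)) = Circle.exp (α s)) :
    ∃ m : ℤ, ∀ s, α (s + 1) = α s + 2 * Real.pi * m := by
  have h1 : ∀ s, ∃ m : ℤ, (α (s + 1) - α s) / (2 * Real.pi) = m := by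
    intro s
    have : Circle.exp (α (s + 1) - α s) = 1 := by rw [Circle.exp_sub, hper, div_self']
    obtain ⟨m, hm⟩ := circle_exp_eq_one_iff.1 this
    exact ⟨m, by rw [hm, mul_div_cancel_right₀ _ (by positivity)]⟩
  choose m hm using h1
  have hmc : Continuous m := by
    rw [Int.isClosedEmbedding_coe_real.isInducing.continuous_iff]
    have : ((↑) : ℤ → ℝ) ∘ m = fun s => (α (s + 1) - α s) / (2 * Real.pi) := by
      funext s; exact (hm s).symm
    rw [this]; fun_prop
  refine ⟨m 0, fun s => ?_⟩
  have : m s = m 0 := PreconnectedSpace.constant inferInstance hmc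
  have h2 := hm s
  rw [this, div_eq_iff (by positivity)] at h2
  linarith

end Jumps

end

/-! ### The variation of `Φ_rel` as the degree of the inner holonomy -/

noncomputable section

section Variation

variable {M : Type*} [TopologicalSpace M] [ChartedSpace E4 M] [IsManifold (𝓡 4) ∞ M]
  [MulAction Circle M] [ContinuousSMul Circle M]
  {θ : (p : M) → TangentSpace (𝓡 4) p →L[ℝ] ℝ} {XJ XH : (p : M) → TangentSpace (𝓡 4) p}
  {φ : Flow ℝ M} {F : M → ℝ × ℝ} {R : Set M}
  {vbar : ℝ × ℝ} {B : Set M} {D : Set (ℝ × ℝ)} {σ₁ σ₂ : ℝ × ℝ → M} {τB τC : ℝ × ℝ → ℝ}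
  {ζB ζC : ℝ × ℝ → Circle}

/-- The variation of `phiRel` is the degree of the holonomy inside the ball. -/
theorem IsTransitSystem.hasVariation_phiRel
    (hT : IsTransitSystem φ F vbar B D σ₁ σ₂ τB τC ζB ζC)
    (ht : IsToralFlow φ F R) (hB : IsOpen B) (hinv : ∀ (z : Circle), ∀ p ∈ B, z • p ∈ B)
    (hφ : ∀ p, IsMIntegralCurve (I := 𝓡 4) (fun t => φ t p) XH)
    (huniq : ∀ γ : ℝ → M, IsMIntegralCurve (I := 𝓡 4) γ XH → ∀ t, γ t = φ t (γ 0))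
    (hXJ : ∀ p : M, IsMIntegralCurve (I := 𝓡 4) (fun t : ℝ => Circle.exp t • p) XJ)
    {U P : Set M} (hθ : IsRotationForm XJ θ (U \ P))
    (hcont : ContinuousOn (fun p => (θ p (XH p) : ℝ)) (U \ P))
    (hU : F ⁻¹' D ∩ closure B ⊆ U) (hP : F ⁻¹' D ∩ frontier B ∩ P = ∅)
    (hD : ContractibleSpace D) {Γ : ℝ → ℝ × ℝ} (hΓ : Continuous Γ) (hper : ∀ s, Γ (s + 1) = Γ s)
    (hΓD : ∀ s, Γ s ∈ D \ {vbar}) (hfin : {s ∈ Ico (0 : ℝ) 1 | Γ s ∈ F '' (P ∩ B)}.Finite)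
    {α : ℝ → ℝ} (hα : Continuous α) (hαζ : ∀ s, Circle.exp (α s) = ζB (Γ s)) {m : ℤ}
    (hm : ∀ s, α (s + 1) = α s + 2 * Real.pi * m) :
    HasVariation (fun s => phiRel F XH θ B (Γ s)) (2 * Real.pi * m) := by
  have hfr : ∀ p ∈ frontier B, F p ∈ D → p ∈ U \ P := fun p hp hF =>
    ⟨hU ⟨hF, frontier_subset_closure hp⟩, fun hpP => by
      have : p ∈ F ⁻¹' D ∩ frontier B ∩ P := ⟨⟨hF, hp⟩, hpP⟩
      rw [hP] at this; exact this⟩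
  have hs₁ : ∀ v ∈ D, σ₁ v ∈ U \ P := fun v hv =>
    hfr _ (hT.mem_sec₁ v hv) (by rw [hT.F_sec₁ v hv]; exact hv)
  have hs₂ : ∀ v ∈ D, σ₂ v ∈ U \ P := fun v hv =>
    hfr _ (hT.mem_sec₂ v hv) (by rw [hT.F_sec₂ v hv]; exact hv)
  have hc₁ : Continuous fun v : D => σ₁ v := continuousOn_iff_continuous_domRestrict.1 hT.cont_sec₁
  have hc₂ : Continuous fun v : D => σ₂ v := continuousOn_iff_continuous_domRestrict.1 hT.cont_sec₂
  have hq₂ : Continuous fun x : D × ℝ => Circle.exp x.2 • σ₂ x.1 :=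
    (Circle.exp.continuous.comp continuous_snd).smul (hc₂.comp continuous_fst)
  -- These primitives live on the boundary circles over all of `D`, so they are unaffected by the
  -- values at which `Γ` meets poles inside `B`.
  obtain ⟨G₁, hG₁⟩ := hθ.exists_primitive_along hc₁ fun v => hs₁ v v.2
  obtain ⟨G₂, hG₂⟩ := hθ.exists_primitive_along hq₂ fun x => hθ.invariant _ _ (hs₂ x.1 x.1.2)
  have hlin : ∀ (v : D) u, G₂ (v, u) = G₂ (v, 0) + u := fun v u =>
    hθ.primitive_circle (hs₂ v v.2) (hXJ _) (G := fun u => G₂ (v, u))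
      (fun u => (hG₂ (v, u)).comp (g := fun u : ℝ => (v, u)) (by fun_prop)) u
  have hG₁c : Continuous G₁ := continuous_iff_continuousAt.2 fun v =>
    (hG₁ v).continuousAt hc₁.continuousAt
  have hG₂c : Continuous G₂ := continuous_iff_continuousAt.2 fun v =>
    (hG₂ v).continuousAt hq₂.continuousAt
  set Γ' : ℝ → D := fun s => ⟨Γ s, (hΓD s).1⟩ with hΓ'
  have hΓ'c : Continuous Γ' := hΓ.subtype_mk _
  have hΓ'p : ∀ s, Γ' (s + 1) = Γ' s := fun s => Subtype.ext (hper s)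
  -- Over a period `c` gains exactly the gain of `α`, since `G₂` grows linearly in the angle and
  -- everything else is periodic.
  refine hasVariation_of_locally_const (c := fun s => G₂ (Γ' s, α s) - G₁ (Γ' s))
    (N := {s | Γ s ∈ F '' (P ∩ B)}) (fun s => by rw [hper]) (by fun_prop) (fun s => ?_)
    (fun s => by simp only [mem_ofPred_eq, hper]) ?_ ?_
  · simp only [hΓ'p]
    rw [hlin, hm, hlin _ (α s)]; ring
  · convert hfin using 1
    ext s
    exact and_comm
  · intro a b hab s hs s' hs'
    have hfree : ∀ u : Ioo a b, ∀ p ∈ B, F p = Γ u → p ∉ P := fun u p hp hF hpP =>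
      hab u u.2 ⟨p, ⟨hpP, hp⟩, hF⟩
    have : ContractibleSpace (Ioo a b) := (convex_Ioo a b).contractibleSpace ⟨s, hs⟩
    have : ContractibleSpace (Icc (0 : ℝ) 1) :=
      (convex_Icc (0 : ℝ) 1).contractibleSpace ⟨0, le_rfl, zero_le_one⟩
    have hτ0 : ∀ s, 0 < τB (Γ s) := fun s => hT.pos_τB _ (hΓD s)
    have hτc : Continuous fun s => τB (Γ s) := hT.cont_τB.comp_continuous hΓ hΓD
    have hφc : Continuous fun x : ℝ × M => φ x.1 x.2 := φ.continuous continuous_fst continuous_snd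
    have hσc : Continuous fun s => σ₁ (Γ s) := hT.cont_sec₁.comp_continuous hΓ fun s => (hΓD s).1
    have hqc : Continuous fun x : Ioo a b × Icc (0 : ℝ) 1 =>
        φ (τB (Γ x.1) * x.2) (σ₁ (Γ x.1)) := by
      refine hφc.comp (Continuous.prodMk ?_ ?_)
      · exact (hτc.comp (continuous_subtype_val.comp continuous_fst)).mul
          (continuous_subtype_val.comp continuous_snd)
      · exact hσc.comp (continuous_subtype_val.comp continuous_fst)
    -- Without polar values the strip of segments lies in the domain of the form. On its two edges
    -- `G` can be compared with `G₁` and `G₂`, from which it differs by constants.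
    obtain ⟨G, hG⟩ := hθ.exists_primitive_along hqc fun x =>
      hT.segment_mem hB hinv ht hU hP (hΓD x.1) (hfree x.1)
        ⟨mul_nonneg (hτ0 _).le x.2.2.1, mul_le_of_le_one_right (hτ0 _).le x.2.2.2⟩
    have hphi : ∀ u : Ioo a b, phiRel F XH θ B (Γ u) = G (u, 1) - G (u, 0) := fun u =>
      hT.phiRel_eq_sub ht hB hinv hφ huniq hXJ hθ hcont hU hP (hΓD u) (hfree u)
        (G := fun t => G (u, t)) fun t => (hG (u, t)).comp (g := fun t => (u, t)) (by fun_prop)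
    have hΓI : Continuous fun u : Ioo a b => Γ' u := hΓ'c.comp continuous_subtype_val
    have h0 := IsPrimitiveAlong.sub_eq_sub (θ := θ) (q := fun u : Ioo a b => σ₁ (Γ u))
      (G := fun u => G₁ (Γ' u)) (G' := fun u => G (u, 0))
      (fun u => (hG₁ (Γ' u)).comp (g := fun u : Ioo a b => Γ' u) hΓI.continuousAt)
      (fun u => by
        have := (hG (u, 0)).comp (g := fun u : Ioo a b => (u, (0 : Icc (0 : ℝ) 1))) (by fun_prop)
        simpa using this)
      (hσc.comp continuous_subtype_val) ⟨s, hs⟩ ⟨s', hs'⟩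
    have hgc : Continuous fun u : Ioo a b => (Γ' u, α u) :=
      hΓI.prodMk (hα.comp continuous_subtype_val)
    have h1 := IsPrimitiveAlong.sub_eq_sub (θ := θ)
      (q := fun u : Ioo a b => Circle.exp (α u) • σ₂ (Γ u))
      (G := fun u => G₂ (Γ' u, α u)) (G' := fun u => G (u, 1))
      (fun u => (hG₂ (Γ' u, α u)).comp (g := fun u : Ioo a b => (Γ' u, α u)) hgc.continuousAt)
      (fun u => by
        have := (hG (u, 1)).comp (g := fun u : Ioo a b => (u, (1 : Icc (0 : ℝ) 1))) (by fun_prop)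
        simpa [hαζ, hT.exit _ (hΓD _)] using this)
      (hq₂.comp hgc) ⟨s, hs⟩ ⟨s', hs'⟩
    have e1 := hphi ⟨s, hs⟩
    have e2 := hphi ⟨s', hs'⟩
    simp only at h0 h1 e1 e2 ⊢
    rw [e1, e2]
    linarith

end Variation

end

/-! ### Period lattices and the monodromy number -/

noncomputable section

section Monodromy

/-- A continuous function whose circle exponential is constant is constant. -/
lemma eq_of_circle_exp_const {X : Type*} [TopologicalSpace X] [PreconnectedSpace X] {f : X → ℝ}
    (hf : Continuous f) {w : Circle} (h : ∀ x, Circle.exp (f x) = w) (x y : X) : f x = f y := by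
  have h1 : ∀ x, ∃ m : ℤ, (f x - f y) / (2 * Real.pi) = m := by
    intro x
    have : Circle.exp (f x - f y) = 1 := by rw [Circle.exp_sub, h, h, div_self']
    obtain ⟨m, hm⟩ := circle_exp_eq_one_iff.1 this
    exact ⟨m, by rw [hm, mul_div_cancel_right₀ _ (by positivity)]⟩
  choose m hm using h1
  have hmc : Continuous m := by
    rw [Int.isClosedEmbedding_coe_real.isInducing.continuous_iff]
    have : ((↑) : ℤ → ℝ) ∘ m = fun s => (f s - f y) / (2 * Real.pi) := by
      funext s; exact (hm s).symm
    rw [this]; fun_prop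
  have h2 : m x = m y := PreconnectedSpace.constant inferInstance hmc
  have h3 := hm y
  rw [sub_self, zero_div] at h3
  have h4 := hm x
  rw [h2, ← h3, div_eq_zero_iff] at h4
  rcases h4 with h4 | h4
  · linarith
  · exact absurd h4 (by positivity)

/-- Homotopic loops in the circle have the same degree. -/
lemma degree_eq_zero_of_homotopy {u : ℝ × ℝ → Circle} (hu : Continuous u)
    (hper : ∀ s t, u (s, t + 1) = u (s, t)) {w w' : Circle} (h0 : ∀ t, u (0, t) = w) {j : ℤ}
    (h1 : ∀ t : ℝ, u (1, t) = w' * Circle.exp (2 * Real.pi * j * t)) : j = 0 := by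
  obtain ⟨y₀, hy₀⟩ := Circle.exp_surjective (u (0, 0))
  obtain ⟨f, hf, -, hfu⟩ := exists_circle_lift hu (0, 0) y₀ hy₀
  -- The winding `f (s, 1) - f (s, 0)` does not depend on `s`; it is 0 at `s = 0` and `2πj` at `s =
  -- 1`.
  have e1 := eq_of_circle_exp_const (f := fun s : ℝ => f (s, 1) - f (s, 0)) (by fun_prop) (w := 1)
    (fun s => by rw [Circle.exp_sub, hfu, hfu, ← zero_add (1 : ℝ), hper, div_self']) 0 1
  have e2 := eq_of_circle_exp_const (f := fun t : ℝ => f (0, t)) (by fun_prop)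
    (fun t => by rw [hfu, h0]) 0 1
  have e3 := eq_of_circle_exp_const (f := fun t : ℝ => f (1, t) - 2 * Real.pi * j * t)
    (by fun_prop) (w := w') (fun t => by rw [Circle.exp_sub, hfu, h1, mul_div_cancel_right]) 0 1
  simp only [mul_zero, sub_zero, mul_one] at e1 e2 e3
  have : 2 * Real.pi * (j : ℝ) = 0 := by linarith
  have h3 : (j : ℝ) = 0 := by
    rcases mul_eq_zero.1 this with h | h
    · exact absurd h (by positivity)
    · exact h
  exact_mod_cast h3

variable {M : Type*} [TopologicalSpace M] [T2Space M] [MulAction Circle M]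
  {φ : Flow ℝ M} {F : M → ℝ × ℝ} {R : Set M}
  {vbar : ℝ × ℝ} {B : Set M} {D : Set (ℝ × ℝ)} {σ₁ σ₂ : ℝ × ℝ → M} {τB τC : ℝ × ℝ → ℝ}
  {ζB ζC : ℝ × ℝ → Circle}

/-- The period lattice of the torus through `q`: the first return of the flow to the circle orbit is
after the time `T`, with displacement `Θ`. -/
structure IsPeriodLattice (φ : Flow ℝ M) (q : M) (T Θ : ℝ) : Prop where
  pos : 0 < T
  period : φ T q = Circle.exp Θ • q
  first : ∀ t ∈ Ioo 0 T, ∀ z : Circle, φ t q ≠ z • q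

namespace IsPeriodLattice

variable {q : M} {T Θ : ℝ}

lemma period_int (h : IsPeriodLattice φ q T Θ) (ht : IsToralFlow φ F R) (n : ℤ) :
    φ (n * T) q = Circle.exp (n * Θ) • q := by
  have hb : φ (-T) q = Circle.exp (-Θ) • q := by
    have := congrArg (fun p => Circle.exp (-Θ) • φ (-T) p) h.period
    simp only [← φ.map_add, neg_add_cancel, φ.map_zero_apply, ht.map_smul, smul_smul, ← Circle.exp_add,
      Circle.exp_zero, one_smul] at this
    exact this.symm
  induction n using Int.induction_on with
  | zero => simp [φ.map_zero_apply]
  | succ n ih =>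
    push_cast at ih ⊢
    rw [show ((n : ℝ) + 1) * T = T + n * T by ring, φ.map_add, ih, ht.map_smul, h.period, smul_smul,
      ← Circle.exp_add]
    congr 2; ring
  | pred n ih =>
    push_cast at ih ⊢
    rw [show (-(n : ℝ) - 1) * T = -T + -n * T by ring, φ.map_add, ih, ht.map_smul, hb, smul_smul,
      ← Circle.exp_add]
    congr 2; ring

/-- Modulo the period, a nonzero remainder of the time would be a return before the first one. So
`x` is an integer, and freeness determines the rotation. -/
lemma displacement (h : IsPeriodLattice φ q T Θ) (ht : IsToralFlow φ F R) (hq : q ∈ R) {x : ℝ}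
    {z : Circle} (hz : φ (x * T) q = z • q) : z = Circle.exp (x * Θ) := by
  have hT := h.pos
  have hfr : φ (Int.fract x * T) q = (Circle.exp (-(⌊x⌋ * Θ)) * z) • q := by
    have e : Int.fract x * T = x * T + (-⌊x⌋ : ℤ) * T := by
      rw [Int.fract]; push_cast; ring
    rw [e, φ.map_add, h.period_int ht, ht.map_smul, hz, smul_smul]
    congr 3; push_cast; ring
  have h0 : Int.fract x = 0 := by
    by_contra hne
    have hpos : 0 < Int.fract x := lt_of_le_of_ne (Int.fract_nonneg x) (Ne.symm hne)
    refine h.first (Int.fract x * T) ⟨by positivity, ?_⟩ _ hfr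
    have := Int.fract_lt_one x
    nlinarith
  rw [h0, zero_mul, φ.map_zero_apply] at hfr
  have h1 := ht.free q hq _ hfr.symm
  have hx : (⌊x⌋ : ℝ) = x := by
    have := Int.fract_add_floor x
    rw [h0, zero_add] at this; exact this
  rw [hx, Circle.exp_neg, inv_mul_eq_one] at h1
  exact h1.symm

/-- The circle coordinate of a point of the torus. -/
lemma coord_unique (h : IsPeriodLattice φ q T Θ) (ht : IsToralFlow φ F R) (hq : q ∈ R) {x x' : ℝ}
    {z z' : Circle} (he : z • φ (x * T) q = z' • φ (x' * T) q) :
    z * Circle.exp (x * Θ) = z' * Circle.exp (x' * Θ) := by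
  have h1 : φ ((x - x') * T) q = (z⁻¹ * z') • q := by
    have := congrArg (fun p => z⁻¹ • φ (-(x' * T)) p) he
    simp only [ht.map_smul, ← φ.map_add, neg_add_cancel, φ.map_zero_apply, smul_smul, inv_mul_cancel,
      one_smul] at this
    rw [← this]; congr 1; ring
  have h2 := h.displacement ht hq h1
  rw [inv_mul_eq_iff_eq_mul] at h2
  rw [h2, mul_assoc, ← Circle.exp_add]
  congr 2; ring

lemma translate (h : IsPeriodLattice φ q T Θ) (ht : IsToralFlow φ F R) (x : ℝ) (z : Circle) :
    IsPeriodLattice φ (z • φ x q) T Θ where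
  pos := h.pos
  period := by
    rw [ht.map_smul, ← φ.map_add, add_comm, φ.map_add, h.period, ht.map_smul, smul_smul, smul_smul,
      mul_comm]
  first t htt z' he := by
    have := congrArg (fun p => z⁻¹ • φ (-x) p) he
    simp only [ht.map_smul, ← φ.map_add, neg_add_cancel, φ.map_zero_apply, smul_smul, inv_mul_cancel,
      one_smul] at this
    rw [show -x + (t + x) = t by ring] at this
    exact h.first t htt _ this

lemma unique {T' Θ' : ℝ} (h : IsPeriodLattice φ q T Θ) (h' : IsPeriodLattice φ q T' Θ')
    (ht : IsToralFlow φ F R) (hq : q ∈ R) (hΘ : Θ ∈ Ico 0 (2 * Real.pi))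
    (hΘ' : Θ' ∈ Ico 0 (2 * Real.pi)) : T = T' ∧ Θ = Θ' := by
  have hTT : T = T' := by
    rcases lt_trichotomy T T' with hlt | he | hlt
    · exact absurd h.period (h'.first T ⟨h.pos, hlt⟩ _)
    · exact he
    · exact absurd h'.period (h.first T' ⟨h'.pos, hlt⟩ _)
  refine ⟨hTT, ?_⟩
  subst hTT
  have h1 : Circle.exp (Θ' - Θ) = 1 := by
    apply ht.free q hq
    rw [Circle.exp_sub, div_eq_inv_mul, mul_smul, ← h'.period, h.period, inv_smul_smul]
  obtain ⟨n, hn⟩ := circle_exp_eq_one_iff.1 h1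
  have hπ := Real.pi_pos
  have h2 : n = 0 := by
    have ha : (-1 : ℝ) < n := by
      by_contra! hle
      nlinarith [hΘ.1, hΘ.2, hΘ'.1, hΘ'.2]
    have hb : (n : ℝ) < 1 := by
      by_contra! hle
      nlinarith [hΘ.1, hΘ.2, hΘ'.1, hΘ'.2]
    have ha' : -1 < n := by exact_mod_cast ha
    have hb' : n < 1 := by exact_mod_cast hb
    omega
  rw [h2] at hn
  push_cast at hn
  linarith

end IsPeriodLattice

variable [ContinuousSMul Circle M] [ChartedSpace E4 M] [IsManifold (𝓡 4) ∞ M]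
  {XH : (p : M) → TangentSpace (𝓡 4) p}

/-- Before `τB v` the orbit is in `B`, at `τB v` it is on the other boundary circle, and then it is
outside the closure of `B`; none of these meets the starting circle. -/
lemma IsTransitSystem.isPeriodLattice (hT : IsTransitSystem φ F vbar B D σ₁ σ₂ τB τC ζB ζC)
    (ht : IsToralFlow φ F R) (hB : IsOpen B) (hinv : ∀ (z : Circle), ∀ p ∈ B, z • p ∈ B)
    {v : ℝ × ℝ} (hv : v ∈ D \ {vbar}) {Θ : ℝ} (hΘ : Circle.exp Θ = ζB v * ζC v) :
    IsPeriodLattice φ (σ₁ v) (τB v + τC v) Θ where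
  pos := add_pos (hT.pos_τB v hv) (hT.pos_τC v hv.1)
  period := by
    rw [add_comm, φ.map_add, hT.exit v hv, ht.map_smul, hT.enter v hv.1, smul_smul, hΘ]
  first t htt z he := by
    have hinv' : ∀ (z : Circle) q, z • q ∈ B → q ∈ B := fun z q hq => by
      have := hinv z⁻¹ _ hq
      rwa [inv_smul_smul] at this
    have hcl : z • σ₁ v ∈ closure B :=
      map_mem_closure (continuous_const_smul z) (frontier_subset_closure (hT.mem_sec₁ v hv.1))
        fun q hq => hinv z q hq
    rcases lt_trichotomy t (τB v) with h | h | h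
    · have := hT.inside v hv t ⟨htt.1, h⟩
      rw [he] at this
      exact IsTransitSystem.not_mem_ball hB (hT.mem_sec₁ v hv.1) (hinv' _ _ this)
    · rw [h, hT.exit v hv] at he
      refine hT.ne_sec v hv.1 ((ζB v)⁻¹ * z) ?_
      rw [mul_smul, ← he, inv_smul_smul]
    · have := hT.outside v hv.1 (t - τB v) ⟨by linarith, by linarith [htt.2]⟩
      apply this
      have e : t = (t - τB v) + τB v := by ring
      rw [e, φ.map_add, hT.exit v hv, ht.map_smul] at he
      have h3 := map_mem_closure (continuous_const_smul (ζB v)⁻¹) hcl fun q hq => hinv _ q hq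
      rwa [← he, inv_smul_smul] at h3

lemma IsTransitSystem.cover (hT : IsTransitSystem φ F vbar B D σ₁ σ₂ τB τC ζB ζC)
    (ht : IsToralFlow φ F R) {v : ℝ × ℝ} (hv : v ∈ D \ {vbar}) {q : M} (hq : F q = v) :
    ∃ x ∈ Icc (0 : ℝ) 1, ∃ z : Circle, q = z • φ (x * (τB v + τC v)) (σ₁ v) := by
  have h1 := hT.pos_τB v hv
  have h2 := hT.pos_τC v hv.1
  have key : ∃ t ∈ Icc 0 (τB v + τC v), ∃ z : Circle, q = z • φ t (σ₁ v) := by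
    by_cases hqB : q ∈ B
    · obtain ⟨t, ht', z, hz⟩ := hT.cover_inside v hv q (subset_closure hqB) hq
      exact ⟨t, ⟨ht'.1, by linarith [ht'.2]⟩, z, hz⟩
    · obtain ⟨t, ht', z, hz⟩ := hT.cover_outside v hv.1 q hqB hq
      refine ⟨t + τB v, ⟨by linarith [ht'.1], by linarith [ht'.2]⟩, z * (ζB v)⁻¹, ?_⟩
      rw [φ.map_add, hT.exit v hv, ht.map_smul, mul_smul, inv_smul_smul, hz]
  obtain ⟨t, ht', z, hz⟩ := key
  refine ⟨t / (τB v + τC v), ⟨div_nonneg ht'.1 (by positivity),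
    div_le_one_of_le₀ ht'.2 (by positivity)⟩, z, ?_⟩
  rw [div_mul_cancel₀ _ (by positivity), hz]

/-- The transport of the return cycle of a family of tori with period lattices. -/
lemma exists_monodromyNumber (ht : IsToralFlow φ F R)
    (hφ : ∀ p, IsMIntegralCurve (I := 𝓡 4) (fun t => φ t p) XH) {Γ : ℝ → ℝ × ℝ} {σ : ℝ → M}
    {T Θ : ℝ → ℝ} (hσ : Continuous σ) (hTc : Continuous T) (hΘc : Continuous Θ)
    (hσ1 : σ 1 = σ 0) (hT1 : T 1 = T 0) {m : ℤ} (hΘ1 : Θ 1 = Θ 0 + 2 * Real.pi * m)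
    (hΘ0 : Θ 0 ∈ Ico 0 (2 * Real.pi)) (hF : ∀ s, F (σ s) = Γ s)
    (hL : ∀ s, IsPeriodLattice φ (σ s) (T s) (Θ s)) : IsMonodromyNumber F XH Γ (-m) := by
  refine ⟨fun t => Circle.exp (-(Θ 0 * t)) • φ (T 0 * t) (σ 0),
    ⟨fun t => φ t (σ 0), T 0, Θ 0, hφ _, (hL 0).pos, hΘ0.1, hΘ0.2, ?_, ?_, fun t => rfl⟩, ?_⟩
  · simp only [φ.map_zero_apply]; exact (hL 0).period
  · simp only [φ.map_zero_apply]; exact (hL 0).first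
  -- Undoing the rotation with the continuous lift keeps every loop closed. At `s = 1` the lift
  -- exceeds its initial value by `2πm`, which leaves the factor `exp(-2πmt)`.
  · refine ⟨fun x => Circle.exp (-(Θ x.1 * x.2)) • φ (T x.1 * x.2) (σ x.1), ?_, ?_, fun t => rfl, ?_⟩
    · have hφc : Continuous fun x : ℝ × M => φ x.1 x.2 :=
        φ.continuous continuous_fst continuous_snd
      have h1 : Continuous fun x : ℝ × ℝ => φ (T x.1 * x.2) (σ x.1) :=
        hφc.comp (Continuous.prodMk (by fun_prop) (by fun_prop))
      have h2 : Continuous fun x : ℝ × ℝ => Circle.exp (-(Θ x.1 * x.2)) :=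
        Circle.exp.continuous.comp (by fun_prop)
      exact (h2.smul h1).continuousOn
    · intro s _ t
      refine ⟨?_, by simp only [ht.map_action, ht.map_flow, hF]⟩
      simp only
      rw [show T s * (t + 1) = T s * t + T s by ring, φ.map_add, (hL s).period, ht.map_smul,
        smul_smul, ← Circle.exp_add]
      congr 2; ring
    · intro t
      simp only [hσ1, hT1, hΘ1, smul_smul, ← Circle.exp_add]
      congr 2; push_cast; ring

/-- The monodromy number of a family of tori with period lattices. -/
lemma monodromyNumber_eq (ht : IsToralFlow φ F R)
    (huniq : ∀ γ : ℝ → M, IsMIntegralCurve (I := 𝓡 4) γ XH → ∀ t, γ t = φ t (γ 0))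
    {Γ : ℝ → ℝ × ℝ} {σ : ℝ → M}
    {T Θ : ℝ → ℝ} (hσ : Continuous σ) (hTc : Continuous T) (hΘc : Continuous Θ)
    (hσ1 : σ 1 = σ 0) (hT1 : T 1 = T 0) {m : ℤ} (hΘ1 : Θ 1 = Θ 0 + 2 * Real.pi * m)
    (hΘ0 : Θ 0 ∈ Ico 0 (2 * Real.pi)) (hR : ∀ s, σ s ∈ R)
    (hL : ∀ s, IsPeriodLattice φ (σ s) (T s) (Θ s))
    (hcov : ∀ s q, F q = Γ s → ∃ x ∈ Icc (0 : ℝ) 1, ∃ z : Circle, q = z • φ (x * T s) (σ s))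
    {k : ℤ} (hk : IsMonodromyNumber F XH Γ k) : k = -m := by
  obtain ⟨c, ⟨γ, T', Θ', hγ, hT', hΘ0', hΘ1', hret, hfirst, hc⟩, C, hCc, hC, hC0, hC1⟩ := hk
  -- The transport is continuous only over `s ∈ [0, 1]`; clamping `s` gives a map on the whole
  -- plane, to which lifting applies.
  set π : ℝ → ℝ := fun s => (projIcc (0 : ℝ) 1 zero_le_one s : ℝ) with hπ
  have hπc : Continuous π := continuous_subtype_val.comp continuous_projIcc
  have hπm : ∀ s, π s ∈ Icc (0 : ℝ) 1 := fun s => (projIcc (0 : ℝ) 1 zero_le_one s).2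
  have hπ0 : π 0 = 0 := by simp [hπ]
  have hπ1 : π 1 = 1 := by simp [hπ]
  have hQc : Continuous fun x : ℝ × ℝ => C (π x.1, x.2) :=
    hCc.comp_continuous (by fun_prop) fun x => ⟨hπm _, trivial⟩
  have hex : ∀ x : ℝ × ℝ, ∃ r ∈ Icc (0 : ℝ) 1, ∃ z : Circle,
      C (π x.1, x.2) = z • φ (r * T (π x.1)) (σ (π x.1)) := fun x =>
    hcov _ _ ((hC _ (hπm x.1) x.2).2)
  choose r hr z hz using hex
  -- The coordinates `r`, `z` are chosen without continuity, but by `coord_unique` this combination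
  -- does not depend on the choice.
  set u : ℝ × ℝ → Circle := fun x => z x * Circle.exp (r x * Θ (π x.1)) with hu
  have hspec : ∀ (x : ℝ × ℝ) (y : ℝ) (w : Circle), C (π x.1, x.2) = w • φ (y * T (π x.1)) (σ (π x.1)) →
      u x = w * Circle.exp (y * Θ (π x.1)) := fun x y w h =>
    (hL _).coord_unique ht (hR _) ((hz x).symm.trans h)
  have hφc : Continuous fun x : ℝ × M => φ x.1 x.2 := φ.continuous continuous_fst continuous_snd
  -- The preimage of a closed set `Z` is pulled back, by a continuous map, from the image of the
  -- compact set `A` of all coordinates with value in `Z`.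
  have huc : Continuous u := by
    rw [continuous_iff_isClosed]
    intro Z hZ
    set A : Set (ℝ × Circle × ℝ) := {y | y ∈ Icc (0 : ℝ) 1 ×ˢ (univ : Set Circle) ×ˢ Icc (0 : ℝ) 1 ∧
      y.2.1 * Circle.exp (y.2.2 * Θ y.1) ∈ Z} with hA
    have hAc : IsCompact A := by
      have h1 : IsClosed {y : ℝ × Circle × ℝ | y.2.1 * Circle.exp (y.2.2 * Θ y.1) ∈ Z} :=
        hZ.preimage (by fun_prop)
      exact (isCompact_Icc.prod (isCompact_univ.prod isCompact_Icc)).inter_right h1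
    have hmap : Continuous fun y : ℝ × Circle × ℝ => (y.1, y.2.1 • φ (y.2.2 * T y.1) (σ y.1)) := by
      have h1 : Continuous fun y : ℝ × Circle × ℝ => φ (y.2.2 * T y.1) (σ y.1) :=
        hφc.comp (Continuous.prodMk (by fun_prop) (by fun_prop))
      fun_prop
    have hcl := (hAc.image hmap).isClosed
    have hgr : Continuous fun x : ℝ × ℝ => (π x.1, C (π x.1, x.2)) :=
      (hπc.comp continuous_fst).prodMk hQc
    convert hcl.preimage hgr using 1
    ext x
    constructor
    · intro hx
      exact ⟨(π x.1, z x, r x), ⟨⟨hπm _, trivial, hr x⟩, hx⟩, by simp only [← hz x]⟩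
    · rintro ⟨⟨s, w, y⟩, ⟨-, hw⟩, he⟩
      simp only [Prod.mk.injEq] at he
      obtain ⟨rfl, he⟩ := he
      rw [mem_preimage, hspec x y w he.symm]
      exact hw
  have hq : F (γ 0) = Γ 0 := by
    have h1 : c 0 = γ 0 := by rw [hc]; simp
    rw [← h1, ← hC0]
    exact (hC 0 ⟨le_rfl, zero_le_one⟩ 0).2
  obtain ⟨x₀, -, z₀, hγ0⟩ := hcov 0 _ hq
  have hLγ := (hL 0).translate ht (x₀ * T 0) z₀
  rw [← hγ0] at hLγ
  have hLγ' : IsPeriodLattice φ (γ 0) T' Θ' :=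
    ⟨hT', by rw [← huniq γ hγ, hret], fun t h z => by rw [← huniq γ hγ]; exact hfirst t h z⟩
  have hγR : γ 0 ∈ R := by
    rw [hγ0]; exact ht.smul_mem _ _ (ht.flow_mem _ _ (hR 0))
  -- An arbitrary return cycle has the same period and the same rotation number: they agree at all
  -- points of a torus, once the latter is taken in `[0, 2π)`.
  obtain ⟨rfl, rfl⟩ := hLγ'.unique hLγ ht hγR ⟨hΘ0', hΘ1'⟩ hΘ0
  have hct : ∀ t, c t = (Circle.exp (-(Θ 0 * t)) * z₀) • φ ((t + x₀) * T 0) (σ 0) := by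
    intro t
    rw [hc, huniq γ hγ, hγ0, ht.map_smul, smul_smul, ← φ.map_add]
    congr 2; ring
  have h0 : ∀ t, u (0, t) = z₀ * Circle.exp (x₀ * Θ 0) := by
    intro t
    rw [hspec (0, t) (t + x₀) (Circle.exp (-(Θ 0 * t)) * z₀) (by simp only [hπ0]; rw [hC0, hct])]
    simp only [hπ0]
    rw [mul_comm _ z₀, mul_assoc, ← Circle.exp_add]
    congr 2; ring
  -- The coordinate `u` is constant along the return cycle. At `s = 1` the factor of the transported
  -- loop contributes degree `k` and the discrepancy of the lift contributes `m`.
  have h1 : ∀ t : ℝ, u (1, t) = z₀ * Circle.exp (x₀ * Θ 1) *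
      Circle.exp (2 * Real.pi * ((k + m : ℤ) : ℝ) * t) := by
    intro t
    rw [hspec (1, t) (t + x₀) (Circle.exp (2 * Real.pi * k * t) * (Circle.exp (-(Θ 0 * t)) * z₀))
      (by simp only [hπ1]; rw [hC1]; simp only; rw [hct, smul_smul, hσ1, hT1])]
    simp only [hπ1]
    have e : ∀ a b c : ℝ, Circle.exp a * (Circle.exp b * z₀) * Circle.exp c
        = z₀ * Circle.exp (a + b + c) := by
      intro a b c
      rw [Circle.exp_add, Circle.exp_add]; ac_rfl
    rw [e, mul_assoc z₀, ← Circle.exp_add, hΘ1]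
    congr 2; push_cast; ring
  have hperu : ∀ s t, u (s, t + 1) = u (s, t) := fun s t => by
    rw [hspec (s, t + 1) (r (s, t)) (z (s, t)) (by
      rw [← hz (s, t)]; exact (hC _ (hπm s) t).1)]
  have := degree_eq_zero_of_homotopy huc hperu h0 h1
  omega

end Monodromy

end

/-! ### The complete flow, and the comparison of monodromy with variation -/

noncomputable section

section Assembly

variable {M : Type*} [TopologicalSpace M] [T2Space M] [ChartedSpace E4 M]
  [IsManifold (𝓡 4) ∞ M] [MulAction Circle M]
  {w : (p : M) → TangentSpace (𝓡 4) p →L[ℝ] TangentSpace (𝓡 4) p →L[ℝ] ℝ} {H J : M → ℝ}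
  {XH XJ : (p : M) → TangentSpace (𝓡 4) p}

lemma IsHamiltonianCircleAction.continuousSMul (hXJ : IsHamiltonianCircleAction w J XJ) :
    ContinuousSMul Circle M := ⟨hXJ.smooth.continuous⟩

/-- When the fibres of `(H, J)` are compact, the Hamiltonian field of `H` is complete. -/
theorem exists_hamiltonian_flow (hw : IsSymplecticForm w)
    (hH : ContMDiff (𝓡 4) 𝓘(ℝ, ℝ) ∞ H) (hJ : ContMDiff (𝓡 4) 𝓘(ℝ, ℝ) ∞ J)
    (hXH : IsHamiltonianField w H XH) (hXJ : IsHamiltonianCircleAction w J XJ)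
    (hinv : ∀ (z : Circle) (p : M), H (z • p) = H p)
    (hcompact : ∀ v, IsCompact ((fun p => (H p, J p)) ⁻¹' {v})) :
    ∃ φ : Flow ℝ M, (∀ p, IsMIntegralCurve (I := 𝓡 4) (fun t => φ t p) XH) ∧
      ∀ γ : ℝ → M, IsMIntegralCurve (I := 𝓡 4) γ XH → ∀ t, γ t = φ t (γ 0) := by
  have hX := contDiffOn_chartField hw hH hXH
  refine exists_flow hX fun x => ?_
  refine exists_global_integralCurve hX (hcompact (H x, J x)) rfl fun γ a h0 hγ t ht => ?_
  have h00 : (0 : ℝ) ∈ Ioo (-a) a := by constructor <;> linarith [ht.1, ht.2]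
  have e1 := eq_of_mfderiv_eq_zero hH (fun p => (hXH p _).symm.trans (hw.alternating p _)) hγ ht h00
  have e2 := eq_of_mfderiv_eq_zero hJ (mfderiv_momentum_field hw hXJ hH hinv hXH) hγ ht h00
  rw [h0] at e1 e2
  rw [mem_preimage, e1, e2]
  rfl

lemma IsHamiltonianField.eq_zero_of_mfderiv (hw : IsSymplecticForm w) {f : M → ℝ}
    {X : (p : M) → TangentSpace (𝓡 4) p} (hX : IsHamiltonianField w f X) {p : M}
    (h : ∀ v, mfderiv (𝓡 4) 𝓘(ℝ, ℝ) f p v = 0) : X p = 0 :=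
  hw.nondegenerate p _ fun v => (hX p v).trans (h v)

/-- An integral curve through a zero of a Hamiltonian field is constant. -/
lemma integralCurve_eq_of_zero (hw : IsSymplecticForm w) {f : M → ℝ}
    (hf : ContMDiff (𝓡 4) 𝓘(ℝ, ℝ) ∞ f) {X : (p : M) → TangentSpace (𝓡 4) p}
    (hX : IsHamiltonianField w f X) {p : M} (hp : X p = 0) {γ : ℝ → M}
    (hγ : IsMIntegralCurve (I := 𝓡 4) γ X) (h0 : γ 0 = p) (t : ℝ) : γ t = p := by
  have hv := contMDiff_section_of_chartField (contDiffOn_chartField hw hf hX)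
  have hc : IsMIntegralCurve (I := 𝓡 4) (fun _ : ℝ => p) X := by
    intro s
    refine (hasMFDerivAt_const p s).congr_mfderiv (ContinuousLinearMap.ext fun r : ℝ => ?_)
    change (0 : TangentSpace (𝓡 4) p) = r • X p
    rw [hp, smul_zero]
  have := isMIntegralCurve_Ioo_eq_of_contMDiff_boundaryless (I := 𝓡 4)
    (t₀ := 0) hv hγ hc (h0.trans rfl)
  exact congrFun this t

/-- The toral flow of the system over a set without other critical values. -/
theorem IsFocusFocus.isToralFlow (hw : IsSymplecticForm w)
    (hH : ContMDiff (𝓡 4) 𝓘(ℝ, ℝ) ∞ H) (hJ : ContMDiff (𝓡 4) 𝓘(ℝ, ℝ) ∞ J)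
    (hXH : IsHamiltonianField w H XH) (hXJ : IsHamiltonianCircleAction w J XJ)
    (hfree : ∀ p : M, (∀ z : Circle, z • p = p) ∨ ∀ z : Circle, z • p = p → z = 1)
    (hinv : ∀ (z : Circle) (p : M), H (z • p) = H p)
    {φ : Flow ℝ M} (hφ : ∀ p, IsMIntegralCurve (I := 𝓡 4) (fun t => φ t p) XH)
    (huniq : ∀ γ : ℝ → M, IsMIntegralCurve (I := 𝓡 4) γ XH → ∀ t, γ t = φ t (γ 0))
    {pbar : M} (hff : mfderiv (𝓡 4) 𝓘(ℝ, ℝ × ℝ) (fun p => (H p, J p)) pbar = 0)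
    {V : Set (ℝ × ℝ)}
    (hreg : ∀ p, (H p, J p) ∈ V → p ≠ pbar → IsRegularPt (fun p => (H p, J p)) p) :
    (∀ z : Circle, z • pbar = pbar) ∧
      IsToralFlow φ (fun p => (H p, J p)) {p | (H p, J p) ∈ V ∧ p ≠ pbar} := by
  have := hXJ.continuousSMul
  have h0 : ∀ v, mfderiv (𝓡 4) 𝓘(ℝ, ℝ × ℝ) (fun p => (H p, J p)) pbar v = (0 : ℝ × ℝ) := fun v => by
    rw [hff]; rfl
  have hH0 := hXH.eq_zero_of_mfderiv hw (p := pbar) fun v =>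
    congrArg Prod.fst ((mfderiv_pair hH hJ pbar v).symm.trans (h0 v))
  have hJ0 := hXJ.momentum.eq_zero_of_mfderiv hw (p := pbar) fun v =>
    congrArg Prod.snd ((mfderiv_pair hH hJ pbar v).symm.trans (h0 v))
  have hz : ∀ z : Circle, z • pbar = pbar := fun z => by
    obtain ⟨t, rfl⟩ := Circle.exp_surjective z
    exact integralCurve_eq_of_zero hw hJ hXJ.momentum hJ0 (hXJ.generator pbar) (by simp) t
  exact ⟨hz, _root_.isToralFlow hw hH hJ hXH hXJ hfree hinv hφ huniq hreg
    (fun t => integralCurve_eq_of_zero hw hH hXH hH0 (hφ pbar) (φ.map_zero_apply _) t) hz⟩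

lemma exists_exp_eq_mem_Ico (z : Circle) : ∃ y ∈ Ico 0 (2 * Real.pi), Circle.exp y = z := by
  obtain ⟨y, rfl⟩ := Circle.exp_surjective z
  have hπ := Real.two_pi_pos
  refine ⟨2 * Real.pi * Int.fract (y / (2 * Real.pi)), ⟨by have := Int.fract_nonneg (y / (2 * Real.pi)); positivity,
    mul_lt_of_lt_one_right hπ (Int.fract_lt_one _)⟩, ?_⟩
  have : 2 * Real.pi * Int.fract (y / (2 * Real.pi)) = y - ⌊y / (2 * Real.pi)⌋ * (2 * Real.pi) := by
    rw [Int.fract]; field_simp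
  rw [this, Circle.exp_sub, circle_exp_eq_one_iff.2 ⟨_, rfl⟩, div_one]

/-- The monodromy number of the torus bundle over a closed path, and the variation of `phiRel`. -/
theorem IsTransitSystem.existsUnique_monodromyNumber [ContinuousSMul Circle M]
    {θ : (p : M) → TangentSpace (𝓡 4) p →L[ℝ] ℝ}
    {φ : Flow ℝ M} {F : M → ℝ × ℝ} {R : Set M} {vbar : ℝ × ℝ} {B : Set M} {D : Set (ℝ × ℝ)}
    {σ₁ σ₂ : ℝ × ℝ → M} {τB τC : ℝ × ℝ → ℝ} {ζB ζC : ℝ × ℝ → Circle}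
    (hT : IsTransitSystem φ F vbar B D σ₁ σ₂ τB τC ζB ζC)
    (ht : IsToralFlow φ F R) (hB : IsOpen B) (hinv : ∀ (z : Circle), ∀ p ∈ B, z • p ∈ B)
    (hφ : ∀ p, IsMIntegralCurve (I := 𝓡 4) (fun t => φ t p) XH)
    (huniq : ∀ γ : ℝ → M, IsMIntegralCurve (I := 𝓡 4) γ XH → ∀ t, γ t = φ t (γ 0))
    (hXJ : ∀ p : M, IsMIntegralCurve (I := 𝓡 4) (fun t : ℝ => Circle.exp t • p) XJ)
    {U P : Set M} (hθ : IsRotationForm XJ θ (U \ P))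
    (hcont : ContinuousOn (fun p => (θ p (XH p) : ℝ)) (U \ P))
    (hU : F ⁻¹' D ∩ closure B ⊆ U) (hP : F ⁻¹' D ∩ frontier B ∩ P = ∅)
    (hDo : IsOpen D) (hD : ContractibleSpace D) (hR : ∀ v ∈ D \ {vbar}, σ₁ v ∈ R)
    {Γ : ℝ → ℝ × ℝ} (hΓ : Continuous Γ) (hper : ∀ s, Γ (s + 1) = Γ s)
    (hΓD : ∀ s, Γ s ∈ D \ {vbar}) (hfin : {s ∈ Ico (0 : ℝ) 1 | Γ s ∈ F '' (P ∩ B)}.Finite) :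
    (∃! k : ℤ, IsMonodromyNumber F XH Γ k) ∧
      ∀ k : ℤ, IsMonodromyNumber F XH Γ k →
        HasVariation (fun s => phiRel F XH θ B (Γ s)) (-2 * k * Real.pi) := by
  have hζBc : Continuous fun s => ζB (Γ s) := hT.cont_ζB.comp_continuous hΓ hΓD
  have hζCc : Continuous fun v : D => ζC v := continuousOn_iff_continuous_domRestrict.1 hT.cont_ζC
  have hlpc : LocallyPathConnectedSpace D := hDo.locallyPathConnectedSpace
  set Γ' : ℝ → D := fun s => ⟨Γ s, (hΓD s).1⟩ with hΓ'
  have hΓ'c : Continuous Γ' := hΓ.subtype_mk _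
  have hΓ'p : ∀ s, Γ' (s + 1) = Γ' s := fun s => Subtype.ext (hper s)
  obtain ⟨y₁, hy₁⟩ := Circle.exp_surjective (ζC (Γ' 0))
  -- The outer holonomy lifts over the contractible disk, so along `Γ` its lift is periodic, and `Θ`
  -- and `α` below gain the same multiple of `2π`.
  obtain ⟨β, hβ, -, hβζ⟩ := exists_circle_lift hζCc (Γ' 0) y₁ hy₁
  -- Return cycles use the rotation number in `[0, 2π)`, which fixes where the lift starts.
  obtain ⟨y₀, hy₀, hy₀'⟩ := exists_exp_eq_mem_Ico (ζB (Γ 0) * ζC (Γ 0))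
  have hprod : Continuous fun s => ζB (Γ s) * ζC (Γ s) := hζBc.mul (hζCc.comp hΓ'c)
  obtain ⟨Θ, hΘ, hΘ0, hΘζ⟩ := exists_circle_lift hprod 0 y₀ hy₀'
  set α : ℝ → ℝ := fun s => Θ s - β (Γ' s) with hαdef
  have hα : Continuous α := by fun_prop
  have hαζ : ∀ s, Circle.exp (α s) = ζB (Γ s) := fun s => by
    rw [hαdef, Circle.exp_sub, hΘζ, hβζ, mul_div_cancel_right]
  obtain ⟨m, hm⟩ := exists_degree hα fun s => by rw [hαζ, hαζ, hper]
  have hvar := hT.hasVariation_phiRel ht hB hinv hφ huniq hXJ hθ hcont hU hP hD hΓ hper hΓD hfin hα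
    hαζ hm
  have hΘ1 : Θ 1 = Θ 0 + 2 * Real.pi * m := by
    have h1 := hm 0
    have h2 := hΓ'p 0
    rw [zero_add] at h1 h2
    simp only [hαdef, h2] at h1
    linarith
  have h10 : Γ 1 = Γ 0 := by have := hper 0; rwa [zero_add] at this
  have hσc : Continuous fun s => σ₁ (Γ s) := hT.cont_sec₁.comp_continuous hΓ fun s => (hΓD s).1
  have hTc : Continuous fun s => τB (Γ s) + τC (Γ s) :=
    (hT.cont_τB.comp_continuous hΓ hΓD).add (hT.cont_τC.comp_continuous hΓ fun s => (hΓD s).1)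
  have hL : ∀ s, IsPeriodLattice φ (σ₁ (Γ s)) (τB (Γ s) + τC (Γ s)) (Θ s) := fun s =>
    hT.isPeriodLattice ht hB hinv (hΓD s) (hΘζ s)
  have hex : IsMonodromyNumber F XH Γ (-m) :=
    exists_monodromyNumber ht hφ hσc hTc hΘ (by rw [h10]) (by rw [h10]) hΘ1
      (by rw [hΘ0]; exact hy₀) (fun s => hT.F_sec₁ _ (hΓD s).1) hL
  have huk : ∀ k, IsMonodromyNumber F XH Γ k → k = -m := fun k hk =>
    monodromyNumber_eq ht huniq hσc hTc hΘ (by rw [h10]) (by rw [h10]) hΘ1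
      (by rw [hΘ0]; exact hy₀) (fun s => hR _ (hΓD s)) hL
      (fun s q hq => hT.cover ht (hΓD s) hq) hk
  refine ⟨⟨-m, hex, huk⟩, fun k hk => ?_⟩
  rw [huk k hk]
  convert hvar using 1
  push_cast; ring

end Assembly

end

/-! ### Trivialisations from sections, orbits in fibres, and return times -/

noncomputable section

section Orbits

variable {M : Type*} [TopologicalSpace M] [T2Space M] [MulAction Circle M]
  [ContinuousSMul Circle M] {φ : Flow ℝ M} {F : M → ℝ × ℝ} {R : Set M}

/-- A map `(v, z, y) ↦ z • s v y` onto the part of `S` over `D` which is injective on the fibres is a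
trivialisation, if `Y` is compact. -/
theorem isTrivialOver_of_sections {Y : Type} [TopologicalSpace Y] [CompactSpace Y]
    (hF : Continuous F) (hFz : ∀ (z : Circle) p, F (z • p) = F p) {S : Set M} {D : Set (ℝ × ℝ)}
    {s : ℝ × ℝ → Y → M} (hs : ContinuousOn (fun x : (ℝ × ℝ) × Y => s x.1 x.2) (D ×ˢ univ))
    (hFs : ∀ v ∈ D, ∀ y, F (s v y) = v) (hmem : ∀ v ∈ D, ∀ y, ∀ z : Circle, z • s v y ∈ S)
    (hsurj : ∀ p ∈ S, F p ∈ D → ∃ (z : Circle) (y : Y), p = z • s (F p) y)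
    (hinj : ∀ v ∈ D, ∀ (z : Circle) (y y' : Y), z • s v y = s v y' → z = 1 ∧ y = y') :
    IsTrivialOver F S D Y := by
  have hm : ∀ x : ↥D × (Circle × Y), x.2.1 • s x.1 x.2.2 ∈ F ⁻¹' D ∩ S := fun x =>
    ⟨by rw [mem_preimage, hFz, hFs _ x.1.2]; exact x.1.2, hmem _ x.1.2 _ _⟩
  set f : ↥D × (Circle × Y) → ↥(F ⁻¹' D ∩ S) := fun x => ⟨_, hm x⟩ with hf
  have hfc : Continuous f := by
    refine Continuous.subtype_mk ?_ _
    have h1 : Continuous fun x : ↥D × (Circle × Y) => s x.1 x.2.2 :=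
      hs.comp_continuous (f := fun x : ↥D × (Circle × Y) => ((x.1 : ℝ × ℝ), x.2.2)) (by fun_prop)
        fun x => ⟨x.1.2, trivial⟩
    exact (continuous_fst.comp continuous_snd).smul h1
  set g : ↥(F ⁻¹' D ∩ S) → ↥D := fun p => ⟨F p, p.2.1⟩ with hg
  have hgc : Continuous g := (hF.comp continuous_subtype_val).subtype_mk _
  have hgf : g ∘ f = Prod.fst := by
    funext x
    exact Subtype.ext ((hFz _ _).trans (hFs _ x.1.2 _))
  -- Followed by `F` the map is the projection along the compact factor `Circle × Y`, which is
  -- proper. Hence the continuous bijection `f` is proper, so closed, and is a homeomorphism.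
  have hproper : IsProperMap f :=
    isProperMap_of_comp_of_t2 hfc hgc (by rw [hgf]; exact isProperMap_fst_of_compactSpace)
  have hfi : Function.Injective f := by
    rintro ⟨v, z, y⟩ ⟨v', z', y'⟩ he
    have hv : v = v' := by
      have := congrArg g he
      rw [← Function.comp_apply (f := g), ← Function.comp_apply (f := g), hgf] at this
      exact this
    subst hv
    have h1 : z • s v y = z' • s v y' := congrArg Subtype.val he
    obtain ⟨h2, rfl⟩ := hinj v v.2 (z'⁻¹ * z) y y' (by rw [mul_smul, h1, inv_smul_smul])
    rw [inv_mul_eq_one] at h2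
    rw [h2]
  have hfs : Function.Surjective f := by
    rintro ⟨p, hpD, hpS⟩
    obtain ⟨z, y, hp⟩ := hsurj p hpS hpD
    exact ⟨(⟨F p, hpD⟩, z, y), Subtype.ext hp.symm⟩
  let e := (Equiv.ofBijective f ⟨hfi, hfs⟩).toHomeomorphOfContinuousClosed hfc hproper.isClosedMap
  have hfe : ∀ x, f (e.symm x) = x := fun x => e.apply_symm_apply x
  refine ⟨e.symm, fun x => ?_, fun z x x' hx => ?_⟩
  · have := congrFun hgf (e.symm x)
    rw [Function.comp_apply, hfe] at this
    exact (congrArg Subtype.val this).symm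
  · have h1 : x' = f ((e.symm x).1, z * (e.symm x).2.1, (e.symm x).2.2) := by
      refine Subtype.ext ?_
      rw [hx]
      conv_lhs => rw [← hfe x]
      exact (mul_smul _ _ _).symm
    have h2 : e.symm x' = ((e.symm x).1, z * (e.symm x).2.1, (e.symm x).2.2) := by
      rw [h1]; exact e.symm_apply_apply _
    rw [h2]

namespace IsToralFlow

lemma continuous_flow (φ : Flow ℝ M) : Continuous fun x : ℝ × M => φ x.1 x.2 :=
  φ.continuous continuous_fst continuous_snd

/-- A connected set of regular points in a fibre is contained in one orbit. -/
lemma exists_eq_smul_flow (ht : IsToralFlow φ F R) {C : Set M} (hC : IsPreconnected C) (hCR : C ⊆ R)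
    (hF : ∀ p ∈ C, ∀ q ∈ C, F p = F q) {p q : M} (hp : p ∈ C) (hq : q ∈ C) :
    ∃ (x : ℝ) (z : Circle), q = z • φ x p := by
  have : PreconnectedSpace C := Subtype.preconnectedSpace hC
  set f : C → Prop := fun q => ∃ (x : ℝ) (z : Circle), (q : M) = z • φ x p with hf
  -- By `transitive`, nearby points of the set lie on a common orbit.
  have hloc : IsLocallyConstant f := by
    rw [IsLocallyConstant.iff_eventually_eq]
    intro q
    obtain ⟨N, hN, htr⟩ := ht.transitive q (hCR q.2) 1 one_pos
    have hev : ∀ᶠ q' : C in 𝓝 q, (q' : M) ∈ N := continuous_subtype_val.continuousAt.eventually hN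
    have key : ∀ a ∈ N, ∀ b ∈ N, a ∈ C → b ∈ C → (∃ (x : ℝ) (z : Circle), b = z • φ x p) →
        ∃ (x : ℝ) (z : Circle), a = z • φ x p := by
      rintro a ha b hb haC hbC ⟨x, z, hx⟩
      obtain ⟨t, z', -, h'⟩ := htr a ha b hb (hF a haC b hbC)
      refine ⟨t + x, z' * z, ?_⟩
      rw [h', hx, ht.map_smul, smul_smul, φ.map_add]
    filter_upwards [hev] with q' hq'
    have hqN := mem_of_mem_nhds hN
    exact propext ⟨key q hqN q' hq' q.2 q'.2, key q' hq' q hqN q'.2 q.2⟩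
  have h1 : f ⟨q, hq⟩ = f ⟨p, hp⟩ := hloc.apply_eq_of_preconnectedSpace _ _
  have h2 : f ⟨p, hp⟩ := ⟨0, 1, by rw [φ.map_zero_apply, one_smul]⟩
  rw [← h1] at h2
  exact h2

lemma isClosed_returns (φ : Flow ℝ M) (p q : M) : IsClosed {t : ℝ | ∃ z : Circle, φ t p = z • q} := by
  have h1 : IsClosed (range fun z : Circle => z • q) := (isCompact_range (by fun_prop)).isClosed
  have h2 : Continuous fun t => φ t p := φ.continuous continuous_id continuous_const
  convert h1.preimage h2 using 1
  ext t
  exact ⟨fun ⟨z, hz⟩ => ⟨z, hz.symm⟩, fun ⟨z, hz⟩ => ⟨z, hz.symm⟩⟩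

/-- A point whose orbit stays in a compact set of regular points is on a torus. -/
theorem exists_isPeriodLattice (ht : IsToralFlow φ F R) {K : Set M} (hK : IsCompact K) (hKR : K ⊆ R)
    {p : M} (hp : ∀ t, φ t p ∈ K) : ∃ T Θ, IsPeriodLattice φ p T Θ := by
  have hpR : p ∈ R := hKR (by simpa [φ.map_zero_apply] using hp 0)
  set A : Set ℝ := {t | ∃ z : Circle, φ t p = z • p} with hA
  -- Recurrence: two distant visits near a cluster point differ by a rotation and a short flow time,
  -- which yields a positive return time.
  obtain ⟨t₁, ht₁, ht₁A⟩ : ∃ t > 0, t ∈ A := by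
    obtain ⟨q, hq, hcl⟩ := hK.exists_mapClusterPt (f := atTop) (u := fun t : ℝ => φ t p)
      (tendsto_principal.2 (Eventually.of_forall hp))
    obtain ⟨N, hN, htr⟩ := ht.transitive q (hKR hq) 1 one_pos
    have hfr := mapClusterPt_iff_frequently.1 hcl N hN
    obtain ⟨s, -, hsN⟩ := (frequently_atTop.1 hfr) 0
    obtain ⟨t, htt, htN⟩ := (frequently_atTop.1 hfr) (s + 2)
    obtain ⟨u, z, hu, hz⟩ := htr _ htN _ hsN (by rw [ht.map_flow, ht.map_flow])
    rw [abs_lt] at hu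
    rw [← φ.map_add] at hz
    refine ⟨t - (u + s), by linarith, z, ?_⟩
    have := congrArg (φ (-(u + s))) hz
    rw [ht.map_smul, ← φ.map_add, ← φ.map_add, neg_add_cancel, φ.map_zero_apply] at this
    rw [← this]; congr 1; ring
  obtain ⟨ε, hε, hno⟩ := ht.no_return p hpR
  have hno' := hno.self_of_nhds
  have hpos : ∀ t ∈ A, 0 < t → ε < t := by
    rintro t ⟨z, hz⟩ h0
    by_contra! hle
    have := hno' t (by rwa [abs_of_pos h0]) z hz
    linarith
  -- No return happens in `(0, ε]`, so cutting at `ε` gives a closed set containing all positive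
  -- returns, whose infimum is the first.
  set A' := A ∩ Ici ε with hA'
  have hcl : IsClosed A' := (isClosed_returns φ p p).inter isClosed_Ici
  have hne : A'.Nonempty := ⟨t₁, ht₁A, (hpos _ ht₁A ht₁).le⟩
  have hbb : BddBelow A' := ⟨ε, fun t h => h.2⟩
  have hmem := hcl.csInf_mem hne hbb
  set T := sInf A' with hT
  obtain ⟨z, hz⟩ := hmem.1
  obtain ⟨Θ, rfl⟩ := Circle.exp_surjective z
  refine ⟨T, Θ, lt_of_lt_of_le hε hmem.2, hz, fun t htt z' he => ?_⟩
  have : T ≤ t := csInf_le hbb ⟨⟨z', he⟩, (hpos t ⟨z', he⟩ htt.1).le⟩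
  exact absurd this (not_le.2 htt.2)

/-- The first return time to a section is continuous. -/
theorem continuousOn_period (ht : IsToralFlow φ F R) {D : Set (ℝ × ℝ)} {σ : ℝ × ℝ → M}
    {T Θ : ℝ × ℝ → ℝ} (hσ : ContinuousOn σ D) (hR : ∀ v ∈ D, σ v ∈ R)
    (hL : ∀ v ∈ D, IsPeriodLattice φ (σ v) (T v) (Θ v)) : ContinuousOn T D := by
  intro v₀ hv₀
  rw [ContinuousWithinAt, Metric.tendsto_nhds]
  intro ε hε
  have L₀ := hL v₀ hv₀
  have hσ₀ : Tendsto σ (𝓝[D] v₀) (𝓝 (σ v₀)) := hσ v₀ hv₀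
  set z₀ := Circle.exp (Θ v₀) with hz₀
  obtain ⟨ε₀, hε₀, hno⟩ := ht.no_return _ (hR v₀ hv₀)
  set ε₁ := min ε (T v₀) with hε₁
  have hε₁0 : 0 < ε₁ := lt_min hε L₀.pos
  obtain ⟨N, hN, htr⟩ := ht.transitive _ (ht.smul_mem z₀ _ (hR v₀ hv₀)) ε₁ hε₁0
  have h1 : ∀ᶠ v in 𝓝[D] v₀, φ (T v₀) (σ v) ∈ N := by
    have hc : Continuous fun q => φ (T v₀) q := φ.continuous continuous_const continuous_id
    have := (hc.tendsto (σ v₀)).comp hσ₀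
    rw [L₀.period] at this
    exact this.eventually hN
  have h2 : ∀ᶠ v in 𝓝[D] v₀, z₀ • σ v ∈ N := by
    have hc : Continuous fun q : M => z₀ • q := continuous_const_smul z₀
    exact ((hc.tendsto (σ v₀)).comp hσ₀).eventually hN
  have h3 : ∀ᶠ v in 𝓝[D] v₀, ∀ x ∈ Icc ε₀ (T v₀ - ε) ×ˢ (univ : Set Circle),
      φ x.1 (σ v) ≠ x.2 • σ v := by
    have : ∀ᶠ q in 𝓝 (σ v₀), ∀ x ∈ Icc ε₀ (T v₀ - ε) ×ˢ (univ : Set Circle),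
        φ x.1 q ≠ x.2 • q := by
      refine (isCompact_Icc.prod isCompact_univ).eventually_forall_of_forall_eventually
        fun x hx => ?_
      have hc1 : Continuous fun y : M × ℝ × Circle => φ y.2.1 y.1 :=
        (continuous_flow φ).comp (by fun_prop : Continuous fun y : M × ℝ × Circle => (y.2.1, y.1))
      have hc2 : Continuous fun y : M × ℝ × Circle => y.2.2 • y.1 := by fun_prop
      refine (isOpen_ne_fun hc1 hc2).mem_nhds ?_
      exact L₀.first _ ⟨by linarith [hx.1.1], by linarith [hx.1.2]⟩ _
    exact hσ₀.eventually this
  filter_upwards [h1, h2, h3, hσ₀.eventually hno, self_mem_nhdsWithin] with v g1 g2 g3 g4 hv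
  have L := hL v hv
  -- The near coincidence at time `T v₀` is an exact return of `σ v` at time `T v₀ - t`; capping
  -- `ε₁` by `T v₀` keeps this time positive.
  have hup : T v < T v₀ + ε := by
    obtain ⟨t, z, hta, hz⟩ := htr _ g1 _ g2 (by rw [ht.map_flow, ht.map_action])
    have hta' := abs_lt.1 (hta.trans_le (min_le_left _ _))
    have htb := abs_lt.1 (hta.trans_le (min_le_right _ _))
    by_contra! hle
    refine L.first (-t + T v₀) ⟨by linarith [htb.2], by linarith [hta'.1]⟩ (z * z₀) ?_
    rw [φ.map_add, hz, ht.map_smul, ← φ.map_add, neg_add_cancel, φ.map_zero_apply, mul_smul]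
  have hlow : T v₀ - ε < T v := by
    by_contra! hle
    rcases le_or_gt (T v) ε₀ with h | h
    · have := g4 (T v) (by rwa [abs_of_pos L.pos]) _ L.period
      linarith [L.pos]
    · exact g3 (T v, Circle.exp (Θ v)) ⟨⟨h.le, hle⟩, trivial⟩ L.period
  rw [Real.dist_eq, abs_lt]
  constructor <;> linarith

end IsToralFlow

end Orbits

end

/-! ### Tubes of orbit segments and the complementary ball -/

noncomputable section

section Tube

variable {M : Type*} [TopologicalSpace M] [T2Space M] [MulAction Circle M]
  [ContinuousSMul Circle M] {φ : Flow ℝ M} {F : M → ℝ × ℝ} {R : Set M} {D : Set (ℝ × ℝ)}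
  {σ : ℝ × ℝ → M} {ℓ : ℝ}

/-- The section `σ` over `D` flows without return for a time longer than `ℓ`. -/
structure IsTube (φ : Flow ℝ M) (F : M → ℝ × ℝ) (R : Set M) (D : Set (ℝ × ℝ)) (σ : ℝ × ℝ → M)
    (ℓ : ℝ) : Prop where
  toral : IsToralFlow φ F R
  isOpen : IsOpen D
  cont : ContinuousOn σ D
  F_sec : ∀ v ∈ D, F (σ v) = v
  sec_mem : ∀ v ∈ D, σ v ∈ R
  pos : 0 < ℓ
  no_return : ∀ v ∈ D, ∀ t : ℝ, |t| ≤ ℓ + 1 → ∀ z : Circle, φ t (σ v) = z • σ v → t = 0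

/-- The points over `D` reached from the section `σ` in a time in `I`. -/
def tube (φ : Flow ℝ M) (F : M → ℝ × ℝ) (D : Set (ℝ × ℝ)) (σ : ℝ × ℝ → M) (I : Set ℝ) : Set M :=
  {p | F p ∈ D ∧ ∃ x ∈ I, ∃ z : Circle, p = z • φ x (σ (F p))}

lemma tube_smul_mem (ht : IsToralFlow φ F R) {I : Set ℝ} (z : Circle) {p : M}
    (hp : p ∈ tube φ F D σ I) : z • p ∈ tube φ F D σ I := by
  obtain ⟨h1, x, hx, w, hw⟩ := hp
  refine ⟨by rwa [ht.map_action], x, hx, z * w, ?_⟩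
  rw [ht.map_action, mul_smul, ← hw]

namespace IsTube

lemma mem_tube (h : IsTube φ F R D σ ℓ) {I : Set ℝ} {v : ℝ × ℝ} (hv : v ∈ D) {x : ℝ} (hx : x ∈ I)
    (z : Circle) : z • φ x (σ v) ∈ tube φ F D σ I := by
  have hF : F (z • φ x (σ v)) = v := by rw [h.toral.map_action, h.toral.map_flow, h.F_sec v hv]
  exact ⟨by rwa [hF], x, hx, z, by rw [hF]⟩

lemma tube_subset (h : IsTube φ F R D σ ℓ) {I : Set ℝ} : tube φ F D σ I ⊆ R := by
  rintro p ⟨h1, x, -, z, hz⟩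
  rw [hz]
  exact h.toral.smul_mem _ _ (h.toral.flow_mem _ _ (h.sec_mem _ h1))

/-- The margin 1 beyond the length `ℓ` makes the coordinates unique slightly past the ends too; this
is used to approach the ends from outside the tube. -/
lemma coord_unique (h : IsTube φ F R D σ ℓ) {v : ℝ × ℝ} (hv : v ∈ D) {x x' : ℝ} {z z' : Circle}
    (he : z • φ x (σ v) = z' • φ x' (σ v)) (hx : |x - x'| ≤ ℓ + 1) : x = x' ∧ z = z' := by
  have h1 : φ (x - x') (σ v) = (z⁻¹ * z') • σ v := by
    have := congrArg (fun p => z⁻¹ • φ (-x') p) he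
    simp only [h.toral.map_smul, ← φ.map_add, neg_add_cancel, φ.map_zero_apply, smul_smul,
      inv_mul_cancel, one_smul] at this
    rw [← this]; congr 1; ring
  have h2 := h.no_return v hv _ hx _ h1
  rw [h2, φ.map_zero_apply] at h1
  have h3 := h.toral.free _ (h.sec_mem v hv) _ h1.symm
  rw [inv_mul_eq_one] at h3
  exact ⟨by linarith, h3⟩

lemma continuousAt_orbit (h : IsTube φ F R D σ ℓ) {p : M} (hp : F p ∈ D) (t : ℝ)
    (z : Circle) : ContinuousAt (fun y : M × ℝ × Circle => y.2.2 • φ y.2.1 (σ (F y.1))) (p, t, z) := by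
  have h1 : ContinuousAt σ (F p) := h.cont.continuousAt (h.isOpen.mem_nhds hp)
  have h2 : ContinuousAt (fun y : M × ℝ × Circle => σ (F y.1)) (p, t, z) :=
    ContinuousAt.comp (f := fun y : M × ℝ × Circle => F y.1) h1
      (h.toral.continuous_map.comp continuous_fst).continuousAt
  have h3 : ContinuousAt (fun y : M × ℝ × Circle => φ y.2.1 (σ (F y.1))) (p, t, z) :=
    ContinuousAt.comp (f := fun y : M × ℝ × Circle => (y.2.1, σ (F y.1)))
      (IsToralFlow.continuous_flow φ).continuousAt
      ((by fun_prop : Continuous fun y : M × ℝ × Circle => y.2.1).continuousAt.prodMk h2)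
  exact (by fun_prop : Continuous fun y : M × ℝ × Circle => y.2.2).continuousAt.smul h3

lemma isOpen_base (h : IsTube φ F R D σ ℓ) : IsOpen (F ⁻¹' D) :=
  h.isOpen.preimage h.toral.continuous_map

/-- A point near `p` differs from the tube point with the coordinates of `p`, in its own fibre, by a
rotation and a time below `ε`. -/
lemma isOpen_tube (h : IsTube φ F R D σ ℓ) {I : Set ℝ} (hI : IsOpen I) : IsOpen (tube φ F D σ I) := by
  rw [isOpen_iff_mem_nhds]
  rintro p hp
  have hpR := h.tube_subset hp
  obtain ⟨hpD, x, hx, z, hz⟩ := hp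
  obtain ⟨ε, hε, hball⟩ := Metric.isOpen_iff.1 hI x hx
  obtain ⟨N, hN, htr⟩ := h.toral.transitive p hpR ε hε
  have hc : Tendsto (fun q => z • φ x (σ (F q))) (𝓝 p) (𝓝 p) := by
    have h1 := ContinuousAt.comp (f := fun q : M => (q, x, z)) (x := p)
      (h.continuousAt_orbit hpD x z) (by fun_prop)
    have h2 : Tendsto (fun q => z • φ x (σ (F q))) (𝓝 p) (𝓝 (z • φ x (σ (F p)))) := h1
    rwa [← hz] at h2
  filter_upwards [hN, hc.eventually hN, h.isOpen_base.mem_nhds hpD] with q h1 h2 h3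
  obtain ⟨t, z', ht', hq⟩ := htr q h1 _ h2 (by
    rw [h.toral.map_action, h.toral.map_flow, h.F_sec _ h3])
  refine ⟨h3, t + x, hball ?_, z' * z, ?_⟩
  · rw [Metric.mem_ball, Real.dist_eq, add_sub_cancel_right]; exact ht'
  · rw [φ.map_add, mul_smul, ← h.toral.map_smul]; exact hq

/-- The part over the base of the complement of the tube. -/
def ball (φ : Flow ℝ M) (F : M → ℝ × ℝ) (D : Set (ℝ × ℝ)) (σ : ℝ × ℝ → M) (ℓ : ℝ) : Set M :=
  F ⁻¹' D \ tube φ F D σ (Icc 0 ℓ)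

/-- For fixed `v` the closed tube is parametrised by a compact set of times and rotations, so
avoiding it is an open condition. -/
lemma isOpen_ball (h : IsTube φ F R D σ ℓ) : IsOpen (ball φ F D σ ℓ) := by
  rw [isOpen_iff_mem_nhds]
  rintro p ⟨hpD, hp⟩
  have key : ∀ᶠ q in 𝓝 p, ∀ x ∈ Icc 0 ℓ ×ˢ (univ : Set Circle), q ≠ x.2 • φ x.1 (σ (F q)) := by
    refine (isCompact_Icc.prod isCompact_univ).eventually_forall_of_forall_eventually fun x hx => ?_
    have hne : p ≠ x.2 • φ x.1 (σ (F p)) := fun he => hp ⟨hpD, x.1, hx.1, x.2, he⟩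
    have h1 : ContinuousAt (fun y : M × ℝ × Circle => y.1) (p, x) := by fun_prop
    have h2 : ContinuousAt (fun y : M × ℝ × Circle => y.2.2 • φ y.2.1 (σ (F y.1))) (p, x) :=
      h.continuousAt_orbit hpD x.1 x.2
    exact (h1.prodMk h2).eventually ((isOpen_ne_fun continuous_fst continuous_snd).mem_nhds hne)
  filter_upwards [key, h.isOpen_base.mem_nhds hpD] with q h1 h2
  exact ⟨h2, fun ⟨_, x, hx, z, hz⟩ => h1 (x, z) ⟨hx, trivial⟩ hz⟩

lemma mem_closure_ball_iff (h : IsTube φ F R D σ ℓ) {p : M} (hp : F p ∈ D) :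
    p ∈ closure (ball φ F D σ ℓ) ↔ p ∉ tube φ F D σ (Ioo 0 ℓ) := by
  constructor
  · intro hcl hT
    obtain ⟨q, hq, hqB⟩ := mem_closure_iff.1 hcl _ (h.isOpen_tube isOpen_Ioo) hT
    obtain ⟨h1, x, hx, z, hz⟩ := hq
    exact hqB.2 ⟨h1, x, Ioo_subset_Icc_self hx, z, hz⟩
  · intro hT
    by_cases hc : p ∈ tube φ F D σ (Icc 0 ℓ)
    · obtain ⟨-, x, hx, z, hz⟩ := hc
      -- an end of the tube is the limit of points just beyond it
      have hlim : ∀ s : ℝ, (s = -1 ∧ x = 0 ∨ s = 1 ∧ x = ℓ) → p ∈ closure (ball φ F D σ ℓ) := by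
        intro s hs
        have hc : Continuous fun ε : ℝ => z • φ (x + s * ε) (σ (F p)) :=
          (φ.continuous (by fun_prop) continuous_const).const_smul z
        have htend : Tendsto (fun ε : ℝ => z • φ (x + s * ε) (σ (F p))) (𝓝[>] 0) (𝓝 p) := by
          have := hc.tendsto 0
          rw [mul_zero, add_zero, ← hz] at this
          exact this.mono_left nhdsWithin_le_nhds
        refine mem_closure_of_tendsto htend ?_
        filter_upwards [Ioo_mem_nhdsGT (zero_lt_one' ℝ)] with ε hε
        have hFq : F (z • φ (x + s * ε) (σ (F p))) = F p := by
          rw [h.toral.map_action, h.toral.map_flow, h.F_sec _ hp]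
        refine ⟨by rwa [mem_preimage, hFq], fun ⟨_, y, hy, z', hz'⟩ => ?_⟩
        rw [hFq] at hz'
        have := (h.coord_unique hp hz' (by
          have := h.pos
          rw [abs_le]
          rcases hs with ⟨rfl, rfl⟩ | ⟨rfl, rfl⟩ <;> constructor <;>
            linarith [hy.1, hy.2, hε.1, hε.2])).1
        rcases hs with ⟨rfl, rfl⟩ | ⟨rfl, rfl⟩ <;> linarith [hy.1, hy.2, hε.1, hε.2]
      rcases eq_or_lt_of_le hx.1 with h0 | h0
      · exact hlim (-1) (Or.inl ⟨rfl, h0.symm⟩)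
      rcases eq_or_lt_of_le hx.2 with h1 | h1
      · exact hlim 1 (Or.inr ⟨rfl, h1⟩)
      exact absurd ⟨hp, x, ⟨h0, h1⟩, z, hz⟩ hT
    · exact subset_closure ⟨hp, hc⟩

lemma mem_frontier_ball_iff (h : IsTube φ F R D σ ℓ) {p : M} (hp : F p ∈ D) :
    p ∈ frontier (ball φ F D σ ℓ) ↔ p ∈ tube φ F D σ {0, ℓ} := by
  rw [h.isOpen_ball.frontier_eq, Set.mem_sdiff, h.mem_closure_ball_iff hp]
  constructor
  · rintro ⟨h1, h2⟩
    have h3 : p ∈ tube φ F D σ (Icc 0 ℓ) := by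
      by_contra hn; exact h2 ⟨hp, hn⟩
    obtain ⟨-, x, hx, z, hz⟩ := h3
    refine ⟨hp, x, ?_, z, hz⟩
    by_contra hne
    rw [mem_insert_iff, mem_singleton_iff, not_or] at hne
    exact h1 ⟨hp, x, ⟨lt_of_le_of_ne hx.1 (Ne.symm hne.1), lt_of_le_of_ne hx.2 hne.2⟩, z, hz⟩
  · rintro ⟨-, x, hx, z, hz⟩
    have hx' : x ∈ Icc 0 ℓ := by
      have := h.pos
      rcases hx with rfl | rfl
      · exact ⟨le_rfl, this.le⟩
      · exact ⟨this.le, le_rfl⟩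
    refine ⟨fun ⟨_, y, hy, z', hz'⟩ => ?_, fun hb => hb.2 ⟨hp, x, hx', z, hz⟩⟩
    have := (h.coord_unique hp (hz.symm.trans hz') (by
      rw [abs_le]; constructor <;> linarith [hx'.1, hx'.2, hy.1, hy.2])).1
    rcases hx with rfl | rfl
    · linarith [hy.1]
    · linarith [hy.2]

lemma continuousOn_sections (h : IsTube φ F R D σ ℓ) {Y : Type} [TopologicalSpace Y]
    {D' : Set (ℝ × ℝ)} (hD' : D' ⊆ D) {x : ℝ × ℝ → Y → ℝ}
    (hx : ContinuousOn (fun y : (ℝ × ℝ) × Y => x y.1 y.2) (D' ×ˢ univ)) :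
    ContinuousOn (fun y : (ℝ × ℝ) × Y => φ (x y.1 y.2) (σ y.1)) (D' ×ˢ univ) := by
  refine (IsToralFlow.continuous_flow φ).comp_continuousOn (hx.prodMk ?_)
  exact (h.cont.mono hD').comp continuousOn_fst fun y hy => hy.1

theorem isTrivialOver_frontier (h : IsTube φ F R D σ ℓ) :
    IsTrivialOver F (frontier (ball φ F D σ ℓ)) D Bool := by
  have hb : ∀ b : Bool, (if b then ℓ else 0) ∈ ({0, ℓ} : Set ℝ) := by
    intro b; cases b <;> simp
  refine isTrivialOver_of_sections h.toral.continuous_map h.toral.map_action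
    (s := fun v b => φ (if b then ℓ else 0) (σ v))
    (h.continuousOn_sections (x := fun _ (b : Bool) => if b then ℓ else 0) subset_rfl ?_) ?_ ?_ ?_ ?_
  · have : Continuous fun b : Bool => if b then ℓ else 0 := continuous_of_discreteTopology
    exact (this.comp continuous_snd).continuousOn
  · intro v hv b
    rw [h.toral.map_flow, h.F_sec v hv]
  · intro v hv b z
    rw [h.mem_frontier_ball_iff (by rw [h.toral.map_action, h.toral.map_flow, h.F_sec v hv]; exact hv)]
    exact h.mem_tube hv (hb b) z
  · intro p hp hpD
    rw [h.mem_frontier_ball_iff hpD] at hp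
    obtain ⟨-, x, hx, z, hz⟩ := hp
    rcases hx with rfl | rfl
    · exact ⟨z, false, hz⟩
    · exact ⟨z, true, hz⟩
  · intro v hv z b b' he
    have hpos := h.pos
    have := h.coord_unique hv (he.trans (one_smul Circle _).symm) (by
      cases b <;> cases b' <;> simp [abs_of_pos hpos] <;> linarith)
    refine ⟨this.2, ?_⟩
    have h1 := this.1
    cases b <;> cases b' <;> simp at h1 ⊢ <;> linarith

theorem isTrivialOver_compl (h : IsTube φ F R D σ ℓ) :
    IsTrivialOver F (ball φ F D σ ℓ)ᶜ D unitInterval := by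
  have hpos := h.pos
  have hr : ∀ r : unitInterval, (r : ℝ) * ℓ ∈ Icc 0 ℓ := fun r =>
    ⟨mul_nonneg r.2.1 hpos.le, mul_le_of_le_one_left hpos.le r.2.2⟩
  refine isTrivialOver_of_sections h.toral.continuous_map h.toral.map_action
    (s := fun v r => φ (r * ℓ) (σ v))
    (h.continuousOn_sections (x := fun _ (r : unitInterval) => (r : ℝ) * ℓ) subset_rfl ?_) ?_ ?_ ?_ ?_
  · exact (by fun_prop : Continuous fun y : (ℝ × ℝ) × unitInterval => (y.2 : ℝ) * ℓ).continuousOn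
  · intro v hv r
    rw [h.toral.map_flow, h.F_sec v hv]
  · intro v hv r z hb
    exact hb.2 (h.mem_tube hv (hr r) z)
  · intro p hp hpD
    have h3 : p ∈ tube φ F D σ (Icc 0 ℓ) := by
      by_contra hn; exact hp ⟨hpD, hn⟩
    obtain ⟨-, x, hx, z, hz⟩ := h3
    refine ⟨z, ⟨x / ℓ, div_nonneg hx.1 hpos.le, div_le_one_of_le₀ hx.2 hpos.le⟩, ?_⟩
    simp only [div_mul_cancel₀ _ hpos.ne']
    exact hz
  · intro v hv z r r' he
    have := h.coord_unique hv (he.trans (one_smul Circle _).symm) (by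
      rw [abs_le]; constructor <;> linarith [(hr r).1, (hr r).2, (hr r').1, (hr r').2])
    exact ⟨this.2, Subtype.ext (mul_right_cancel₀ hpos.ne' this.1)⟩

/-- A fibre over `D'` is a torus of period `T v`, and without the times in `(0, ℓ)` there remain
those in `[ℓ, T v]`, rescaled to the unit interval. The margin in `no_return` gives `T v > ℓ + 1`,
so the interval does not degenerate. -/
theorem isTrivialOver_closure (h : IsTube φ F R D σ ℓ) {D' : Set (ℝ × ℝ)} (hD' : D' ⊆ D)
    (hcompact : ∀ v ∈ D', IsCompact (F ⁻¹' {v})) (hconn : ∀ v ∈ D', IsPreconnected (F ⁻¹' {v}))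
    (hR : ∀ v ∈ D', F ⁻¹' {v} ⊆ R) :
    IsTrivialOver F (closure (ball φ F D σ ℓ)) D' unitInterval := by
  have hpos := h.pos
  choose! T Θ hL using fun v (hv : v ∈ D') =>
    h.toral.exists_isPeriodLattice (hcompact v hv) (hR v hv) (p := σ v) fun t => by
      rw [mem_preimage, h.toral.map_flow, h.F_sec v (hD' hv)]; rfl
  have hTc : ContinuousOn T D' := h.toral.continuousOn_period (h.cont.mono hD')
    (fun v hv => h.sec_mem v (hD' hv)) hL
  have hTℓ : ∀ v ∈ D', ℓ + 1 < T v := by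
    intro v hv
    by_contra! hle
    have hT0 := (hL v hv).pos
    have := h.no_return v (hD' hv) (T v) (by rwa [abs_of_pos hT0]) _ (hL v hv).period
    linarith
  set x : ℝ × ℝ → unitInterval → ℝ := fun v r => ℓ + r * (T v - ℓ) with hx
  have hxm : ∀ v ∈ D', ∀ r, x v r ∈ Icc ℓ (T v) := fun v hv r => by
    have h1 := hTℓ v hv
    constructor
    · have := mul_nonneg r.2.1 (show 0 ≤ T v - ℓ by linarith)
      simp only [hx]; linarith
    · have := mul_le_of_le_one_left (show 0 ≤ T v - ℓ by linarith) r.2.2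
      simp only [hx]; linarith
  refine isTrivialOver_of_sections h.toral.continuous_map h.toral.map_action
    (s := fun v r => φ (x v r) (σ v)) (h.continuousOn_sections (x := x) hD' ?_) ?_ ?_ ?_ ?_
  · have h1 : ContinuousOn (fun y : (ℝ × ℝ) × unitInterval => T y.1) (D' ×ˢ univ) :=
      hTc.comp continuousOn_fst fun y hy => hy.1
    have h2 : Continuous fun y : (ℝ × ℝ) × unitInterval => (y.2 : ℝ) := by fun_prop
    exact continuousOn_const.add (h2.continuousOn.mul (h1.sub continuousOn_const))
  · intro v hv r
    rw [h.toral.map_flow, h.F_sec v (hD' hv)]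
  · intro v hv r z
    have hF : F (z • φ (x v r) (σ v)) = v := by
      rw [h.toral.map_action, h.toral.map_flow, h.F_sec v (hD' hv)]
    rw [h.mem_closure_ball_iff (by rw [hF]; exact hD' hv)]
    rintro ⟨-, y, hy, z', hz'⟩
    rw [hF] at hz'
    have h1 : φ (x v r - y) (σ v) = (z⁻¹ * z') • σ v := by
      have := congrArg (fun p => z⁻¹ • φ (-y) p) hz'
      simp only [h.toral.map_smul, ← φ.map_add, neg_add_cancel, φ.map_zero_apply, smul_smul,
        inv_mul_cancel, one_smul] at this
      rw [← this]; congr 1; ring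
    have h2 := hxm v hv r
    exact (hL v hv).first _ ⟨by linarith [hy.2, h2.1], by linarith [hy.1, h2.2]⟩ _ h1
  · intro p hp hpD
    set v := F p with hv
    rw [h.mem_closure_ball_iff (hD' hpD)] at hp
    have hL' := hL v hpD
    have hT0 := hL'.pos
    have hTv := hTℓ v hpD
    have hσv : σ v ∈ F ⁻¹' {v} := h.F_sec v (hD' hpD)
    obtain ⟨y, z, hz⟩ := h.toral.exists_eq_smul_flow (hconn v hpD) (hR v hpD)
      (fun a ha b hb => (mem_singleton_iff.1 ha).trans (mem_singleton_iff.1 hb).symm)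
      hσv (rfl : p ∈ F ⁻¹' {v})
    -- reduce the time modulo the period
    obtain ⟨y', hy', z', hz'⟩ : ∃ y' ∈ Icc ℓ (T v), ∃ z' : Circle, p = z' • φ y' (σ v) := by
      set n := ⌊y / T v⌋
      have hfr : y - n * T v = Int.fract (y / T v) * T v := by
        rw [Int.fract]; field_simp; ring
      have h0 : 0 ≤ y - n * T v := by
        rw [hfr]; exact mul_nonneg (Int.fract_nonneg _) hT0.le
      have h1 : y - n * T v < T v := by
        rw [hfr]; exact mul_lt_of_lt_one_left hT0 (Int.fract_lt_one _)
      have hp' : p = (z * Circle.exp (n * Θ v)) • φ (y - n * T v) (σ v) := by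
        rw [mul_smul, ← h.toral.map_smul, ← hL'.period_int h.toral, ← φ.map_add, sub_add_cancel]
        exact hz
      -- A remainder 0 is replaced by `T v`, and one in `(0, ℓ)` is impossible because `p` is not in
      -- the open tube.
      rcases eq_or_lt_of_le h0 with h2 | h2
      · refine ⟨T v, ⟨by linarith, le_rfl⟩, z * Circle.exp (n * Θ v) * (Circle.exp (Θ v))⁻¹, ?_⟩
        rw [mul_smul _ (Circle.exp (Θ v))⁻¹, hL'.period, inv_smul_smul, hp', ← h2, φ.map_zero_apply]
      · refine ⟨y - n * T v, ⟨?_, h1.le⟩, _, hp'⟩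
        by_contra! hlt
        exact hp ⟨hD' hpD, _, ⟨h2, hlt⟩, _, hp'⟩
    have hTℓ' : 0 < T v - ℓ := by linarith
    refine ⟨z', ⟨(y' - ℓ) / (T v - ℓ), div_nonneg (by linarith [hy'.1]) hTℓ'.le,
      div_le_one_of_le₀ (by linarith [hy'.2]) hTℓ'.le⟩, ?_⟩
    simp only [hx, div_mul_cancel₀ _ hTℓ'.ne', add_sub_cancel]
    exact hz'
  · intro v hv z r r' he
    have hL' := hL v hv
    have hTv := hTℓ v hv
    have key : ∀ (r r' : unitInterval) (z : Circle), z • φ (x v r) (σ v) = φ (x v r') (σ v) →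
        ¬ x v r' < x v r := by
      intro r r' z he hlt
      have h1 : φ (x v r - x v r') (σ v) = z⁻¹ • σ v := by
        have := congrArg (fun p => z⁻¹ • φ (-(x v r')) p) he
        simp only [h.toral.map_smul, ← φ.map_add, neg_add_cancel, φ.map_zero_apply, smul_smul,
          inv_mul_cancel, one_smul] at this
        rw [← this]; congr 1; ring
      exact hL'.first _ ⟨by linarith, by linarith [(hxm v hv r).2, (hxm v hv r').1]⟩ _ h1
    have h1 : x v r = x v r' := by
      rcases lt_trichotomy (x v r) (x v r') with h' | h' | h'
      · refine absurd h' (key r' r z⁻¹ ?_)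
        rw [← he, inv_smul_smul]
      · exact h'
      · exact absurd h' (key r r' z he)
    refine ⟨?_, ?_⟩
    · rw [h1] at he
      exact h.toral.free _ (h.toral.flow_mem _ _ (h.sec_mem v (hD' hv))) _ he
    · have h2 : (r : ℝ) * (T v - ℓ) = r' * (T v - ℓ) := by simp only [hx] at h1; linarith
      exact Subtype.ext (mul_right_cancel₀ (by linarith) h2)

/-- The complement of a tube in a neighbourhood of the pinched fibre gives a local pair. -/
theorem isLocalPair [ChartedSpace E4 M] (h : IsTube φ F R D σ ℓ) {pbar : M} (hpbar : F pbar ∈ D)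
    (hpR : pbar ∉ R) (hR : ∀ p, F p ∈ D → p ≠ pbar → p ∈ R) (hD : ContractibleSpace D)
    (hreg : ∀ p, F p ∈ D → p ≠ pbar → IsRegularPt F p)
    (hcompact : ∀ v, IsCompact (F ⁻¹' {v})) (hconn : ∀ v, IsPreconnected (F ⁻¹' {v})) :
    IsLocalPair F pbar (ball φ F D σ ℓ) D where
  isOpen_ball := h.isOpen_ball
  mem_ball := ⟨hpbar, fun hp => hpR (h.tube_subset hp)⟩
  invariant z p hp := by
    refine ⟨by rw [mem_preimage, h.toral.map_action]; exact hp.1, fun hz => hp.2 ?_⟩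
    have := tube_smul_mem h.toral z⁻¹ hz
    rwa [inv_smul_smul] at this
  isOpen_disk := h.isOpen
  mem_disk := hpbar
  contractible_disk := hD
  regular := hreg
  boundary := h.isTrivialOver_frontier
  complement := h.isTrivialOver_compl
  inside := h.isTrivialOver_closure sdiff_subset (fun v _ => hcompact v) (fun v _ => hconn v)
    fun v hv p hp => hR p (by rw [mem_singleton_iff.1 hp]; exact hv.1) fun he => hv.2 (by
      rw [← mem_singleton_iff.1 hp, he]; rfl)

end IsTube

end Tube

end

/-! ### The pinched fibre as a single orbit without returns -/

noncomputable section

section PinchedFibre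

variable {M : Type*} [TopologicalSpace M] [T2Space M] [MulAction Circle M]
  [ContinuousSMul Circle M] {φ : Flow ℝ M} {F : M → ℝ × ℝ} {R : Set M}

namespace IsToralFlow

/-- The return times of a point to its own circle orbit. -/
def returnGroup (ht : IsToralFlow φ F R) (p : M) : AddSubgroup ℝ where
  carrier := {t | ∃ z : Circle, φ t p = z • p}
  zero_mem' := ⟨1, by rw [φ.map_zero_apply, one_smul]⟩
  add_mem' := by
    rintro a b ⟨z, hz⟩ ⟨z', hz'⟩
    exact ⟨z' * z, by rw [φ.map_add, hz', ht.map_smul, hz, smul_smul]⟩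
  neg_mem' := by
    rintro a ⟨z, hz⟩
    refine ⟨z⁻¹, ?_⟩
    have := congrArg (fun q => z⁻¹ • φ (-a) q) hz
    simp only [ht.map_smul, ← φ.map_add, neg_add_cancel, φ.map_zero_apply, inv_smul_smul] at this
    exact this.symm

/-- The orbit of a point that returns to its circle orbit is compact. -/
lemma isCompact_orbit (ht : IsToralFlow φ F R) {p : M} {x : ℝ} (hx : 0 < x)
    (hxp : x ∈ ht.returnGroup p) : IsCompact {q | ∃ (y : ℝ) (z : Circle), q = z • φ y p} := by
  have h : {q | ∃ (y : ℝ) (z : Circle), q = z • φ y p}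
      = (fun a : ℝ × Circle => a.2 • φ a.1 p) '' (Icc 0 x ×ˢ univ) := by
    ext q
    constructor
    · rintro ⟨y, z, rfl⟩
      obtain ⟨w, hw⟩ := (ht.returnGroup p).zsmul_mem hxp ⌊y / x⌋
      rw [zsmul_eq_mul] at hw
      have hfr : y - ⌊y / x⌋ * x = Int.fract (y / x) * x := by
        rw [Int.fract]; field_simp
      refine ⟨(y - ⌊y / x⌋ * x, z * w), ⟨⟨?_, ?_⟩, trivial⟩, ?_⟩
      · rw [hfr]; exact mul_nonneg (Int.fract_nonneg _) hx.le
      · rw [hfr]; exact mul_le_of_le_one_left hx.le (Int.fract_lt_one _).le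
      · show (z * w) • φ (y - ⌊y / x⌋ * x) p = z • φ y p
        rw [mul_smul, ← ht.map_smul, ← hw, ← φ.map_add, sub_add_cancel]
    · rintro ⟨a, -, rfl⟩
      exact ⟨a.1, a.2, rfl⟩
  rw [h]
  have hc : Continuous fun a : ℝ × Circle => a.2 • φ a.1 p :=
    continuous_snd.smul (φ.continuous continuous_fst continuous_const)
  exact (isCompact_Icc.prod isCompact_univ).image hc

/-- A cylinder of regular points in a fibre is a single orbit, along which no point returns. -/
theorem exists_orbit_of_cylinder (ht : IsToralFlow φ F R) {C : Set M} (hCR : C ⊆ R)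
    (hF : ∀ p ∈ C, ∀ q ∈ C, F p = F q) (hCφ : ∀ p ∈ C, ∀ (x : ℝ) (z : Circle), z • φ x p ∈ C)
    (e : C ≃ₜ Circle × Ioo (0 : ℝ) 1) :
    ∃ p ∈ C, (∀ q ∈ C, ∃ (x : ℝ) (z : Circle), q = z • φ x p) ∧
      ∀ (x : ℝ) (z : Circle), φ x p = z • p → x = 0 := by
  have : PreconnectedSpace Circle :=
    ⟨by rw [← Circle.exp_surjective.range_eq]; exact isPreconnected_range Circle.exp.continuous⟩
  have : PreconnectedSpace (Ioo (0 : ℝ) 1) := Subtype.preconnectedSpace isPreconnected_Ioo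
  have hC : IsPreconnected C := by
    have h1 : IsPreconnected (range (fun x => (e.symm x : M))) :=
      isPreconnected_range (continuous_subtype_val.comp e.symm.continuous)
    have h2 : range (fun x => (e.symm x : M)) = C := by
      rw [show (fun x => (e.symm x : M)) = Subtype.val ∘ e.symm from rfl,
        e.symm.surjective.range_comp, Subtype.range_coe]
    rwa [h2] at h1
  have hncomp : ¬ IsCompact C := by
    intro hK
    have := isCompact_iff_compactSpace.1 hK
    have h1 : IsCompact (range fun c : C => ((e c).2 : ℝ)) := isCompact_range (by fun_prop)
    have h2 : range (fun c : C => ((e c).2 : ℝ)) = Ioo 0 1 := by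
      ext r
      refine ⟨?_, fun hr => ⟨e.symm (1, ⟨r, hr⟩), by simp⟩⟩
      rintro ⟨c, rfl⟩
      exact (e c).2.2
    rw [h2] at h1
    have h3 := h1.isClosed.closure_eq
    rw [closure_Ioo zero_ne_one] at h3
    exact absurd (h3 ▸ left_mem_Icc.2 zero_le_one : (0 : ℝ) ∈ Ioo (0 : ℝ) 1) (by simp)
  obtain ⟨p, hp⟩ : C.Nonempty := ⟨_, (e.symm (1, ⟨1 / 2, by norm_num, by norm_num⟩)).2⟩
  have horb : ∀ q ∈ C, ∃ (x : ℝ) (z : Circle), q = z • φ x p := fun q hq =>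
    ht.exists_eq_smul_flow hC hCR hF hp hq
  refine ⟨p, hp, horb, fun x z hxz => ?_⟩
  have hx : x ∈ ht.returnGroup p := ⟨z, hxz⟩
  by_contra hne
  -- A return at a nonzero time would make the orbit, which is all of `C`, compact.
  apply hncomp
  have h : C = {q | ∃ (y : ℝ) (z : Circle), q = z • φ y p} := by
    ext q
    refine ⟨horb q, ?_⟩
    rintro ⟨y, z, rfl⟩
    exact hCφ p hp y z
  rw [h]
  rcases lt_or_gt_of_ne hne with h0 | h0
  · exact ht.isCompact_orbit (neg_pos.2 h0) ((ht.returnGroup p).neg_mem hx)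
  · exact ht.isCompact_orbit h0 hx

/-- Along an orbit without returns, the time is bounded on a compact set of regular points. -/
lemma exists_time_bound (ht : IsToralFlow φ F R) {p : M}
    (hno : ∀ (x : ℝ) (z : Circle), φ x p = z • p → x = 0) {K : Set M} (hK : IsCompact K)
    (hKR : K ⊆ R) (hKp : ∀ q ∈ K, ∃ (x : ℝ) (z : Circle), q = z • φ x p) :
    ∃ N > 0, ∀ q ∈ K, ∀ (x : ℝ) (z : Circle), q = z • φ x p → |x| ≤ N := by
  refine hK.induction_on (p := fun s => ∃ N > 0, ∀ q ∈ s, ∀ (x : ℝ) (z : Circle), q = z • φ x p → |x| ≤ N)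
    ⟨1, one_pos, fun q hq => hq.elim⟩ ?_ ?_ ?_
  · rintro s t hst ⟨N, hN, h⟩
    exact ⟨N, hN, fun q hq => h q (hst hq)⟩
  · rintro s t ⟨N, hN, h⟩ ⟨N', -, h'⟩
    refine ⟨max N N', lt_max_of_lt_left hN, ?_⟩
    rintro q (hq | hq) x z hx
    · exact (h q hq x z hx).trans (le_max_left _ _)
    · exact (h' q hq x z hx).trans (le_max_right _ _)
  · intro q hq
    obtain ⟨x₀, z₀, h0⟩ := hKp q hq
    obtain ⟨N, hN, htr⟩ := ht.transitive q (hKR hq) 1 one_pos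
    refine ⟨N, mem_nhdsWithin_of_mem_nhds hN, |x₀| + 1, by positivity, fun q' hq' x z hx => ?_⟩
    obtain ⟨t, w, hta, hw⟩ := htr q' hq' q (mem_of_mem_nhds hN) (by
      rw [hx, h0, ht.map_action, ht.map_action, ht.map_flow, ht.map_flow])
    -- Points near `q` are reached from `p` at a time within 1 of `x₀`, and there is no other such
    -- time because the orbit has no returns.
    have h1 : φ (x - (t + x₀)) p = (z⁻¹ * (w * z₀)) • p := by
      have h2 : z • φ x p = (w * z₀) • φ (t + x₀) p := by
        rw [← hx, hw, φ.map_add, mul_smul, ← ht.map_smul t z₀, ← h0]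
      have := congrArg (fun q => z⁻¹ • φ (-(t + x₀)) q) h2
      simp only [ht.map_smul, ← φ.map_add, neg_add_cancel, φ.map_zero_apply, smul_smul,
        inv_mul_cancel, one_smul] at this
      rw [← this]; congr 1; ring
    have h2 := hno _ _ h1
    have h3 : x = t + x₀ := by linarith
    rw [h3]
    linarith [abs_add_le t x₀]

/-- A section near an orbit without returns flows without return for a given time. -/
lemma eventually_no_return (ht : IsToralFlow φ F R) {p : M} (hp : p ∈ R)
    (hno : ∀ (x : ℝ) (z : Circle), φ x p = z • p → x = 0) (ℓ : ℝ) :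
    ∀ᶠ q in 𝓝 p, ∀ t : ℝ, |t| ≤ ℓ → ∀ z : Circle, φ t q = z • q → t = 0 := by
  obtain ⟨ε, hε, hev⟩ := ht.no_return p hp
  have hKc : IsCompact (Icc (-ℓ) (-ε) ∪ Icc ε ℓ) := isCompact_Icc.union isCompact_Icc
  have hfar : ∀ᶠ q in 𝓝 p, ∀ x ∈ (Icc (-ℓ) (-ε) ∪ Icc ε ℓ) ×ˢ (univ : Set Circle),
      φ x.1 q ≠ x.2 • q := by
    refine (hKc.prod isCompact_univ).eventually_forall_of_forall_eventually fun x hx => ?_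
    have hc1 : Continuous fun y : M × ℝ × Circle => φ y.2.1 y.1 :=
      (continuous_flow φ).comp (by fun_prop : Continuous fun y : M × ℝ × Circle => (y.2.1, y.1))
    have hc2 : Continuous fun y : M × ℝ × Circle => y.2.2 • y.1 := by fun_prop
    refine (isOpen_ne_fun hc1 hc2).mem_nhds fun he => ?_
    have h0 := hno _ _ he
    rcases hx.1 with h | h
    · linarith [h.2]
    · linarith [h.1]
  filter_upwards [hev, hfar] with q h1 h2 t ht' z hz
  rcases le_or_gt |t| ε with h | h
  · exact h1 t h z hz
  · refine absurd hz (h2 (t, z) ⟨?_, trivial⟩)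
    rw [abs_le] at ht'
    rcases lt_abs.1 h with h | h
    · exact Or.inr ⟨h.le, ht'.2⟩
    · exact Or.inl ⟨ht'.1, by linarith⟩

end IsToralFlow

lemma IsTube.mono {D D' : Set (ℝ × ℝ)} {σ : ℝ × ℝ → M} {ℓ : ℝ} (h : IsTube φ F R D σ ℓ)
    (hD : D' ⊆ D) (hD' : IsOpen D') : IsTube φ F R D' σ ℓ where
  toral := h.toral
  isOpen := hD'
  cont := h.cont.mono hD
  F_sec v hv := h.F_sec v (hD hv)
  sec_mem v hv := h.sec_mem v (hD hv)
  pos := h.pos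
  no_return v hv := h.no_return v (hD hv)

/-- Connected fibres near a compact fibre are contained in a given neighbourhood of it. -/
lemma eventually_fibre_subset [LocallyCompactSpace M] (hF : Continuous F) {v₀ : ℝ × ℝ}
    (hcompact : IsCompact (F ⁻¹' {v₀})) (hconn : ∀ v, IsPreconnected (F ⁻¹' {v}))
    {σ : ℝ × ℝ → M} (hσ : ContinuousAt σ v₀) (hFσ : ∀ᶠ v in 𝓝 v₀, F (σ v) = v)
    {G : Set M} (hG : IsOpen G) (hG₀ : F ⁻¹' {v₀} ⊆ G) :
    ∀ᶠ v in 𝓝 v₀, F ⁻¹' {v} ⊆ G := by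
  -- A fibre close to the given one meets `G'` at `σ v` and misses its compact frontier, so being
  -- connected it stays in `G'`.
  obtain ⟨G', hG'o, hG'₀, hG'c, hcomp⟩ := exists_open_between_and_isCompact_closure hcompact hG hG₀
  have hfc : IsCompact (F '' frontier G') :=
    (hcomp.of_isClosed_subset isClosed_frontier frontier_subset_closure).image hF
  have h1 : ∀ᶠ v in 𝓝 v₀, v ∉ F '' frontier G' := by
    refine hfc.isClosed.isOpen_compl.mem_nhds ?_
    rintro ⟨q, hq, hq'⟩
    rw [hG'o.frontier_eq] at hq
    exact hq.2 (hG'₀ hq')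
  have h2 : ∀ᶠ v in 𝓝 v₀, σ v ∈ G' :=
    hσ.eventually (hG'o.mem_nhds (hG'₀ hFσ.self_of_nhds))
  filter_upwards [h1, h2, hFσ] with v g1 g2 g3
  intro q hq
  by_contra hn
  obtain ⟨r, -, hr, hr'⟩ := hconn v G' (closure G')ᶜ hG'o isClosed_closure.isOpen_compl
    (fun r hr => by
      by_contra hr'
      rw [mem_union, not_or, notMem_compl_iff] at hr'
      exact g1 ⟨r, by rw [hG'o.frontier_eq]; exact ⟨hr'.2, hr'.1⟩, hr⟩)
    ⟨σ v, g3, g2⟩ ⟨q, hq, fun hc => hn (hG'c hc)⟩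
  exact hr' (subset_closure hr)

/-- A section through an orbit without returns, which leaves an open set of a pinched fibre after
its start and comes back before its end, defines a tube over a small disk. -/
theorem exists_isTube [LocallyCompactSpace M] (ht : IsToralFlow φ F R) {v₀ : ℝ × ℝ}
    (hcompact : IsCompact (F ⁻¹' {v₀})) (hconn : ∀ v, IsPreconnected (F ⁻¹' {v}))
    {σ : ℝ × ℝ → M} {V : Set (ℝ × ℝ)} (hV : V ∈ 𝓝 v₀) (hσ : ContinuousOn σ V)
    (hFσ : ∀ v ∈ V, F (σ v) = v) (hσR : ∀ v ∈ V, σ v ∈ R)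
    (hno : ∀ (x : ℝ) (z : Circle), φ x (σ v₀) = z • σ v₀ → x = 0) {ℓ : ℝ} (hℓ : 0 < ℓ)
    {W S : Set M} (hW : IsOpen W) (hWσ : ∀ q, F q = v₀ → q ∉ W →
      ∃ x ∈ Ioo 0 ℓ, ∃ z : Circle, q = z • φ x (σ v₀))
    (hS : IsOpen S) (hS₀ : σ v₀ ∈ S) (hSℓ : φ ℓ (σ v₀) ∈ S) :
    ∃ r > 0, Metric.ball v₀ r ⊆ V ∧ IsTube φ F R (Metric.ball v₀ r) σ ℓ ∧
      (∀ q, F q ∈ Metric.ball v₀ r → q ∉ W → q ∈ tube φ F (Metric.ball v₀ r) σ (Ioo 0 ℓ)) ∧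
      ∀ v ∈ Metric.ball v₀ r, σ v ∈ S ∧ φ ℓ (σ v) ∈ S := by
  have hv₀ := mem_of_mem_nhds hV
  have hσ₀ : ContinuousAt σ v₀ := hσ.continuousAt hV
  have hcℓ : Continuous fun q => φ ℓ q := φ.continuous continuous_const continuous_id
  have hev : ∀ᶠ v in 𝓝 v₀, v ∈ V ∧
      (∀ t : ℝ, |t| ≤ ℓ + 1 → ∀ z : Circle, φ t (σ v) = z • σ v → t = 0) ∧
      σ v ∈ S ∧ φ ℓ (σ v) ∈ S :=
    (show ∀ᶠ v in 𝓝 v₀, v ∈ V from hV).and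
      ((hσ₀.eventually (ht.eventually_no_return (hσR _ hv₀) hno (ℓ + 1))).and
        ((hσ₀.eventually (hS.mem_nhds hS₀)).and
          (hσ₀.eventually ((hS.preimage hcℓ).mem_nhds hSℓ))))
  obtain ⟨r₁, hr₁, hball₁⟩ := Metric.mem_nhds_iff.1 hev
  have hT₁ : IsTube φ F R (Metric.ball v₀ r₁) σ ℓ :=
    { toral := ht
      isOpen := Metric.isOpen_ball
      cont := hσ.mono fun v hv => (hball₁ hv).1
      F_sec := fun v hv => hFσ v (hball₁ hv).1
      sec_mem := fun v hv => hσR v (hball₁ hv).1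
      pos := hℓ
      no_return := fun v hv => (hball₁ hv).2.1 }
  -- `W` and the open tube cover the central fibre, hence all fibres over a smaller disk.
  have hfib := eventually_fibre_subset ht.continuous_map hcompact hconn hσ₀
    (by filter_upwards [hV] with v hv using hFσ v hv)
    (hW.union (hT₁.isOpen_tube isOpen_Ioo)) (by
      intro q hq
      by_cases hqW : q ∈ W
      · exact Or.inl hqW
      · obtain ⟨x, hx, z, hz⟩ := hWσ q hq hqW
        refine Or.inr ?_
        rw [hz]
        exact hT₁.mem_tube (Metric.mem_ball_self hr₁) hx z)
  obtain ⟨r₂, hr₂, hball₂⟩ := Metric.mem_nhds_iff.1 hfib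
  have hle : Metric.ball v₀ (min r₁ r₂) ⊆ Metric.ball v₀ r₁ :=
    Metric.ball_subset_ball (min_le_left _ _)
  refine ⟨min r₁ r₂, lt_min hr₁ hr₂, fun v hv => (hball₁ (hle hv)).1,
    hT₁.mono hle Metric.isOpen_ball, fun q hq hqW => ?_, fun v hv => (hball₁ (hle hv)).2.2⟩
  have h1 := hball₂ (Metric.ball_subset_ball (min_le_right _ _) hq)
  rcases h1 (rfl : q ∈ F ⁻¹' {F q}) with h | h
  · exact absurd h hqW
  · exact ⟨hq, h.2⟩

end PinchedFibre

end

/-! ### Polar sets and the existence of small adapted pairs -/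

noncomputable section

section Poles

variable {M : Type*} [TopologicalSpace M] [T2Space M]
  [ChartedSpace E4 M] [IsManifold (𝓡 4) ∞ M] [MulAction Circle M]
  {w : (p : M) → TangentSpace (𝓡 4) p →L[ℝ] TangentSpace (𝓡 4) p →L[ℝ] ℝ}
  {H J : M → ℝ} {XH XJ : (p : M) → TangentSpace (𝓡 4) p}

/-- If two independent vectors span the kernel of `A` and are killed by `B`, then so is the
kernel. -/
lemma finrank_map_ker_eq_zero {A B : E4 →L[ℝ] ℝ × ℝ} (hA : Function.Surjective A) {u v : E4}
    (hu : A u = 0) (hv : A v = 0) (hBu : B u = 0) (hBv : B v = 0)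
    (huv : ∀ a b : ℝ, a • u + b • v = 0 → a = 0 ∧ b = 0) :
    Module.finrank ℝ ((LinearMap.ker A.toLinearMap).map B.toLinearMap) = 0 := by
  obtain ⟨π, hπu, hπv, e, he⟩ := exists_complementary_coordinates hA hu hv huv
  have hev : ∀ x, e x = (A x, π x) := fun x => DFunLike.congr_fun he x
  have h : (LinearMap.ker A.toLinearMap).map B.toLinearMap = ⊥ := by
    rw [Submodule.eq_bot_iff]
    rintro _ ⟨x, hx, rfl⟩
    have hx' : A x = 0 := hx
    have hsplit : x = (π x).1 • u + (π x).2 • v := by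
      apply e.injective
      rw [map_add, map_smul, map_smul, hev, hev, hev, hx', hu, hv, hπu, hπv]
      ext <;> simp
    show B x = 0
    rw [hsplit, map_add, map_smul, map_smul, hBu, hBv, smul_zero, smul_zero, add_zero]
  rw [h, finrank_bot]

/-- The derivative of a map that vanishes along an integral curve kills the field. -/
lemma mfderiv_eq_zero_of_integralCurve {g : M → ℝ × ℝ} {X : (p : M) → TangentSpace (𝓡 4) p}
    {γ : ℝ → M} (hγ : IsMIntegralCurve (I := 𝓡 4) γ X) {t : ℝ}
    (hg : MDifferentiableAt (𝓡 4) 𝓘(ℝ, ℝ × ℝ) g (γ t)) (h0 : ∀ᶠ s in 𝓝 t, g (γ s) = 0) :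
    mfderiv (𝓡 4) 𝓘(ℝ, ℝ × ℝ) g (γ t) (X (γ t)) = (0 : ℝ × ℝ) := by
  have h1 := hg.hasMFDerivAt.comp t (hγ t)
  have h2 : HasMFDerivAt 𝓘(ℝ, ℝ) 𝓘(ℝ, ℝ × ℝ) (fun _ : ℝ => (0 : ℝ × ℝ)) t 0 := hasMFDerivAt_const _ _
  have h3 := h2.congr_of_eventuallyEq (f₁ := g ∘ γ) h0
  have h4 := hasMFDerivAt_unique h1 h3
  have h5 := DFunLike.congr_fun h4 (1 : ℝ)
  refine Eq.trans ?_ h5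
  exact (congrArg (mfderiv (𝓡 4) 𝓘(ℝ, ℝ × ℝ) g (γ t)) (one_smul ℝ (X (γ t)))).symm

/-- Orbits through regular points of the fibres are not contained in the polar set. -/
theorem IsTransversalPolarSet.exists_flow_notMem (hw : IsSymplecticForm w)
    (hH : ContMDiff (𝓡 4) 𝓘(ℝ, ℝ) ∞ H) (hJ : ContMDiff (𝓡 4) 𝓘(ℝ, ℝ) ∞ J)
    (hXH : IsHamiltonianField w H XH) (hXJ : IsHamiltonianCircleAction w J XJ)
    (hinv : ∀ (z : Circle) (p : M), H (z • p) = H p)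
    {φ : Flow ℝ M} (hφ : ∀ p, IsMIntegralCurve (I := 𝓡 4) (fun t => φ t p) XH) {P : Set M}
    (htr : IsTransversalPolarSet (fun p => (H p, J p)) P) (hP : ∀ (z : Circle), ∀ p ∈ P, z • p ∈ P)
    {p : M} (hreg : ∀ t, IsRegularPt (fun p => (H p, J p)) (φ t p))
    (hfix : ∀ t, ∃ z : Circle, z • φ t p ≠ φ t p) {a b : ℝ} (hab : a < b) :
    ∃ t ∈ Ioo a b, φ t p ∉ P := by
  by_contra! hall
  have := hXJ.continuousSMul
  obtain ⟨m, hm⟩ : (Ioo a b).Nonempty := nonempty_Ioo.2 hab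
  set q := φ m p with hq
  obtain ⟨N, g, hNo, hqN, hg, hgP, hgs, hrank⟩ := htr q (hall m hm) (hfix m)
  have hgd : MDifferentiableAt (𝓡 4) 𝓘(ℝ, ℝ × ℝ) g q :=
    (hg.contMDiffAt (hNo.mem_nhds hqN)).mdifferentiableAt (by simp)
  -- Through `q` the set `P` contains an arc of the flow and, by invariance, the circle orbit. Both
  -- fields thus lie in `ker dg`, and being independent they span it. Since `dF` kills them, its
  -- rank on `P` would be 0 and not 1.
  have hgH : mfderiv (𝓡 4) 𝓘(ℝ, ℝ × ℝ) g q (XH q) = (0 : ℝ × ℝ) := by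
    refine mfderiv_eq_zero_of_integralCurve (γ := fun t => φ t p) (hφ p) (t := m) hgd ?_
    have h1 : ∀ᶠ s in 𝓝 m, φ s p ∈ N :=
      ((hφ p).continuous.tendsto m).eventually (hNo.mem_nhds hqN)
    filter_upwards [h1, Ioo_mem_nhds hm.1 hm.2] with s h1 h2
    exact (hgP _ h1).1 (hall s h2)
  have hgJ : mfderiv (𝓡 4) 𝓘(ℝ, ℝ × ℝ) g q (XJ q) = (0 : ℝ × ℝ) := by
    have hc := hXJ.generator q
    have he : Circle.exp 0 • q = q := by simp
    have h0 : ∀ᶠ s in 𝓝 (0 : ℝ), g (Circle.exp s • q) = 0 := by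
      have h1 : ∀ᶠ s in 𝓝 (0 : ℝ), Circle.exp s • q ∈ N :=
        (hc.continuous.tendsto 0).eventually (hNo.mem_nhds (by rw [he]; exact hqN))
      filter_upwards [h1] with s h1
      exact (hgP _ h1).1 (hP _ _ (hall m hm))
    have key : ∀ r, r = q → (mfderiv (𝓡 4) 𝓘(ℝ, ℝ × ℝ) g r (XJ r) = (0 : ℝ × ℝ)) →
        mfderiv (𝓡 4) 𝓘(ℝ, ℝ × ℝ) g q (XJ q) = (0 : ℝ × ℝ) := by
      rintro r rfl h
      exact h
    have hgd' : MDifferentiableAt (𝓡 4) 𝓘(ℝ, ℝ × ℝ) g (Circle.exp 0 • q) := by rw [he]; exact hgd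
    exact key _ he
      (mfderiv_eq_zero_of_integralCurve (γ := fun t => Circle.exp t • q) hc (t := 0) hgd' h0)
  have hFH : mfderiv (𝓡 4) 𝓘(ℝ, ℝ × ℝ) (fun p => (H p, J p)) q (XH q) = (0 : ℝ × ℝ) := by
    rw [mfderiv_pair hH hJ]
    exact Prod.ext ((hXH q _).symm.trans (hw.alternating q _))
      (mfderiv_momentum_field hw hXJ hH hinv hXH q)
  have hFJ : mfderiv (𝓡 4) 𝓘(ℝ, ℝ × ℝ) (fun p => (H p, J p)) q (XJ q) = (0 : ℝ × ℝ) := by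
    rw [mfderiv_pair hH hJ]
    exact Prod.ext (mfderiv_generator_eq_zero hH hinv hXJ q)
      ((hXJ.momentum q _).symm.trans (hw.alternating q _))
  have h0 := finrank_map_ker_eq_zero (A := mfderiv (𝓡 4) 𝓘(ℝ, ℝ × ℝ) g q)
    (B := mfderiv (𝓡 4) 𝓘(ℝ, ℝ × ℝ) (fun p => (H p, J p)) q) hgs (u := XH q) (v := XJ q) hgH hgJ hFH
    hFJ fun a b hab => hamiltonian_fields_independent hH hJ hXH hXJ.momentum (hreg m) hab
  exact zero_ne_one (h0.symm.trans hrank)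

/-- There are arbitrarily small adapted pairs. -/
theorem IsFocusFocus.exists_isAdaptedPair (hw : IsSymplecticForm w)
    (hH : ContMDiff (𝓡 4) 𝓘(ℝ, ℝ) ∞ H) (hJ : ContMDiff (𝓡 4) 𝓘(ℝ, ℝ) ∞ J)
    (hXH : IsHamiltonianField w H XH) (hXJ : IsHamiltonianCircleAction w J XJ)
    (hfree : ∀ p : M, (∀ z : Circle, z • p = p) ∨ ∀ z : Circle, z • p = p → z = 1)
    (hinv : ∀ (z : Circle) (p : M), H (z • p) = H p)
    {φ : Flow ℝ M} (hφ : ∀ p, IsMIntegralCurve (I := 𝓡 4) (fun t => φ t p) XH)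
    (huniq : ∀ γ : ℝ → M, IsMIntegralCurve (I := 𝓡 4) γ XH → ∀ t, γ t = φ t (γ 0))
    (hcompact : ∀ v, IsCompact ((fun p => (H p, J p)) ⁻¹' {v}))
    (hconn : ∀ v, IsPreconnected ((fun p => (H p, J p)) ⁻¹' {v}))
    {pbar : M} (hff : IsFocusFocus (fun p => (H p, J p)) pbar)
    {U P : Set M} (hU : IsOpen U) (hpU : pbar ∈ U) (hUinv : ∀ (z : Circle), ∀ p ∈ U, z • p ∈ U)
    (hPU : P ⊆ U) (hS : IsOpen (U \ P)) (hSinv : ∀ (z : Circle), ∀ p ∈ U \ P, z • p ∈ U \ P)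
    (htr : IsTransversalPolarSet (fun p => (H p, J p)) P) {W : Set M} (hW : W ∈ 𝓝 pbar) :
    ∃ (B : Set M) (D : Set (ℝ × ℝ)), B ⊆ W ∧
      IsAdaptedPair (fun p => (H p, J p)) pbar U P B D := by
  have := hXJ.continuousSMul
  have : LocallyCompactSpace M := ChartedSpace.locallyCompactSpace E4 M
  obtain ⟨V, hV, hreg⟩ := hff.isolated
  obtain ⟨hzbar, ht⟩ := IsFocusFocus.isToralFlow hw hH hJ hXH hXJ hfree hinv hφ huniq
    hff.rank_zero hreg
  set F : M → ℝ × ℝ := fun p => (H p, J p) with hF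
  set R := {p | (H p, J p) ∈ V ∧ p ≠ pbar} with hR
  have hPinv : ∀ (z : Circle), ∀ p ∈ P, z • p ∈ P := fun z p hp => by
    by_contra hn
    have := hSinv z⁻¹ _ ⟨hUinv z p (hPU hp), hn⟩
    rw [inv_smul_smul] at this
    exact this.2 hp
  -- the pinched fibre is a single orbit
  set C : Set M := {p | F p = F pbar ∧ p ≠ pbar} with hC
  have hCR : C ⊆ R := fun p hp => ⟨by
    have h1 := mem_of_mem_nhds hV
    have h2 : (H p, J p) = (H pbar, J pbar) := hp.1
    rwa [← h2] at h1, hp.2⟩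
  obtain ⟨e⟩ := hff.pinched
  obtain ⟨p₀, hp₀, horb, hno⟩ := ht.exists_orbit_of_cylinder hCR
    (fun p hp q hq => hp.1.trans hq.1.symm)
    (fun p hp x z => ⟨by rw [ht.map_action, ht.map_flow, hp.1],
      (ht.smul_mem z _ (ht.flow_mem x _ (hCR hp))).2⟩) e
  set W' := interior W ∩ U with hW'
  have hW'o : IsOpen W' := isOpen_interior.inter hU
  have hpW' : pbar ∈ W' := ⟨mem_interior_iff_mem_nhds.2 hW, hpU⟩
  have hKC : F ⁻¹' {F pbar} \ W' ⊆ C := fun q hq => ⟨hq.1, fun he => hq.2 (he ▸ hpW')⟩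
  -- Outside `W'` the pinched fibre is compact and avoids `pbar`, so it is reached in time at most
  -- `N`; the orbit of `p₀` is in `W'` before `-N` and after `N`.
  obtain ⟨N, hN, hbound⟩ := ht.exists_time_bound hno ((hcompact (F pbar)).diff hW'o)
    (hKC.trans hCR) fun q hq => horb q (hKC hq)
  have hW'φ : ∀ x, N < |x| → φ x p₀ ∈ W' := fun x hx => by
    by_contra hn
    have := hbound (φ x p₀) ⟨(ht.map_flow x p₀).trans hp₀.1, hn⟩ x 1 (one_smul _ _).symm
    linarith
  -- ends of the tube outside the polar set
  have hfix : ∀ t, ∃ z : Circle, z • φ t p₀ ≠ φ t p₀ := fun t => by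
    refine ⟨Circle.exp Real.pi, fun he => ?_⟩
    have h1 := ht.free _ (ht.flow_mem t _ (hCR hp₀)) _ he
    rw [circle_exp_eq_one_iff] at h1
    obtain ⟨n, hn⟩ := h1
    have h2 : (n : ℝ) * 2 = 1 := by
      have := Real.pi_pos
      apply mul_right_cancel₀ this.ne'
      linarith
    have h3 : n * 2 = 1 := by exact_mod_cast h2
    omega
  have hregφ : ∀ t, IsRegularPt F (φ t p₀) := fun t =>
    hreg _ (ht.flow_mem t _ (hCR hp₀)).1 (ht.flow_mem t _ (hCR hp₀)).2
  obtain ⟨L₂, hL₂, hL₂P⟩ := htr.exists_flow_notMem hw hH hJ hXH hXJ hinv hφ hPinv hregφ hfix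
    (lt_add_one N)
  obtain ⟨L₁, hL₁, hL₁P⟩ := htr.exists_flow_notMem hw hH hJ hXH hXJ hinv hφ hPinv hregφ hfix
    (a := -N - 1) (b := -N) (by linarith)
  -- a section through the start of the tube
  obtain ⟨-, -, -, -, σ₀, hσ₀, V₀, hV₀, hσ₀c, hFσ₀⟩ := exists_adapted_chart hH hJ hXH hXJ.momentum
    (fun p => (hXH p _).symm.trans (hw.alternating p _)) (mfderiv_generator_eq_zero hH hinv hXJ)
    (mfderiv_momentum_field hw hXJ hH hinv hXH)
    (fun p => (hXJ.momentum p _).symm.trans (hw.alternating p _))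
    (hreg p₀ (hCR hp₀).1 (hCR hp₀).2)
  have hFp₀ : (H p₀, J p₀) = F pbar := hp₀.1
  rw [hFp₀] at hσ₀ hV₀
  have hσ₀R : ∀ᶠ v in 𝓝 (F pbar), σ₀ v ≠ pbar := by
    have h1 : ContinuousAt σ₀ (F pbar) := hσ₀c.continuousAt hV₀
    refine h1.eventually (isOpen_ne.mem_nhds ?_)
    rw [hσ₀]
    exact hp₀.2
  set V' := V ∩ (V₀ ∩ {v | σ₀ v ≠ pbar}) with hV'
  have hV'n : V' ∈ 𝓝 (F pbar) := inter_mem hV (inter_mem hV₀ hσ₀R)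
  set σ : ℝ × ℝ → M := fun v => φ L₁ (σ₀ v) with hσ
  have hσφ : ∀ x, φ x (σ (F pbar)) = φ (x + L₁) p₀ := fun x => by
    rw [φ.map_add, hσ]
    simp only [hσ₀]
  obtain ⟨r, hr, hrV, hT, hWT, hTS⟩ := exists_isTube ht (hcompact (F pbar)) hconn (σ := σ) hV'n
    ((φ.continuous continuous_const continuous_id).comp_continuousOn
      (hσ₀c.mono (inter_subset_right.trans inter_subset_left)))
    (fun v hv => (ht.map_flow _ _).trans (hFσ₀ v hv.2.1))
    (fun v hv => ht.flow_mem _ _ ⟨by rw [hFσ₀ v hv.2.1]; exact hv.1, hv.2.2⟩)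
    (fun x z he => hno x z (by
      rw [hσφ, add_comm, φ.map_add] at he
      have := congrArg (φ (-L₁)) he
      simp only [hσ, hσ₀, ht.map_smul, ← φ.map_add, neg_add_cancel, φ.map_zero_apply,
        neg_add_cancel_left] at this
      exact this))
    (ℓ := L₂ - L₁) (by linarith [hL₁.2, hL₂.1]) (W := W') (S := U \ P) hW'o
    (fun q hq hqW => by
      obtain ⟨x, z, hx⟩ := horb q (hKC ⟨hq, hqW⟩)
      have := abs_le.1 (hbound q ⟨hq, hqW⟩ x z hx)
      refine ⟨x - L₁, ⟨by linarith [hL₁.2], by linarith [hL₂.1]⟩, z, ?_⟩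
      rw [hσφ, sub_add_cancel, hx])
    hS
    (by
      have h1 : σ (F pbar) = φ L₁ p₀ := by simp only [hσ, hσ₀]
      rw [h1]
      exact ⟨(hW'φ L₁ (by rw [lt_abs]; right; linarith [hL₁.2])).2, hL₁P⟩)
    (by
      rw [hσφ, sub_add_cancel]
      exact ⟨(hW'φ L₂ (by rw [lt_abs]; left; exact hL₂.1)).2, hL₂P⟩)
  have hpair := hT.isLocalPair (pbar := pbar) (Metric.mem_ball_self hr) (fun h => h.2 rfl)
    (fun p hp hne => ⟨(hrV hp).1, hne⟩)
    ((convex_ball _ _).contractibleSpace ⟨_, Metric.mem_ball_self hr⟩)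
    (fun p hp hne => hreg p (hrV hp).1 hne) hcompact hconn
  -- Points over the disk outside `W'` are in the open tube, so the ball is inside `W` and its
  -- closure over the disk inside `U`. The boundary circles consist of rotated tube ends, which lie
  -- in the invariant set `U \ P`.
  refine ⟨_, _, fun p hp => ?_, ⟨hpair, fun p hp => ?_, ?_⟩⟩
  · by_contra hn
    have h1 := hWT p hp.1 fun h => hn (interior_subset h.1)
    obtain ⟨h2, x, hx, h3⟩ := h1
    exact hp.2 ⟨h2, x, Ioo_subset_Icc_self hx, h3⟩
  · by_contra hn
    exact (hT.mem_closure_ball_iff hp.1).1 hp.2 (hWT p hp.1 fun h => hn h.2)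
  · rw [eq_empty_iff_forall_notMem]
    rintro p ⟨⟨hpD, hp⟩, hpP⟩
    obtain ⟨-, x, hx, z, hz⟩ := (hT.mem_frontier_ball_iff hpD).1 hp
    have h1 : φ x (σ (F p)) ∈ U \ P := by
      rcases hx with rfl | rfl
      · rw [φ.map_zero_apply]; exact (hTS _ hpD).1
      · exact (hTS _ hpD).2
    have h2 := hSinv z _ h1
    rw [← hz] at h2
    exact h2.2 hpP

end Poles

end

theorem mainTheorem3
    {M : Type*} [TopologicalSpace M] [T2Space M] [SecondCountableTopology M]
    [ChartedSpace E4 M] [IsManifold (𝓡 4) ∞ M] [MulAction Circle M]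
    (w : (p : M) → TangentSpace (𝓡 4) p →L[ℝ] TangentSpace (𝓡 4) p →L[ℝ] ℝ)
    (hw : IsSymplecticForm w)
    (H J : M → ℝ)
    (hH : ContMDiff (𝓡 4) 𝓘(ℝ, ℝ) ∞ H) (hJ : ContMDiff (𝓡 4) 𝓘(ℝ, ℝ) ∞ J)
    (XH XJ : (p : M) → TangentSpace (𝓡 4) p)
    (hXH : IsHamiltonianField w H XH)
    (hXJ : IsHamiltonianCircleAction w J XJ)
    (hfree : ∀ p : M, (∀ z : Circle, z • p = p) ∨ ∀ z : Circle, z • p = p → z = 1)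
    (hinv : ∀ (z : Circle) (p : M), H (z • p) = H p)
    (F : M → ℝ × ℝ) (hF : F = fun p => (H p, J p))
    (hcompact : ∀ v, IsCompact (F ⁻¹' {v}))
    (hconnected : ∀ v, IsPreconnected (F ⁻¹' {v}))
    (pbar : M) (hff : IsFocusFocus F pbar)
    -- a rotation form on a neighbourhood `U` of the focus-focus point minus the polar set `P`
    (U P : Set M) (hU : IsOpen U) (hpU : pbar ∈ U)
    (hUinv : ∀ (z : Circle), ∀ p ∈ U, z • p ∈ U) (hPU : P ⊆ U)
    (θ : (p : M) → TangentSpace (𝓡 4) p →L[ℝ] ℝ)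
    (hθ : IsRotationForm XJ θ (U \ P))
    (htr : IsTransversalPolarSet F P) :
    -- there are arbitrarily small adapted pairs
    (∀ W ∈ 𝓝 pbar, ∃ (B : Set M) (D : Set (ℝ × ℝ)), B ⊆ W ∧ IsAdaptedPair F pbar U P B D) ∧
    ∀ (B : Set M) (D : Set (ℝ × ℝ)), IsAdaptedPair F pbar U P B D →
      -- `Φ_rel` is well defined on the fibres that have no poles in `B`
      (∀ v ∈ D, v ≠ F pbar → (∀ p ∈ B, F p = v → p ∉ P) →
        (∀ p ∈ B, F p = v → ∃ (γ : ℝ → M) (a b : ℝ),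
          IsRelSegment XH B γ a b ∧ a < 0 ∧ 0 < b ∧ γ 0 = p) ∧
        ∀ (γ : ℝ → M) (a b : ℝ), IsRelSegment XH B γ a b → F (γ a) = v →
          IntervalIntegrable (fun t => θ (γ t) (XH (γ t))) volume a b ∧
          ∫ t in a..b, θ (γ t) (XH (γ t)) = phiRel F XH θ B v) ∧
      -- the variation of `Φ_rel` along a closed path that meets finitely many polar values
      ∀ Γ : ℝ → ℝ × ℝ, Continuous Γ → (∀ s, Γ (s + 1) = Γ s) →
        (∀ s, Γ s ∈ D \ {F pbar}) →
        {s ∈ Ico (0 : ℝ) 1 | Γ s ∈ F '' (P ∩ B)}.Finite →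
        (∃! k : ℤ, IsMonodromyNumber F XH Γ k) ∧
        ∀ k : ℤ, IsMonodromyNumber F XH Γ k →
          HasVariation (fun s => phiRel F XH θ B (Γ s)) (-2 * k * Real.pi) := by
  subst hF
  have := hXJ.continuousSMul
  obtain ⟨φ, hφ, huniq⟩ := exists_hamiltonian_flow hw hH hJ hXH hXJ hinv hcompact
  refine ⟨?_, fun B D hBD => ?_⟩
  · exact fun W hW => hff.exists_isAdaptedPair hw hH hJ hXH hXJ hfree hinv hφ huniq hcompact
      hconnected hU hpU hUinv hPU hθ.isOpen hθ.invariant htr hW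
  -- The disk of the adapted pair itself serves as the set of values without other critical points.
  · obtain ⟨-, ht⟩ := IsFocusFocus.isToralFlow hw hH hJ hXH hXJ hfree hinv hφ huniq hff.rank_zero
      hBD.regular
    obtain ⟨σ₁, σ₂, τB, τC, ζB, ζC, hT⟩ := hBD.toIsLocalPair.exists_transitSystem subset_rfl ht
    have hcont := hθ.continuousOn_pairing hw hH hXH
    refine ⟨fun v hv hne hvP => ?_, fun Γ hΓ hper hΓD hfin => ?_⟩
    · have hv' : v ∈ D \ {(H pbar, J pbar)} := ⟨hv, hne⟩
      exact ⟨fun p hp hF => hT.exists_relSegment ht hBD.isOpen_ball hBD.invariant hφ hv' hp hF,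
        fun γ a b hγ hF => hT.integral_eq_phiRel ht hBD.isOpen_ball hBD.invariant huniq
          hXJ.generator hθ hcont hBD.closure_subset hBD.no_boundary_poles hv' hvP hγ hF⟩
    · exact hT.existsUnique_monodromyNumber ht hBD.isOpen_ball hBD.invariant hφ huniq
        hXJ.generator hθ hcont hBD.closure_subset hBD.no_boundary_poles hBD.isOpen_disk
        hBD.contractible_disk (fun v hv => by
          have hF := hT.F_sec₁ v hv.1
          refine ⟨by rw [hF]; exact hv.1, fun he => hv.2 ?_⟩
          rw [← hF, he]; rfl) hΓ hper hΓD hfin
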